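/- All graphs are finite and simple. Let $G$ be a 2-connected graph on $n$ vertices (that is, $n\ge 3$, and $G$ is connected and remains connected after the deletion of any single vertex), and let $d(v)$ denote the degree of $v$ in $G$. For a graph $R$, call $G$ \emph{$R$-$f$-heavy} if for every induced subgraph $F$ of $G$ isomorphic to $R$ and all vertices $u,v\in V(F)$ with $d_F(u,v)=2$ (distance measured in $F$) one has $\max\{d(u),d(v)\}\ge n/2$. Let $P_7$ be the path on seven vertices; let the deer $D$ be the graph on seven vertices obtained from a triangle $abc$ by attaching a path with two edges at $b$ and another, disjoint, path with two edges at $c$; and let the hourglass $H$ be the graph on five vertices formed by two triangles sharing exactly one vertex. If $G$ is $R$-$f$-heavy for every $R\in\{K_{1,3},P_7,D\}$, or $G$ is $R$-$f$-heavy for every $R\in\{K_{1,3},P_7,H\}$, then $G$ is Hamiltonian, i.e. $G$ has a cycle passing through all its vertices. -/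

import Mathlib

namespace FanHeavy

/-- A (finite) graph is 2-connected if it has at least three vertices, is connected,
and remains connected after the deletion of any single vertex. -/
def TwoConnected {V : Type*} [Fintype V] (G : SimpleGraph V) : Prop :=
  3 ≤ Fintype.card V ∧ G.Connected ∧ ∀ v : V, (G.induce {w : V | w ≠ v}).Connected

/-- The claw `K_{1,3}`. -/
def claw : SimpleGraph (Fin 1 ⊕ Fin 3) :=
  completeBipartiteGraph (Fin 1) (Fin 3)

/-- The path `P_7` on seven vertices. -/
def path7 : SimpleGraph (Fin 7) :=
  SimpleGraph.pathGraph 7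

/-- The deer: a triangle `0, 1, 2` with a path `1, 3, 4` attached at `1` and a path
`2, 5, 6` attached at `2`. -/
def deer : SimpleGraph (Fin 7) :=
  SimpleGraph.fromEdgeSet
    {s(0, 1), s(0, 2), s(1, 2), s(1, 3), s(3, 4), s(2, 5), s(5, 6)}

/-- The hourglass: two triangles `0, 1, 2` and `0, 3, 4` sharing exactly the vertex `0`. -/
def hourglass : SimpleGraph (Fin 5) :=
  SimpleGraph.fromEdgeSet
    {s(0, 1), s(0, 2), s(1, 2), s(0, 3), s(0, 4), s(3, 4)}

/-- The subgraph of `G` induced by `S` is `f`-heavy: any two of its vertices at distance 2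
(measured in the induced subgraph) satisfy `max {d(u), d(v)} ≥ n / 2`, where degrees are
taken in `G` and `n` is the number of vertices of `G`. -/
def IsFHeavy {V : Type*} [Fintype V] (G : SimpleGraph V) [DecidableRel G.Adj]
    (S : Set V) : Prop :=
  ∀ u v : S, (G.induce S).dist u v = 2 →
    (Fintype.card V : ℝ) / 2 ≤ max (G.degree (u : V) : ℝ) (G.degree (v : V) : ℝ)

/-- `G` is `R`-`f`-heavy: every induced subgraph of `G` isomorphic to `R` is `f`-heavy. -/
def IsFHeavyFor {W V : Type*} [Fintype V] (R : SimpleGraph W) (G : SimpleGraph V)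
    [DecidableRel G.Adj] : Prop :=
  ∀ S : Set V, Nonempty (R ≃g G.induce S) → IsFHeavy G S

end FanHeavy

/-! Call a vertex heavy if its degree is at least half the order. The hypotheses permit claws, long
paths, deer or hourglasses in `G` provided enough of their vertices are heavy, so the proof replaces
`G` by a closure in which these exceptions disappear. `star G` is the least graph above `G` in which
two common neighbours of adjacent vertices are adjacent and heavy vertices are pairwise adjacent. In
a claw of `G` two leaves are heavy, and this suffices for `star_spec`: a spanning cycle of `star G`
can be pulled back to `G`, by Ore's crossing argument for heavy pairs and a rerouting argument
(`HamPath.hamL_of_diamond`) for local completions. Moreover `star G` is claw-free (`star_claw`), and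
each of its edges lies in exactly one maximal clique `clq`.

Leastness returns information to `G`: inside every maximal clique of `star G` the graph `G` is
connected, and two nonadjacent heavy vertices of `G` have a common neighbour that is simplicial in
`star G`. Hence an induced path of `star G` is followed by an induced path of `G` that is at least
as long and stays near it (`exists_follows`). If such a path were long, the hypothesis would give
heavy vertices near two nonadjacent parts of it, although heavy vertices are adjacent in `star G`.
So `star G` has no induced path on seven vertices (`star_indPath_length`), and the triangle vertices
carrying the legs of a deer in it are heavy (`star_deer_heavy`). With the hourglass instead, of two
triangles of `star G` meeting in one vertex one lies in a clique with two heavy vertices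
(`star_hourglass_heavy`), and there is only one such clique.

If `star G` had no spanning cycle, take a longest cycle and a path outside it joining two of its
vertices `u` and `v`, with one arc between them as short as possible. Absence of claws and of long
induced paths forces the local picture `EndConf`. There the deer lemma makes the nonadjacent
vertices `u` and `b` both heavy, while the hourglass lemma at `a`, `u` and `b` puts `u` and `b` into
one clique. Either way there is a contradiction. -/

namespace FanHeavy

/-! ### Walks, closed walks and induced paths as vertex lists -/

section ListBasics

variable {V : Type*}

/-- `l` is a walk of `H` from `x` to `y`, given as a list of vertices. -/
def Pth (H : SimpleGraph V) (l : List V) (x y : V) : Prop :=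
  l.IsChain H.Adj ∧ l.head? = some x ∧ l.getLast? = some y

/-- `l` is the vertex list of a closed walk of `H`. -/
def Cyc (H : SimpleGraph V) (l : List V) : Prop :=
  ∃ x y, Pth H l x y ∧ H.Adj y x

/-- `H` has a closed vertex list containing every vertex exactly once. -/
def HamL (H : SimpleGraph V) : Prop :=
  ∃ l : List V, l.Nodup ∧ (∀ v, v ∈ l) ∧ Cyc H l

variable {H M : SimpleGraph V} {l l₁ l₂ : List V} {x y z w a b : V}

theorem Pth.singleton (H : SimpleGraph V) (x : V) : Pth H [x] x x := by
  simp [Pth]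

theorem Pth.ne_nil (h : Pth H l x y) : l ≠ [] := by
  rintro rfl; simp [Pth] at h

theorem Pth.mono (h : Pth H l x y) (hle : H ≤ M) : Pth M l x y :=
  ⟨h.1.imp (fun _ _ hab => hle hab), h.2⟩

theorem Pth.head_mem (h : Pth H l x y) : x ∈ l := List.mem_of_head? h.2.1

theorem Pth.last_mem (h : Pth H l x y) : y ∈ l := List.mem_of_getLast? h.2.2

theorem Pth.append (h₁ : Pth H l₁ x y) (h : H.Adj y z) (h₂ : Pth H l₂ z w) :
    Pth H (l₁ ++ l₂) x w := by
  refine ⟨List.isChain_append.2 ⟨h₁.1, h₂.1, ?_⟩, ?_, ?_⟩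
  · intro p hp q hq
    rw [h₁.2.2] at hp; rw [h₂.2.1] at hq
    simp only [Option.mem_def, Option.some.injEq] at hp hq
    subst hp hq; exact h
  · simp [List.head?_append, h₁.2.1]
  · simp [List.getLast?_append, h₂.2.2]

theorem Pth.cons (h : H.Adj x y) (h₂ : Pth H l y z) : Pth H (x :: l) x z :=
  (Pth.singleton H x).append h h₂

theorem Pth.concat (h₁ : Pth H l x y) (h : H.Adj y z) : Pth H (l ++ [z]) x z :=
  h₁.append h (Pth.singleton H z)

theorem Pth.reverse (h : Pth H l x y) : Pth H l.reverse y x := by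
  refine ⟨List.isChain_reverse.2 (h.1.imp fun _ _ hab => hab.symm), ?_, ?_⟩
  · simp [h.2.2]
  · simp [h.2.1]

theorem Pth.exists (h : l.IsChain H.Adj) (hn : l ≠ []) : ∃ x y, Pth H l x y :=
  ⟨l.head hn, l.getLast hn, h, List.head?_eq_some_head hn, List.getLast?_eq_some_getLast hn⟩

theorem Pth.of_append (h : Pth H (l₁ ++ l₂) x y) (h₁ : l₁ ≠ []) (h₂ : l₂ ≠ []) :
    ∃ a b, Pth H l₁ x a ∧ H.Adj a b ∧ Pth H l₂ b y := by
  obtain ⟨hc, hx, hy⟩ := h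
  obtain ⟨c1, c2, c3⟩ := List.isChain_append.1 hc
  obtain ⟨p, q, hp⟩ := Pth.exists c1 h₁
  obtain ⟨r, s, hr⟩ := Pth.exists c2 h₂
  rw [List.head?_append, hp.2.1] at hx
  rw [List.getLast?_append, hr.2.2] at hy
  simp only [Option.some_or, Option.some.injEq] at hx hy
  subst hx hy
  exact ⟨q, r, hp, c3 q hp.2.2 r hr.2.1, hr⟩

theorem Pth.tail_of_cons (h : Pth H (a :: l) x y) (hl : l ≠ []) :
    a = x ∧ ∃ b, H.Adj a b ∧ Pth H l b y := by
  obtain ⟨p, q, hp, hpq, hq⟩ := Pth.of_append (l₁ := [a]) h (by simp) hl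
  have h1 := hp.2.1
  have h2 := hp.2.2
  simp only [List.head?_cons, Option.some.injEq, List.getLast?_singleton] at h1 h2
  subst h2
  exact ⟨h1, q, hpq, hq⟩

theorem Pth.head_eq (h : Pth H (a :: l) x y) : a = x := by
  have := h.2.1; simpa using this

theorem Pth.last_eq (h : Pth H (l ++ [a]) x y) : a = y := by
  have := h.2.2; simpa using this

theorem Pth.split (h : Pth H (l₁ ++ a :: l₂) x y) :
    Pth H (l₁ ++ [a]) x a ∧ Pth H (a :: l₂) a y := by
  rcases eq_or_ne l₁ [] with rfl | h1
  · have := h.head_eq; subst this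
    exact ⟨Pth.singleton H _, h⟩
  · obtain ⟨p, q, hp, hpq, hq⟩ := Pth.of_append h h1 (by simp)
    have := hq.head_eq; subst this
    exact ⟨hp.concat hpq, hq⟩

theorem Cyc.mono (h : Cyc H l) (hle : H ≤ M) : Cyc M l := by
  obtain ⟨x, y, h1, h2⟩ := h
  exact ⟨x, y, h1.mono hle, hle h2⟩

theorem HamL.mono (h : HamL H) (hle : H ≤ M) : HamL M := by
  obtain ⟨l, h1, h2, h3⟩ := h
  exact ⟨l, h1, h2, h3.mono hle⟩

theorem Cyc.rotate (h : Cyc H (l₁ ++ l₂)) : Cyc H (l₂ ++ l₁) := by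
  rcases eq_or_ne l₁ [] with rfl | h1
  · simpa using h
  rcases eq_or_ne l₂ [] with rfl | h2
  · simpa using h
  obtain ⟨x, y, h, hyx⟩ := h
  obtain ⟨p, q, hp, hpq, hq⟩ := h.of_append h1 h2
  exact ⟨q, p, hq.append hyx hp, hpq⟩

/-- Duplicate-freeness can be checked on multiplicities. -/
theorem nodup_of_count [DecidableEq V] {L L' : List V} (h : L.Nodup)
    (hc : ∀ a, L'.count a ≤ L.count a) : L'.Nodup := by
  rw [List.nodup_iff_count_le_one] at h ⊢
  exact fun a => (hc a).trans (h a)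

/-- `l` is the vertex list of an induced path of `H`. -/
def IndPath (H : SimpleGraph V) : List V → Prop
  | [] => True
  | [_] => True
  | x :: y :: l => H.Adj x y ∧ (∀ z ∈ l, ¬ H.Adj x z ∧ x ≠ z) ∧ IndPath H (y :: l)

theorem IndPath.tail : ∀ {l : List V} {x : V}, IndPath H (x :: l) → IndPath H l
  | [], _, _ => trivial
  | _ :: _, _, h => h.2.2

theorem IndPath.isChain : ∀ {l : List V}, IndPath H l → l.IsChain H.Adj
  | [], _ => List.isChain_nil
  | [_], _ => List.isChain_singleton _
  | _ :: _ :: _, h => List.isChain_cons_cons.2 ⟨h.1, IndPath.isChain h.2.2⟩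

theorem IndPath.nodup : ∀ {l : List V}, IndPath H l → l.Nodup
  | [], _ => List.nodup_nil
  | [_], _ => List.nodup_singleton _
  | _ :: _ :: _, h => by
    refine List.nodup_cons.2 ⟨?_, IndPath.nodup h.2.2⟩
    intro hm
    rcases List.mem_cons.1 hm with h1 | h1
    · exact h.1.ne h1
    · exact (h.2.1 _ h1).2 rfl

theorem indPath_append : ∀ {l₁ l₂ : List V} {x : V},
    IndPath H (l₁ ++ x :: l₂) ↔ IndPath H (l₁ ++ [x]) ∧ IndPath H (x :: l₂) ∧
      ∀ a ∈ l₁, ∀ b ∈ l₂, ¬ H.Adj a b ∧ a ≠ b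
  | [], l₂, x => by simp [IndPath]
  | [p], l₂, x => by simp [IndPath]; tauto
  | p :: q :: l, l₂, x => by
    have ih := @indPath_append (q :: l) l₂ x
    simp only [List.cons_append] at ih
    simp only [List.cons_append, IndPath, ih]
    simp only [List.mem_append, List.mem_cons]
    constructor
    · rintro ⟨h1, h2, h3, h4, h5⟩
      refine ⟨⟨h1, fun z hz => h2 z ?_, h3⟩, h4, ?_⟩
      · simp at hz; tauto
      · rintro a (rfl | ha) b hb
        · exact h2 b (by tauto)
        · exact h5 a ha b hb
    · rintro ⟨⟨h1, h2, h3⟩, h4, h5⟩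
      refine ⟨h1, ?_, h3, h4, fun a ha => h5 a (Or.inr ha)⟩
      rintro z (hz | rfl | hz)
      · exact h2 z (Or.inl hz)
      · exact h2 _ (by simp)
      · exact h5 p (Or.inl rfl) z hz

theorem IndPath.left (h : IndPath H (l₁ ++ l₂)) : IndPath H l₁ := by
  induction l₁ using List.reverseRecOn with
  | nil => trivial
  | append_singleton l a _ =>
    rw [List.append_assoc] at h
    exact (indPath_append.1 h).1

theorem IndPath.right (h : IndPath H (l₁ ++ l₂)) : IndPath H l₂ := by
  induction l₁ with
  | nil => exact h
  | cons a l ih => exact ih (IndPath.tail h)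

theorem exists_split_last (P : V → Prop) (l : List V) (h : ∃ z ∈ l, P z) :
    ∃ l₁ z l₂, l = l₁ ++ z :: l₂ ∧ P z ∧ ∀ w ∈ l₂, ¬ P w := by
  induction l with
  | nil => simp at h
  | cons a l ih =>
    by_cases h2 : ∃ z ∈ l, P z
    · obtain ⟨l₁, z, l₂, rfl, h3, h4⟩ := ih h2
      exact ⟨a :: l₁, z, l₂, rfl, h3, h4⟩
    · push Not at h2
      obtain ⟨z, hz, hP⟩ := h
      rcases List.mem_cons.1 hz with rfl | hz
      · exact ⟨[], z, l, rfl, hP, h2⟩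
      · exact absurd hP (h2 z hz)

theorem exists_split_first (P : V → Prop) (l : List V) (h : ∃ z ∈ l, P z) :
    ∃ l₁ z l₂, l = l₁ ++ z :: l₂ ∧ P z ∧ ∀ w ∈ l₁, ¬ P w := by
  obtain ⟨l₁, z, l₂, h1, h2, h3⟩ := exists_split_last P l.reverse (by simpa using h)
  refine ⟨l₂.reverse, z, l₁.reverse, ?_, h2, by simpa using h3⟩
  have := congrArg List.reverse h1
  simpa using this

/-- A walk contains an induced path with the same ends. -/
theorem Pth.exists_indPath : ∀ {l : List V} {x : V}, Pth H l x y →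
    ∃ l', l'.Sublist l ∧ Pth H l' x y ∧ IndPath H l'
  | [], _, h => absurd rfl h.ne_nil
  | [a], _, h => ⟨[a], List.Sublist.refl _, h, trivial⟩
  | a :: b :: l, x, h => by
    obtain ⟨hax, c, hc, ht⟩ := h.tail_of_cons (by simp)
    subst hax
    obtain ⟨l', hs, hp, hi⟩ := Pth.exists_indPath ht
    by_cases ha : a ∈ l'
    · obtain ⟨l₁, l₂, rfl⟩ := List.append_of_mem ha
      exact ⟨a :: l₂, ((List.sublist_append_right _ _).trans hs).cons a, hp.split.2, hi.right⟩
    obtain ⟨l₁, z, l₂, rfl, hz, hz2⟩ := exists_split_last (H.Adj a) l' ⟨c, hp.head_mem, hc⟩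
    refine ⟨a :: z :: l₂, ?_, Pth.cons hz hp.split.2, hz, ?_, hi.right⟩
    · exact ((List.sublist_append_right _ _).trans hs).cons_cons a
    · intro w hw
      refine ⟨hz2 w hw, ?_⟩
      rintro rfl
      exact ha (by simp [hw])

theorem IndPath.adj_getElem_iff : ∀ {l : List V}, IndPath H l → ∀ {i j : ℕ} (hi : i < l.length)
    (hj : j < l.length), i < j → (H.Adj l[i] l[j] ↔ j = i + 1)
  | [], _, i, _, hi, _, _ => absurd hi (by simp)
  | [_], _, i, j, hi, hj, hij => by simp at hj; omega
  | x :: y :: l, h, 0, 0, _, _, hij => absurd hij (by simp)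
  | x :: y :: l, h, 0, 1, _, _, _ => by simpa using h.1
  | x :: y :: l, h, 0, j + 2, _, hj, _ => by
    simp only [List.getElem_cons_zero, List.getElem_cons_succ]
    simp only [List.length_cons] at hj
    exact iff_of_false (h.2.1 _ (List.getElem_mem (by omega))).1 (by omega)
  | x :: y :: l, h, i + 1, 0, _, _, hij => absurd hij (by simp)
  | x :: y :: l, h, i + 1, j + 1, hi, hj, hij => by
    have := IndPath.adj_getElem_iff h.2.2 (i := i) (j := j) (by simpa using hi) (by simpa using hj)
      (by omega)
    simp only [List.getElem_cons_succ]
    rw [this]; omega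

end ListBasics

/-! ### From spanning closed lists to Hamiltonian cycles -/

section Hamiltonian

variable {V : Type*} [Fintype V] [DecidableEq V]

/-- A spanning closed vertex list yields a Hamiltonian cycle. -/
theorem HamL.isHamiltonian {G : SimpleGraph V} (h : HamL G) (h3 : 3 ≤ Fintype.card V) :
    G.IsHamiltonian := by
  intro _
  obtain ⟨l, hn, hall, x, y, hp, hyx⟩ := h
  obtain ⟨t, rfl⟩ : ∃ t, l = x :: t := by
    cases l with
    | nil => exact absurd rfl hp.ne_nil
    | cons a t => exact ⟨t, by rw [hp.head_eq]⟩
  have hlen : (x :: t).length = Fintype.card V := by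
    have : (x :: t).toFinset = Finset.univ := by ext v; simpa using hall v
    rw [← List.toFinset_card_of_nodup hn, this, Finset.card_univ]
  have hc : (x :: (t ++ [x])).IsChain G.Adj := (hp.concat hyx).1
  obtain ⟨p, hps⟩ : ∃ p : G.Walk x x, p.support = x :: (t ++ [x]) := by
    refine ⟨(SimpleGraph.Walk.ofSupport (x :: (t ++ [x])) (List.cons_ne_nil _ _) hc).copy
      (List.head_cons) (by simp), ?_⟩
    rw [SimpleGraph.Walk.support_copy, SimpleGraph.Walk.support_ofSupport]
  have hnt : (t ++ [x]).Nodup := by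
    rw [List.nodup_append_comm]; exact hn
  have htail : p.support.tail = t ++ [x] := by rw [hps]; rfl
  have hlen2 : p.length = Fintype.card V := by
    have := p.length_support
    rw [hps] at this
    simp at this hlen
    omega
  refine ⟨x, p, ?_⟩
  rw [SimpleGraph.Walk.isHamiltonianCycle_iff_isCycle_and_support_count_tail_eq_one]
  constructor
  · rw [SimpleGraph.Walk.isCycle_iff_isPath_tail_and_le_length]
    refine ⟨?_, by omega⟩
    rw [SimpleGraph.Walk.isPath_def, SimpleGraph.Walk.support_tail_of_not_nil, htail]
    · exact hnt
    · intro hnil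
      have := SimpleGraph.Walk.length_eq_zero_iff.2 hnil
      omega
  · intro a
    rw [htail]
    refine List.count_eq_one_of_mem hnt ?_
    have := hall a
    simp at this ⊢
    tauto

end Hamiltonian

/-! ### Edges whose addition creates no spanning cycle -/

section BondyChvatal

variable {V : Type*} {H M L : SimpleGraph V} {l : List V} {x y z w a b p q : V}

/-- A duplicate-free list visits `y` and `z` once each, so it uses the extra edge at most once;
cutting there leaves two chains of `M`. -/
theorem isChain_add_edge {M' : SimpleGraph V}
    (hM : ∀ a b, M'.Adj a b → M.Adj a b ∨ (a = y ∧ b = z) ∨ (a = z ∧ b = y)) :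
    ∀ {l : List V}, l.Nodup → l.IsChain M'.Adj → l.IsChain M.Adj ∨
      ∃ l₁ l₂, l = l₁ ++ l₂ ∧ l₁.IsChain M.Adj ∧ l₂.IsChain M.Adj ∧
        ((l₁.getLast? = some y ∧ l₂.head? = some z) ∨
          (l₁.getLast? = some z ∧ l₂.head? = some y))
  | [], _, _ => Or.inl List.isChain_nil
  | [_], _, _ => Or.inl (List.isChain_singleton _)
  | a :: b :: l, hn, hc => by
    obtain ⟨hab, hc⟩ := List.isChain_cons_cons.1 hc
    obtain ⟨ha, hn⟩ := List.nodup_cons.1 hn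
    rcases isChain_add_edge hM hn hc with h | ⟨l₁, l₂, h1, h2, h3, h4⟩
    · rcases hM a b hab with h5 | ⟨rfl, rfl⟩ | ⟨rfl, rfl⟩
      · exact Or.inl (List.isChain_cons_cons.2 ⟨h5, h⟩)
      · exact Or.inr ⟨[a], b :: l, rfl, List.isChain_singleton _, h, Or.inl ⟨rfl, rfl⟩⟩
      · exact Or.inr ⟨[a], b :: l, rfl, List.isChain_singleton _, h, Or.inr ⟨rfl, rfl⟩⟩
    · have hyz : y ∈ b :: l ∧ z ∈ b :: l := by
        rw [h1]
        rcases h4 with ⟨h5, h6⟩ | ⟨h5, h6⟩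
        · exact ⟨List.mem_append_left _ (List.mem_of_getLast? h5),
            List.mem_append_right _ (List.mem_of_head? h6)⟩
        · exact ⟨List.mem_append_right _ (List.mem_of_head? h6),
            List.mem_append_left _ (List.mem_of_getLast? h5)⟩
      have hab' : M.Adj a b := by
        rcases hM a b hab with h5 | ⟨rfl, rfl⟩ | ⟨rfl, rfl⟩
        · exact h5
        · exact absurd hyz.1 ha
        · exact absurd hyz.2 ha
      obtain ⟨l₁, rfl⟩ : ∃ t, l₁ = b :: t := by
        cases l₁ with
        | nil => simp at h4
        | cons c t => simp at h1; exact ⟨t, by rw [h1.1]⟩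
      refine Or.inr ⟨a :: b :: l₁, l₂, by rw [h1]; rfl,
        List.isChain_cons_cons.2 ⟨hab', h2⟩, h3, ?_⟩
      simpa [List.getLast?_cons_cons] using h4

variable [Fintype V] [DecidableEq V]

/-- A spanning path of `M` from `y` to `z`. -/
def HamPath (M : SimpleGraph V) (y z : V) : Prop :=
  ∃ l : List V, l.Nodup ∧ (∀ v, v ∈ l) ∧ Pth M l y z

omit [Fintype V] [DecidableEq V] in
theorem HamPath.symm (h : HamPath M y z) : HamPath M z y := by
  obtain ⟨l, h1, h2, h3⟩ := h
  exact ⟨l.reverse, List.nodup_reverse.2 h1, by simpa using h2, h3.reverse⟩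

theorem length_of_spanning (hn : l.Nodup) (hall : ∀ v, v ∈ l) : l.length = Fintype.card V := by
  have : l.toFinset = Finset.univ := by ext v; simpa using hall v
  rw [← List.toFinset_card_of_nodup hn, this, Finset.card_univ]

omit [Fintype V] [DecidableEq V] in
theorem eq_singleton_of_nodup (hn : l.Nodup) (h1 : l.head? = some x) (h2 : l.getLast? = some x) :
    l = [x] := by
  cases l with
  | nil => simp at h1
  | cons a t =>
    simp at h1; subst h1
    rcases List.eq_nil_or_concat t with rfl | ⟨s, b, rfl⟩
    · rfl
    · have h3 : b = a := by
        rw [List.concat_eq_append, ← List.cons_append, List.getLast?_concat] at h2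
        simpa using h2
      subst h3
      simp at hn

/-- A spanning cycle through the extra edge becomes, when opened at that edge, a spanning path of
`M` between its ends. -/
theorem HamL.of_add_edge (h3 : 3 ≤ Fintype.card V) {M' : SimpleGraph V}
    (hM : ∀ a b, M'.Adj a b → M.Adj a b ∨ (a = y ∧ b = z) ∨ (a = z ∧ b = y))
    (h : HamL M') : HamL M ∨ HamPath M y z := by
  obtain ⟨l, hn, hall, p, q, hp, hqp⟩ := h
  have key : ∀ y z, (∀ a b, M'.Adj a b → M.Adj a b ∨ (a = y ∧ b = z) ∨ (a = z ∧ b = y)) →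
      ∀ l₁ l₂, l = l₁ ++ l₂ → l₁.IsChain M.Adj → l₂.IsChain M.Adj →
      l₁.getLast? = some y → l₂.head? = some z → HamPath M z y := by
    intro y z hM l₁ l₂ hl h1 h2 h4 h5
    subst hl
    have hl1 : l₁ ≠ [] := by rintro rfl; simp at h4
    have hl2 : l₂ ≠ [] := by rintro rfl; simp at h5
    obtain ⟨p', y', hp1⟩ := Pth.exists h1 hl1
    obtain ⟨z', q', hp2⟩ := Pth.exists h2 hl2
    obtain rfl : y' = y := by have := hp1.2.2; rw [h4] at this; simpa using this.symm
    obtain rfl : z' = z := by have := hp2.2.1; rw [h5] at this; simpa using this.symm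
    obtain rfl : p' = p := by
      have := hp.2.1; rw [List.head?_append, hp1.2.1] at this; simpa using this
    obtain rfl : q' = q := by
      have := hp.2.2; rw [List.getLast?_append, hp2.2.2] at this; simpa using this
    rcases hM _ _ hqp with h6 | ⟨rfl, rfl⟩ | ⟨rfl, rfl⟩
    · refine ⟨l₂ ++ l₁, List.nodup_append_comm.1 hn, ?_, hp2.append h6 hp1⟩
      intro v; have := hall v; simp at this ⊢; tauto
    · exact absurd hp2.last_mem fun hh =>
        (List.disjoint_of_nodup_append hn) hp1.last_mem hh
    -- Here the closing edge and the cut edge are both the extra edge, so the cycle has only two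
    -- vertices; this is what `h3` excludes.
    · have e1 := eq_singleton_of_nodup (List.nodup_append.1 hn).1 hp1.2.1 hp1.2.2
      have e2 := eq_singleton_of_nodup (List.nodup_append.1 hn).2.1 hp2.2.1 hp2.2.2
      have := length_of_spanning hn hall
      rw [e1, e2] at this
      simp at this
      omega
  rcases isChain_add_edge hM hn hp.1 with h | ⟨l₁, l₂, h1, h2, h3, ⟨h4, h5⟩ | ⟨h4, h5⟩⟩
  · have hp' : Pth M l p q := ⟨h, hp.2⟩
    rcases hM _ _ hqp with h5 | ⟨rfl, rfl⟩ | ⟨rfl, rfl⟩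
    · exact Or.inl ⟨l, hn, hall, p, q, hp', h5⟩
    · exact Or.inr (HamPath.symm ⟨l, hn, hall, hp'⟩)
    · exact Or.inr ⟨l, hn, hall, hp'⟩
  · exact Or.inr (key y z hM l₁ l₂ h1 h2 h3 h4 h5).symm
  · refine Or.inr (key z y (fun a b hab => ?_) l₁ l₂ h1 h2 h3 h4 h5)
    have := hM a b hab; tauto

omit [Fintype V] in
theorem HamL.of_count {l l' : List V} (hn : l.Nodup) (hall : ∀ v, v ∈ l)
    (hc : ∀ a, l'.count a = l.count a) (hp : Pth M l' p q) (hqp : M.Adj q p) : HamL M := by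
  have hperm : l'.Perm l := List.perm_iff_count.2 hc
  exact ⟨l', hperm.nodup_iff.2 hn, fun v => hperm.mem_iff.2 (hall v), p, q, hp, hqp⟩

/-- `x` has degree at least `n / 2` in `H`. -/
def Heavy (H : SimpleGraph V) (x : V) : Prop :=
  Fintype.card V ≤ 2 * (H.neighborSet x).ncard

omit [DecidableEq V] in
theorem Heavy.mono (h : Heavy H x) (hle : H ≤ M) : Heavy M x := by
  refine h.trans (Nat.mul_le_mul_left 2 (Set.ncard_le_ncard ?_ (Set.toFinite _)))
  intro y hy
  exact hle hy

omit [Fintype V] [DecidableEq V] in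
-- Each consecutive pair `a, b` is charged at most once, by `P b` or by `Q a`. The head is not
-- counted for `P`, and the last vertex fails `Q`, so the total is at most the number of pairs.
theorem countP_add_countP_le (P Q : V → Bool) : ∀ (t : List V) (x y : V),
    (∀ l₁ a b l₂, x :: t = l₁ ++ a :: b :: l₂ → ¬ (P b ∧ Q a)) →
    (x :: t).getLast? = some y → Q y = false →
    t.countP P + (x :: t).countP Q ≤ t.length
  | [], x, y, _, h2, h3 => by
    simp at h2; subst h2; simp [h3]
  | b :: t, x, y, h1, h2, h3 => by
    have ih := countP_add_countP_le P Q t b y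
      (fun l₁ a c l₂ h => h1 (x :: l₁) a c l₂ (by rw [h]; rfl))
      (by rwa [List.getLast?_cons_cons] at h2) h3
    have h4 := h1 [] x b t rfl
    rw [List.countP_cons (p := P), List.countP_cons (p := Q) (a := x), List.length_cons]
    by_cases hP : P b <;> by_cases hQ : Q x <;> simp [hP, hQ] at h4 ⊢ <;> omega

omit [Fintype V] in
theorem ncard_neighborSet_eq_countP [DecidableRel H.Adj] (hn : l.Nodup) (hall : ∀ v, v ∈ l) (x : V) :
    (H.neighborSet x).ncard = l.countP (fun v => H.Adj x v) := by
  have : H.neighborSet x = ((l.filter (fun v => H.Adj x v)).toFinset : Set V) := by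
    ext v; simp [hall v]
  rw [this, Set.ncard_coe_finset, List.toFinset_card_of_nodup (hn.filter _),
    List.countP_eq_length_filter]

/-- A spanning path between vertices of large degree sum closes up to a spanning cycle. -/
theorem HamPath.hamL (h : HamPath H p q)
    (hd : Fintype.card V ≤ (H.neighborSet p).ncard + (H.neighborSet q).ncard) : HamL H := by
  classical
  by_contra hno
  obtain ⟨l, hn, hall, hp⟩ := h
  obtain ⟨t, rfl⟩ : ∃ t, l = p :: t := by
    cases l with
    | nil => exact absurd rfl hp.ne_nil
    | cons a t => exact ⟨t, by rw [hp.head_eq]⟩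
  -- Ore's crossing argument: consecutive `a, b` with `p` adjacent to `b` and `q` adjacent to `a`
  -- would let the path be reversed beyond `a` and closed up.
  have h1 := countP_add_countP_le (fun v => decide (H.Adj p v)) (fun v => decide (H.Adj q v)) t p q
    (by
      rintro l₁ a b l₂ he ⟨hb, ha⟩
      simp at hb ha
      rw [he] at hp hn hall
      rw [show l₁ ++ a :: b :: l₂ = (l₁ ++ [a]) ++ b :: l₂ by simp] at hp
      obtain ⟨a', b', hp1, hab, hp2⟩ := hp.of_append (by simp) (by simp)
      have := hp1.last_eq; subst this
      have := hp2.head_eq; subst this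
      exact hno (HamL.of_count hn hall (by intro v; simp [List.count_append, List.count_cons])
        (hp1.append ha.symm hp2.reverse) hb.symm))
    hp.2.2 (by simp)
  rw [ncard_neighborSet_eq_countP hn hall, ncard_neighborSet_eq_countP hn hall,
    List.countP_cons] at hd
  have := length_of_spanning hn hall
  simp at this hd
  omega

/-- Adding edges between heavy vertices does not create a spanning cycle. -/
theorem HamL.of_heavy_pairs (h3 : 3 ≤ Fintype.card V) {M' : SimpleGraph V} (hHM : H ≤ M)
    (hM : ∀ a b, M'.Adj a b → M.Adj a b ∨ (Heavy H a ∧ Heavy H b)) (h : HamL M') : HamL M := by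
  have hM' : HamL (M ⊔ M') := h.mono le_sup_right
  -- In a minimal graph with a spanning cycle between `M` and `M ⊔ M'`, any edge outside `M` joins
  -- heavy vertices and could be deleted by Ore's argument.
  obtain ⟨F, ⟨hF1, hF2, hF3⟩, hmin⟩ := WellFounded.has_min (wellFounded_lt (α := SimpleGraph V))
    {F | M ≤ F ∧ F ≤ M ⊔ M' ∧ HamL F} ⟨M ⊔ M', le_sup_left, le_rfl, hM'⟩
  by_cases hFM : F ≤ M
  · exact hF3.mono hFM
  exfalso
  obtain ⟨p, q, hpq, hpq'⟩ : ∃ p q, F.Adj p q ∧ ¬ M.Adj p q := by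
    by_contra! hcon
    exact hFM fun a b => hcon a b
  have hheavy : Heavy H p ∧ Heavy H q := by
    rcases hF2 hpq with h4 | h4
    · exact absurd h4 hpq'
    · exact (hM p q h4).resolve_left hpq'
  let F' : SimpleGraph V := F.deleteEdges {s(p, q)}
  have hMF' : M ≤ F' := by
    intro a b hab
    simp only [F', SimpleGraph.deleteEdges_adj, Set.mem_singleton_iff, Sym2.eq_iff]
    refine ⟨hF1 hab, ?_⟩
    rintro (⟨rfl, rfl⟩ | ⟨rfl, rfl⟩)
    · exact hpq' hab
    · exact hpq' hab.symm
  have hF'F : F' ≤ F := SimpleGraph.deleteEdges_le _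
  have hlt : F' < F := by
    refine lt_of_le_of_ne hF'F fun he => ?_
    rw [← he] at hpq
    simp [F'] at hpq
  have hHF : H ≤ F' := hHM.trans hMF'
  refine hmin F' ⟨hMF', hF'F.trans hF2, ?_⟩ hlt
  rcases HamL.of_add_edge h3 (M := F') (y := p) (z := q) (M' := F) (by
    intro a b hab
    simp only [F', SimpleGraph.deleteEdges_adj, Set.mem_singleton_iff, Sym2.eq_iff]
    tauto) hF3 with h5 | h5
  · exact h5
  · refine h5.hamL ?_
    have h6 : Heavy F' p := hheavy.1.mono hHF
    have h7 : Heavy F' q := hheavy.2.mono hHF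
    unfold Heavy at h6 h7
    omega

omit [Fintype V] in
-- Let `s, q` be the path neighbours of `x` and `t, e` those of `w`. Any of the chords `qy`, `sq`,
-- `sz`, `te` in `L` gives a spanning cycle at once. Hence the claw condition at `x` leaves only
-- `qz`, and with this chord each remaining outcome at `w`, `tx` or `ex`, gives a cycle as well.
theorem hamL_of_diamond_aux (hML : M ≤ L) (hxw : M.Adj x w)
    (hxy : M.Adj x y) (hxz : M.Adj x z) (hwy : M.Adj w y) (hwz : M.Adj w z)
    (c1 : ∀ p q, M.Adj x p → M.Adj x q → p ≠ q → p ≠ z → q ≠ z →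
      L.Adj p q ∨ L.Adj p z ∨ L.Adj q z)
    (c2 : ∀ p q, M.Adj w p → M.Adj w q → p ≠ q → p ≠ x → q ≠ x →
      L.Adj p q ∨ L.Adj p x ∨ L.Adj q x)
    {A B D : List V} (hn : (A ++ x :: (B ++ w :: D)).Nodup)
    (hall : ∀ v, v ∈ A ++ x :: (B ++ w :: D)) (hp : Pth M (A ++ x :: (B ++ w :: D)) y z) :
    HamL L := by
  by_contra hno
  have hA : A ≠ [] := by
    rintro rfl
    exact hxy.ne hp.head_eq
  have hD : D ≠ [] := by
    rintro rfl
    rw [show A ++ x :: (B ++ [w]) = (A ++ x :: B) ++ [w] by simp] at hp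
    exact hwz.ne hp.last_eq
  obtain ⟨s, x', hA1, hsx, hp2⟩ := hp.of_append hA (by simp)
  obtain ⟨hx', q, hxq, hp3⟩ := hp2.tail_of_cons (by simp)
  subst hx'
  have n1 : ¬ L.Adj q y := fun hqy =>
    hno (HamL.of_count hn hall (l' := [x] ++ A.reverse ++ (B ++ w :: D))
      (by intro v; simp [List.count_append, List.count_cons]; omega)
      (((Pth.singleton L x).append (hML hsx.symm) (hA1.mono hML).reverse).append hqy.symm
        (hp3.mono hML)) (hML hxz.symm))
  have hB : B ≠ [] := by
    rintro rfl
    have := hp3.head_eq; subst this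
    exact n1 (hML hwy)
  obtain ⟨t, w', hB1, htw, hp4⟩ := hp3.of_append hB (by simp)
  obtain ⟨hw', e, hwe, hD1⟩ := hp4.tail_of_cons hD
  subst hw'
  have n2 : ¬ L.Adj s q := fun hsq =>
    hno (HamL.of_count hn hall (l' := A ++ (B ++ w :: D) ++ [x])
      (by intro v; simp [List.count_append, List.count_cons]; omega)
      (((hA1.mono hML).append hsq (hp3.mono hML)).concat (hML hxz.symm)) (hML hxy))
  have n3 : ¬ L.Adj s z := fun hsz =>
    hno (HamL.of_count hn hall (l' := A ++ (B ++ w :: D).reverse ++ [x])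
      (by intro v; simp [List.count_append, List.count_cons]; omega)
      (((hA1.mono hML).append hsz (hp3.mono hML).reverse).concat (hML hxq.symm)) (hML hxy))
  have n4 : ¬ L.Adj t e := fun hte =>
    hno (HamL.of_count hn hall (l' := A ++ (x :: B) ++ D ++ [w])
      (by intro v; simp [List.count_append, List.count_cons])
      (((((hA1.append hsx (hB1.cons hxq)).mono hML).append hte (hD1.mono hML)).concat
        (hML hwz.symm))) (hML hwy))
  have hsA := hA1.last_mem
  have hqB := hB1.head_mem
  have htB := hB1.last_mem
  have heD := hD1.head_mem
  have hzD := hD1.last_mem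
  simp only [List.nodup_append, List.nodup_cons, List.mem_append, List.mem_cons, ne_eq] at hn
  have hqz : L.Adj q z := by
    have := c1 s q hsx.symm hxq (by rintro rfl; grind) (by rintro rfl; grind) (by rintro rfl; grind)
    tauto
  rcases c2 t e htw.symm hwe (by rintro rfl; grind) (by rintro rfl; grind) (by rintro rfl; grind)
    with h | h | h
  · exact n4 h
  · exact hno (HamL.of_count (by simpa [List.nodup_append] using hn) hall
      (l' := [x] ++ A.reverse ++ (w :: D) ++ B)
      (by intro v; simp [List.count_append, List.count_cons]; omega)
      ((((Pth.singleton L x).append (hML hsx.symm) (hA1.mono hML).reverse).append (hML hwy.symm)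
        (hp4.mono hML)).append hqz.symm (hB1.mono hML)) h)
  · exact hno (HamL.of_count (by simpa [List.nodup_append] using hn) hall
      (l' := [x] ++ A.reverse ++ [w] ++ B.reverse ++ D.reverse)
      (by intro v; simp [List.count_append, List.count_cons]; omega)
      (((((Pth.singleton L x).append (hML hsx.symm) (hA1.mono hML).reverse).append (hML hwy.symm)
        (Pth.singleton L w)).append (hML htw.symm) (hB1.mono hML).reverse).append hqz
        (hD1.mono hML).reverse) h)

omit [Fintype V] in
/-- If `x` and `w` are adjacent common neighbours of `y` and `z`, then adding the edge `yz` does not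
create a spanning cycle, up to the edges of `L`. -/
theorem HamPath.hamL_of_diamond (hML : M ≤ L) (hxw : M.Adj x w)
    (hxy : M.Adj x y) (hxz : M.Adj x z) (hwy : M.Adj w y) (hwz : M.Adj w z)
    (c1 : ∀ r, r = y ∨ r = z → ∀ p q, M.Adj x p → M.Adj x q → p ≠ q → p ≠ r → q ≠ r →
      L.Adj p q ∨ L.Adj p r ∨ L.Adj q r)
    (c2 : ∀ p q, M.Adj w p → M.Adj w q → p ≠ q → p ≠ x → q ≠ x →
      L.Adj p q ∨ L.Adj p x ∨ L.Adj q x)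
    (hp : HamPath M y z) : HamL L := by
  obtain ⟨l, hn, hall, hp⟩ := hp
  obtain ⟨A, C, rfl⟩ := List.append_of_mem (hall x)
  have hw : w ∈ A ∨ w ∈ C := by
    have := hall w
    simp [hxw.ne.symm] at this
    exact this
  rcases hw with hw | hw
  -- If `w` comes before `x`, the path is read backwards, which exchanges `y` and `z`; therefore
  -- `c1` is required for both ends.
  · obtain ⟨A, B, rfl⟩ := List.append_of_mem hw
    have hp' := hp.reverse
    have he : ((A ++ w :: B) ++ x :: C).reverse =
      C.reverse ++ x :: (B.reverse ++ w :: A.reverse) := by simp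
    refine hamL_of_diamond_aux hML hxw hxz hxy hwz hwy (c1 y (Or.inl rfl)) c2
      (A := C.reverse) (B := B.reverse) (D := A.reverse) ?_ ?_ ?_
    · rw [← he]; exact List.nodup_reverse.2 hn
    · rw [← he]; exact fun v => List.mem_reverse.2 (hall v)
    · rw [← he]; exact hp'
  · obtain ⟨B, D, rfl⟩ := List.append_of_mem hw
    exact hamL_of_diamond_aux hML hxw hxy hxz hwy hwz (c1 z (Or.inr rfl)) c2 hn hall hp

end BondyChvatal

/-! ### The closure and the pull-back of spanning cycles -/

section Closure

variable {V : Type*} [Fintype V]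

/-- Closed graphs: common neighbours of adjacent vertices are adjacent, and so are heavy
vertices. -/
structure IsClosedGraph (F : SimpleGraph V) : Prop where
  diamond : ∀ ⦃x w y z⦄, F.Adj x w → F.Adj x y → F.Adj x z → F.Adj w y → F.Adj w z → y ≠ z →
    F.Adj y z
  heavy : ∀ ⦃p q⦄, Heavy F p → Heavy F q → p ≠ q → F.Adj p q

/-- The least closed graph above `G`. -/
def star (G : SimpleGraph V) : SimpleGraph V := sInf {F | G ≤ F ∧ IsClosedGraph F}

/-- `H` together with all edges between its heavy vertices. -/
def hv (H : SimpleGraph V) : SimpleGraph V where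
  Adj p q := H.Adj p q ∨ (p ≠ q ∧ Heavy H p ∧ Heavy H q)
  symm := ⟨fun p q h => by
    rcases h with h | ⟨h1, h2, h3⟩
    · exact Or.inl h.symm
    · exact Or.inr ⟨h1.symm, h3, h2⟩⟩
  loopless := ⟨fun p h => by
    rcases h with h | ⟨h1, _⟩
    · exact H.loopless.irrefl p h
    · exact h1 rfl⟩

/-- The local completion of `H` at `x`. -/
def complAt (H : SimpleGraph V) (x : V) : SimpleGraph V where
  Adj p q := H.Adj p q ∨ (p ≠ q ∧ H.Adj x p ∧ H.Adj x q)
  symm := ⟨fun p q h => by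
    rcases h with h | ⟨h1, h2, h3⟩
    · exact Or.inl h.symm
    · exact Or.inr ⟨h1.symm, h3, h2⟩⟩
  loopless := ⟨fun p h => by
    rcases h with h | ⟨h1, _⟩
    · exact H.loopless.irrefl p h
    · exact h1 rfl⟩

/-- No three neighbours of a vertex are pairwise nonadjacent in `hv H`. -/
def WeakClawFree (H : SimpleGraph V) : Prop :=
  ∀ x a b c, H.Adj x a → H.Adj x b → H.Adj x c → a ≠ b → a ≠ c → b ≠ c →
    (hv H).Adj a b ∨ (hv H).Adj a c ∨ (hv H).Adj b c

variable {G H F M : SimpleGraph V} {x y z w a b c p q : V}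

theorem le_star : G ≤ star G := le_sInf fun _ hF => hF.1

theorem star_le (h : G ≤ F) (hF : IsClosedGraph F) : star G ≤ F := sInf_le ⟨h, hF⟩

/-- Both rules survive intersections: the diamond rule is a Horn condition, and a vertex heavy in
the intersection is heavy in every member. -/
theorem IsClosedGraph.star : IsClosedGraph (star G) := by
  constructor
  · intro x w y z hxw hxy hxz hwy hwz hyz
    unfold FanHeavy.star at *
    rw [SimpleGraph.sInf_adj] at *
    exact ⟨fun F hF => hF.2.diamond (hxw.1 F hF) (hxy.1 F hF) (hxz.1 F hF) (hwy.1 F hF)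
      (hwz.1 F hF) hyz, hyz⟩
  · intro p q hp hq hpq
    unfold FanHeavy.star at *
    rw [SimpleGraph.sInf_adj]
    exact ⟨fun F hF => hF.2.heavy (hp.mono (sInf_le hF)) (hq.mono (sInf_le hF)) hpq, hpq⟩

theorem le_hv : H ≤ hv H := fun _ _ h => Or.inl h

theorem hv_mono (h : H ≤ M) : hv H ≤ hv M := by
  rintro p q (h1 | ⟨h1, h2, h3⟩)
  · exact Or.inl (h h1)
  · exact Or.inr ⟨h1, h2.mono h, h3.mono h⟩

theorem IsClosedGraph.hv_le (hF : IsClosedGraph F) (h : H ≤ F) : hv H ≤ F := by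
  rintro p q (h1 | ⟨h1, h2, h3⟩)
  · exact h h1
  · exact hF.heavy (h2.mono h) (h3.mono h) h1

omit [Fintype V] in
theorem le_complAt : H ≤ complAt H x := fun _ _ h => Or.inl h

theorem HamL.of_hv [DecidableEq V] (h3 : 3 ≤ Fintype.card V) (h : HamL (hv H)) : HamL H :=
  HamL.of_heavy_pairs h3 le_rfl (fun _ _ (hab : _ ∨ _) => hab.imp_right fun h => h.2) h

omit [Fintype V] in
-- Every element of `S` is joined to `w`, by way of `y` or `z`, and then any two elements are joined
-- through `w`.
theorem adj_of_transOn {A : SimpleGraph V} {S : Set V} (hy : y ∈ S) (hw : w ∈ S) (hz : z ∈ S)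
    (hyw : A.Adj y w) (hwz : A.Adj w z)
    (hcov : ∀ q ∈ S, q = y ∨ q = z ∨ A.Adj q y ∨ A.Adj q z)
    (htr : ∀ a ∈ S, ∀ b ∈ S, ∀ c ∈ S, A.Adj a b → A.Adj b c → a ≠ c → A.Adj a c) :
    ∀ p ∈ S, ∀ q ∈ S, p ≠ q → A.Adj p q := by
  have h1 : ∀ p ∈ S, p ≠ w → A.Adj p w := by
    intro p hp hpw
    rcases hcov p hp with rfl | rfl | h | h
    · exact hyw
    · exact hwz.symm
    · exact htr p hp y hy w hw h hyw hpw
    · exact htr p hp z hz w hw h hwz.symm hpw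
  intro p hp q hq hpq
  rcases eq_or_ne p w with rfl | hpw
  · exact (h1 q hq hpq.symm).symm
  rcases eq_or_ne q w with rfl | hqw
  · exact h1 p hp hpq
  exact htr p hp w hw q hq (h1 p hp hpw) (h1 q hq hqw).symm hpq

/-- In a claw of the completion with a new edge `va`, the leaf `a` can be replaced by `x`: the other
leaves are not adjacent to `x`, so their edges to `v` are old and the condition of `H` applies to
`x, b, c` at `v`. -/
theorem WeakClawFree.complAt (h : WeakClawFree H) (x : V) : WeakClawFree (complAt H x) := by
  have key : ∀ v a b c, (FanHeavy.complAt H x).Adj v a → (FanHeavy.complAt H x).Adj v b →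
      (FanHeavy.complAt H x).Adj v c → a ≠ b → a ≠ c → b ≠ c → ¬ H.Adj v a →
      ¬ (hv (FanHeavy.complAt H x)).Adj a b → ¬ (hv (FanHeavy.complAt H x)).Adj a c →
      (hv (FanHeavy.complAt H x)).Adj b c := by
    intro v a b c hva hvb hvc hab hac hbc hnva nab nac
    by_contra nbc
    have hle := hv_mono (le_complAt (H := H) (x := x))
    obtain ⟨-, hxv, hxa⟩ := hva.resolve_left hnva
    have hb : ¬ H.Adj x b := fun hxb => nab (Or.inl (Or.inr ⟨hab, hxa, hxb⟩))
    have hc : ¬ H.Adj x c := fun hxc => nac (Or.inl (Or.inr ⟨hac, hxa, hxc⟩))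
    have hvb' : H.Adj v b := hvb.resolve_right fun hh => hb hh.2.2
    have hvc' : H.Adj v c := hvc.resolve_right fun hh => hc hh.2.2
    have hbx : x ≠ b := by rintro rfl; exact nab (Or.inl (Or.inl hxa.symm))
    have hcx : x ≠ c := by rintro rfl; exact nac (Or.inl (Or.inl hxa.symm))
    -- In the completion `a` sees every other neighbour of `x` and `x` itself, so it inherits the
    -- heaviness of `x`.
    have hvyx : Heavy H x → Heavy (FanHeavy.complAt H x) a := by
      intro hx
      refine hx.trans (Nat.mul_le_mul_left 2 ?_)
      have hsub : H.neighborSet x \ {a} ⊆ (FanHeavy.complAt H x).neighborSet a \ {x} := by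
        rintro t ⟨ht, hta⟩
        exact ⟨Or.inr ⟨fun h => hta h.symm, hxa, ht⟩, fun h => H.loopless.irrefl x (h ▸ ht)⟩
      have h1 := Set.ncard_le_ncard hsub (Set.toFinite _)
      have h2 := Set.ncard_sdiff_singleton_add_one (s := H.neighborSet x) hxa (Set.toFinite _)
      have h3 := Set.ncard_sdiff_singleton_add_one
        (s := (FanHeavy.complAt H x).neighborSet a) (a := x) (Or.inl hxa.symm) (Set.toFinite _)
      omega
    rcases h v x b c hxv.symm hvb' hvc' hbx hcx hbc with h1 | h1 | h1
    · obtain ⟨-, h2, h3⟩ := h1.resolve_left hb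
      exact nab (Or.inr ⟨hab, hvyx h2, h3.mono le_complAt⟩)
    · obtain ⟨-, h2, h3⟩ := h1.resolve_left hc
      exact nac (Or.inr ⟨hac, hvyx h2, h3.mono le_complAt⟩)
    · exact nbc (hle h1)
  intro v a b c hva hvb hvc hab hac hbc
  have hle := hv_mono (le_complAt (H := H) (x := x))
  by_contra! hcon
  obtain ⟨nab, nac, nbc⟩ := hcon
  by_cases h1 : H.Adj v a
  · by_cases h2 : H.Adj v b
    · by_cases h3 : H.Adj v c
      · rcases h v a b c h1 h2 h3 hab hac hbc with h | h | h
        · exact nab (hle h)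
        · exact nac (hle h)
        · exact nbc (hle h)
      · exact nab (key v c a b hvc hva hvb hac.symm hbc.symm hab h3 (fun h => nac h.symm)
          (fun h => nbc h.symm))
    · exact nac (key v b a c hvb hva hvc hab.symm hbc hac h2 (fun h => nab h.symm) nbc)
  · exact nbc (key v a b c hva hvb hvc hab hac hbc h1 nab nac)

theorem complAt_le (hF : IsClosedGraph F) (hHF : H ≤ F) (hxy : H.Adj x y) (hxw : H.Adj x w)
    (hxz : H.Adj x z) (hyw : (hv H).Adj y w) (hwz : (hv H).Adj w z)
    (hcov : ∀ q, H.Adj x q → q = y ∨ q = z ∨ (hv H).Adj q y ∨ (hv H).Adj q z) :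
    complAt H x ≤ F := by
  have hle := hF.hv_le hHF
  have h := adj_of_transOn (A := F) (S := H.neighborSet x) hxy hxw hxz (hle hyw) (hle hwz)
    (fun q hq => (hcov q hq).imp_right fun h => h.imp_right fun h => h.imp (@hle _ _) (@hle _ _))
    (fun a ha b hb c hc hab hbc hac => hF.diamond (hHF hb) (hHF ha) (hHF hc) hab.symm hbc hac)
  rintro p q (hpq | ⟨hne, hp, hq⟩)
  · exact hHF hpq
  · exact h p hp q hq hne

/-- The missing edges in the neighbourhood of `x` are added one by one, each between two vertices
having a common neighbour `b` in that neighbourhood, so that `x` and `b` span a diamond with them.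
The path `y, w, z` and `hcov` ensure that this process reaches the whole completion. -/
theorem HamL.of_complAt [DecidableEq V] (h3 : 3 ≤ Fintype.card V) (hW : WeakClawFree H)
    (hxy : H.Adj x y) (hxw : H.Adj x w)
    (hxz : H.Adj x z) (hyw : (hv H).Adj y w) (hwz : (hv H).Adj w z)
    (hcov : ∀ q, H.Adj x q → q = y ∨ q = z ∨ (hv H).Adj q y ∨ (hv H).Adj q z)
    (hH : HamL (complAt H x)) : HamL H := by
  let M₀ : SimpleGraph V := hv H ⊓ complAt H x
  obtain ⟨M, ⟨hM1, hM2, hM3⟩, hmax⟩ := WellFounded.has_min (wellFounded_gt (α := SimpleGraph V))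
    {M | M₀ ≤ M ∧ M ≤ complAt H x ∧ (HamL M → HamL H)}
    ⟨M₀, le_rfl, inf_le_right, fun h => HamL.of_hv h3 (h.mono inf_le_left)⟩
  have hHM : H ≤ M := (le_inf le_hv le_complAt).trans hM1
  have hMx : ∀ p, M.Adj x p → H.Adj x p := by
    intro p hp
    exact (hM2 hp).resolve_right fun h => H.loopless.irrefl x h.2.1
  have hloc : ∀ p q, H.Adj x p → H.Adj x q → (hv H).Adj p q → M.Adj p q := fun p q hp hq hpq =>
    hM1 ⟨hpq, Or.inr ⟨hpq.ne, hp, hq⟩⟩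
  have htr : ∀ a ∈ H.neighborSet x, ∀ b ∈ H.neighborSet x, ∀ c ∈ H.neighborSet x,
      M.Adj a b → M.Adj b c → a ≠ c → M.Adj a c := by
    intro a ha b hb c hc hab hbc hac
    by_contra hnac
    let M' : SimpleGraph V := M ⊔ SimpleGraph.edge a c
    have hM' : ∀ p q, M'.Adj p q → M.Adj p q ∨ (p = a ∧ q = c) ∨ (p = c ∧ q = a) := by
      intro p q hpq
      simp only [M', SimpleGraph.sup_adj, SimpleGraph.edge_adj] at hpq
      tauto
    have hac' : M'.Adj a c := by simp [M', SimpleGraph.edge_adj, hac]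
    have hlt : M < M' := lt_of_le_of_ne le_sup_left fun he => hnac (he ▸ hac')
    refine hmax M' ⟨hM1.trans hlt.le, ?_, ?_⟩ hlt
    · intro p q hpq
      rcases hM' p q hpq with h | ⟨rfl, rfl⟩ | ⟨rfl, rfl⟩
      · exact hM2 h
      · exact Or.inr ⟨hac, ha, hc⟩
      · exact Or.inr ⟨hac.symm, hc, ha⟩
    · intro hh
      rcases HamL.of_add_edge h3 hM' hh with h | h
      · exact hM3 h
      -- The claw conditions hold only up to edges between heavy vertices, so the diamond argument
      -- ends in `M ⊔ hv H`; the extra edges are then removed by Ore's argument.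
      refine hM3 (HamL.of_heavy_pairs h3 (M := M) (M' := M ⊔ hv H) hHM (fun p q hpq => ?_)
        (h.hamL_of_diamond (L := M ⊔ hv H) le_sup_left (hHM hb) (hHM ha) (hHM hc) hab.symm hbc
          ?_ ?_))
      · rcases hpq with h | h | h
        · exact Or.inl h
        · exact Or.inl (hHM h)
        · exact Or.inr h.2
      · intro r hr p q hp hq hpq hpr hqr
        have hr' : H.Adj x r := by rcases hr with rfl | rfl <;> assumption
        rcases hW x p q r (hMx p hp) (hMx q hq) hr' hpq hpr hqr with h | h | h
        · exact Or.inl (Or.inr h)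
        · exact Or.inr (Or.inl (Or.inr h))
        · exact Or.inr (Or.inr (Or.inr h))
      · intro p q hp hq hpq hpx hqx
        by_cases hp' : H.Adj x p
        · exact Or.inr (Or.inl (Or.inl (hHM hp'.symm)))
        by_cases hq' : H.Adj x q
        · exact Or.inr (Or.inr (Or.inl (hHM hq'.symm)))
        have hp2 : H.Adj b p := (hM2 hp).resolve_right fun h => hp' h.2.2
        have hq2 : H.Adj b q := (hM2 hq).resolve_right fun h => hq' h.2.2
        rcases hW b p q x hp2 hq2 hb.symm hpq hpx hqx with h | h | h
        · exact Or.inl (Or.inr h)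
        · exact Or.inr (Or.inl (Or.inr h))
        · exact Or.inr (Or.inr (Or.inr h))
  have hcomp := adj_of_transOn (A := M) (S := H.neighborSet x) hxy hxw hxz (hloc _ _ hxy hxw hyw)
    (hloc _ _ hxw hxz hwz)
    (fun q hq => (hcov q hq).imp_right fun h => h.imp_right fun h =>
      h.imp (hloc _ _ hq hxy) (hloc _ _ hq hxz)) htr
  refine hM3 (hH.mono ?_)
  rintro p q (hpq | ⟨hne, hp, hq⟩)
  · exact hHM hpq
  · exact hcomp p hp q hq hne

/-- The two degrees sum to at least the order, while the union of the neighbourhoods misses `p` and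
`q`; the overlap therefore has at least two vertices. -/
theorem exists_common_of_heavy (hp : Heavy H p) (hq : Heavy H q) (hpq : p ≠ q)
    (hn : ¬ H.Adj p q) : ∃ w w', w ≠ w' ∧ (H.Adj p w ∧ H.Adj q w) ∧ H.Adj p w' ∧ H.Adj q w' := by
  classical
  have hsub : H.neighborSet p ∪ H.neighborSet q ⊆ {p, q}ᶜ := by
    rintro w (h | h) (rfl | rfl)
    · exact H.loopless.irrefl _ h
    · exact hn h
    · exact hn (SimpleGraph.Adj.symm h)
    · exact H.loopless.irrefl _ h
  have h1 := Set.ncard_le_ncard hsub (Set.toFinite _)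
  have h2 := Set.ncard_union_add_ncard_inter (H.neighborSet p) (H.neighborSet q)
    (Set.toFinite _) (Set.toFinite _)
  rw [Set.ncard_compl, Set.ncard_pair hpq, Nat.card_eq_fintype_card] at h1
  have h3 : 1 < Fintype.card V := Fintype.one_lt_card_iff.2 ⟨p, q, hpq⟩
  have h4 : 1 < (H.neighborSet p ∩ H.neighborSet q).ncard := by
    unfold Heavy at hp hq
    omega
  obtain ⟨w, w', hw, hw', hne⟩ := (Set.one_lt_ncard_iff (Set.toFinite _)).1 h4
  exact ⟨w, w', hne, hw, hw'⟩

/-- The closure theorem. -/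
theorem star_spec [DecidableEq V] (h3 : 3 ≤ Fintype.card V) (hW : WeakClawFree G) :
    (HamL (star G) → HamL G) ∧ WeakClawFree (star G) := by
  obtain ⟨H, ⟨hGH, hHs, hHam, hWH⟩, hmax⟩ :=
    WellFounded.has_min (wellFounded_gt (α := SimpleGraph V))
    {H | G ≤ H ∧ H ≤ star G ∧ (HamL H → HamL G) ∧ WeakClawFree H}
    ⟨G, le_rfl, le_star, id, hW⟩
  -- Adjacency in `hv H` is transitive on every neighbourhood, for otherwise the local completion
  -- would contradict maximality of `H`; weak claw-freeness supplies the covering condition.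
  have hT : ∀ x y w z, H.Adj x y → H.Adj x w → H.Adj x z → (hv H).Adj y w → (hv H).Adj w z →
      y ≠ z → (hv H).Adj y z := by
    intro x y w z hxy hxw hxz hyw hwz hyz
    by_contra hn
    have hcov : ∀ q, H.Adj x q → q = y ∨ q = z ∨ (hv H).Adj q y ∨ (hv H).Adj q z := by
      intro q hq
      by_contra! hcon
      rcases hWH x q y z hq hxy hxz hcon.1 hcon.2.1 hyz with h | h | h
      · exact hcon.2.2.1 h
      · exact hcon.2.2.2 h
      · exact hn h
    have hlt : H < complAt H x := by
      refine lt_of_le_of_ne le_complAt fun he => hn (Or.inl ?_)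
      rw [he]; exact Or.inr ⟨hyz, hxy, hxz⟩
    exact hmax (complAt H x) ⟨hGH.trans le_complAt,
      complAt_le IsClosedGraph.star hHs hxy hxw hxz hyw hwz hcov,
      fun h => hHam (HamL.of_complAt h3 hWH hxy hxw hxz hyw hwz hcov h), hWH.complAt x⟩ hlt
  have hWv : WeakClawFree (hv H) := by
    have key : ∀ v a b c, (hv H).Adj v a → (hv H).Adj v b → (hv H).Adj v c → a ≠ b → a ≠ c →
        b ≠ c → ¬ H.Adj v a → ¬ (hv H).Adj a b → ¬ (hv H).Adj a c → (hv H).Adj b c := by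
      intro v a b c hva hvb hvc hab hac hbc hnva nab nac
      by_contra nbc
      obtain ⟨hne, hv1, ha⟩ := hva.resolve_left hnva
      have hb : ¬ Heavy H b := fun hb => nab (Or.inr ⟨hab, ha, hb⟩)
      have hc : ¬ Heavy H c := fun hc => nac (Or.inr ⟨hac, ha, hc⟩)
      have hvb' : H.Adj v b := hvb.resolve_right fun h => hb h.2.2
      have hvc' : H.Adj v c := hvc.resolve_right fun h => hc h.2.2
      -- The new edge `va` of `hv H` joins heavy vertices, so a common neighbour `w` in `H` can
      -- stand in for `a`; an edge from `w` to `b` or `c` passes to `a` by `hT` at `w`.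
      obtain ⟨w, -, -, ⟨hvw, haw⟩, -⟩ := exists_common_of_heavy hv1 ha hne hnva
      have hwb : w ≠ b := by rintro rfl; exact nab (Or.inl haw)
      have hwc : w ≠ c := by rintro rfl; exact nac (Or.inl haw)
      rcases hWH v w b c hvw hvb' hvc' hwb hwc hbc with h | h | h
      · have hwb' := h.resolve_right fun h => hb h.2.2
        exact nab (hT w a v b haw.symm hvw.symm hwb' hva.symm (Or.inl hvb') hab)
      · have hwc' := h.resolve_right fun h => hc h.2.2
        exact nac (hT w a v c haw.symm hvw.symm hwc' hva.symm (Or.inl hvc') hac)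
      · exact nbc h
    intro v a b c hva hvb hvc hab hac hbc
    by_contra! hcon
    obtain ⟨nab, nac, nbc⟩ := hcon
    have nab := fun h => nab (le_hv h)
    have nac := fun h => nac (le_hv h)
    have nbc := fun h => nbc (le_hv h)
    by_cases h1 : H.Adj v a
    · by_cases h2 : H.Adj v b
      · by_cases h3 : H.Adj v c
        · rcases hWH v a b c h1 h2 h3 hab hac hbc with h | h | h
          · exact nab h
          · exact nac h
          · exact nbc h
        · exact nab (key v c a b hvc hva hvb hac.symm hbc.symm hab h3 (fun h => nac h.symm)
            (fun h => nbc h.symm))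
      · exact nac (key v b a c hvb hva hvc hab.symm hbc hac h2 (fun h => nab h.symm) nbc)
    · exact nbc (key v a b c hva hvb hvc hab hac hbc h1 nab nac)
  have hvH : hv H ≤ H := by
    by_contra hn
    have hlt : H < hv H := lt_of_le_of_ne le_hv fun he => hn he.ge
    exact hmax (hv H) ⟨hGH.trans le_hv, IsClosedGraph.star.hv_le hHs,
      fun h => hHam (HamL.of_hv h3 h), hWv⟩ hlt
  have hcl : IsClosedGraph H := by
    constructor
    · intro x w y z hxw hxy hxz hwy hwz hyz
      exact hvH (hT x y w z hxy hxw hxz (Or.inl hwy.symm) (Or.inl hwz) hyz)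
    · intro p q hp hq hpq
      exact hvH (Or.inr ⟨hpq, hp, hq⟩)
  have he : star G = H := le_antisymm (star_le hGH hcl) hHs
  rw [he]
  exact ⟨hHam, hWH⟩

theorem star_claw [DecidableEq V] (h3 : 3 ≤ Fintype.card V) (hW : WeakClawFree G)
    (ha : (star G).Adj x a) (hb : (star G).Adj x b) (hc : (star G).Adj x c) (hab : a ≠ b)
    (hac : a ≠ c) (hbc : b ≠ c) :
    (star G).Adj a b ∨ (star G).Adj a c ∨ (star G).Adj b c := by
  have hle := IsClosedGraph.star.hv_le (le_refl (star G))
  exact ((star_spec h3 hW).2 x a b c ha hb hc hab hac hbc).imp (@hle _ _)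
    fun h => h.imp (@hle _ _) (@hle _ _)

end Closure

/-! ### Maximal cliques of a closed graph -/

section Cliques

variable {V : Type*} {H : SimpleGraph V} {p q s t a b w z : V}

/-- The ends of an edge `pq` together with their common neighbours. -/
def clq (H : SimpleGraph V) (p q : V) : Set V := {s | s = p ∨ s = q ∨ (H.Adj p s ∧ H.Adj q s)}

/-- The neighbours of `z` are pairwise adjacent. -/
def Simp (H : SimpleGraph V) (z : V) : Prop := ∀ a b, H.Adj z a → H.Adj z b → a ≠ b → H.Adj a b

theorem left_mem_clq : p ∈ clq H p q := Or.inl rfl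

theorem right_mem_clq : q ∈ clq H p q := Or.inr (Or.inl rfl)

theorem mem_clq_of_adj (h1 : H.Adj p s) (h2 : H.Adj q s) : s ∈ clq H p q := Or.inr (Or.inr ⟨h1, h2⟩)

variable [Fintype V]

theorem IsClosedGraph.adj_clq (hH : IsClosedGraph H) (h : H.Adj p q) (ha : a ∈ clq H p q)
    (hb : b ∈ clq H p q) (hab : a ≠ b) : H.Adj a b := by
  rcases ha with rfl | rfl | ⟨h1, h2⟩ <;> rcases hb with rfl | rfl | ⟨h3, h4⟩
  · exact absurd rfl hab
  · exact h
  · exact h3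
  · exact h.symm
  · exact absurd rfl hab
  · exact h4
  · exact h1.symm
  · exact h2.symm
  · exact hH.diamond h h1 h3 h2 h4 hab

/-- Since `w` and any clique vertex `r` other than `a, b, w` are common neighbours of the adjacent
pair `a, b`, the diamond rule joins `w` to `r`. -/
theorem IsClosedGraph.mem_clq (hH : IsClosedGraph H) (h : H.Adj p q) (ha : a ∈ clq H p q)
    (hb : b ∈ clq H p q) (hab : a ≠ b) (h1 : H.Adj a w) (h2 : H.Adj b w) : w ∈ clq H p q := by
  have hadj := hH.adj_clq h ha hb hab
  by_cases hp : w = p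
  · exact Or.inl hp
  by_cases hq : w = q
  · exact Or.inr (Or.inl hq)
  have key : ∀ r, r ∈ clq H p q → w ≠ r → H.Adj r w := by
    intro r hr hwr
    rcases eq_or_ne a r with rfl | har
    · exact h1
    rcases eq_or_ne b r with rfl | hbr
    · exact h2
    exact hH.diamond hadj (hH.adj_clq h ha hr har) h1 (hH.adj_clq h hb hr hbr) h2 hwr.symm
  exact mem_clq_of_adj (key p left_mem_clq hp) (key q right_mem_clq hq)

/-- Two vertices of a maximal clique determine it, so distinct maximal cliques meet in at most one
vertex. -/
theorem IsClosedGraph.clq_eq (hH : IsClosedGraph H) (h : H.Adj p q) (ha : a ∈ clq H p q)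
    (hb : b ∈ clq H p q) (hab : a ≠ b) : clq H a b = clq H p q := by
  have hadj := hH.adj_clq h ha hb hab
  ext w
  constructor
  · rintro (rfl | rfl | ⟨h1, h2⟩)
    · exact ha
    · exact hb
    · exact hH.mem_clq h ha hb hab h1 h2
  · intro hw
    by_cases h1 : w = a
    · exact Or.inl h1
    by_cases h2 : w = b
    · exact Or.inr (Or.inl h2)
    exact mem_clq_of_adj (hH.adj_clq h ha hw (Ne.symm h1)) (hH.adj_clq h hb hw (Ne.symm h2))

theorem IsClosedGraph.exists_exit (hH : IsClosedGraph H) (h : H.Adj p q) (hs : ¬ Simp H w) : ∃ r, H.Adj w r ∧ r ∉ clq H p q := by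
  by_contra! hcon
  exact hs fun a b ha hb hab => hH.adj_clq h (hcon a ha) (hcon b hb) hab

end Cliques

/-! ### What minimality of the closure says about the original graph -/

section Leastness

variable {V : Type*} [Fintype V] {G : SimpleGraph V} {p q s t a b w z e : V}

/-- The graph `G` is connected inside each maximal clique of `star G`. -/
theorem exists_adj_of_cut (h : (star G).Adj p q) (A : Set V) (ha : a ∈ clq (star G) p q)
    (haA : a ∈ A) (hb : b ∈ clq (star G) p q) (hbA : b ∉ A) :
    ∃ c d, c ∈ clq (star G) p q ∧ c ∈ A ∧ d ∈ clq (star G) p q ∧ d ∉ A ∧ G.Adj c d := by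
  have hH : IsClosedGraph (star G) := IsClosedGraph.star
  by_contra! hcon
  let S := clq (star G) p q
  -- If no edge of `G` crossed the cut, removing all crossing edges of the clique would leave a
  -- smaller closed graph above `G`. The rules never force a removed edge back: a common neighbour
  -- in `F` of its ends lies in the clique, on the same side as both.
  let F : SimpleGraph V :=
    { Adj := fun x y => (star G).Adj x y ∧ (x ∈ S → y ∈ S → (x ∈ A ↔ y ∈ A))
      symm := ⟨fun x y hxy => ⟨hxy.1.symm, fun h1 h2 => (hxy.2 h2 h1).symm⟩⟩
      loopless := ⟨fun x hx => (star G).loopless.irrefl x hx.1⟩ }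
  have hFH : F ≤ star G := fun _ _ h => h.1
  have hGF : G ≤ F := by
    intro x y hxy
    refine ⟨le_star hxy, fun hx hy => ⟨fun hxA => ?_, fun hyA => ?_⟩⟩
    · by_contra hyA
      exact hcon x y hx hxA hy hyA hxy
    · by_contra hxA
      exact hcon y x hy hyA hx hxA hxy.symm
  have key : ∀ x y z, (star G).Adj y z → F.Adj x y → F.Adj x z → F.Adj y z := by
    intro x y z hyz hxy hxz
    refine ⟨hyz, fun hy hz => ?_⟩
    have hx : x ∈ S := hH.mem_clq h hy hz hyz.ne hxy.1.symm hxz.1.symm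
    exact (hxy.2 hx hy).symm.trans (hxz.2 hx hz)
  have hF : IsClosedGraph F := by
    constructor
    · intro x w y z hxw hxy hxz hwy hwz hyz
      exact key x y z (hH.diamond (hFH hxw) (hFH hxy) (hFH hxz) (hFH hwy) (hFH hwz) hyz) hxy hxz
    · intro x y hx hy hxy
      by_contra hn
      obtain ⟨w, -, -, ⟨h1, h2⟩, -⟩ := exists_common_of_heavy hx hy hxy hn
      exact hn (key w x y (hH.heavy (hx.mono hFH) (hy.mono hFH) hxy) h1.symm h2.symm)
  have h1 : F.Adj a b := star_le hGF hF (hH.adj_clq h ha hb (by rintro rfl; exact hbA haA))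
  exact hbA ((h1.2 ha hb).1 haA)

theorem exists_adj_of_adj_star (h : (star G).Adj p q) :
    ∃ s, s ∈ clq (star G) p q ∧ G.Adj p s := by
  obtain ⟨c, d, -, hc, hd, -, hcd⟩ := exists_adj_of_cut h {p} left_mem_clq rfl right_mem_clq
    (by simpa using h.ne.symm)
  obtain rfl : c = p := hc
  exact ⟨d, hd, hcd⟩

/-- If `z` were the only neighbour of `e` in `G` inside the clique, all other clique edges at `e`
could be deleted. The result is still closed, since each rule that would restore such an edge
supplies two distinct common neighbours of its ends, and both would have to be `z`. -/
theorem exists_two_adj_of_adj_star (h : (star G).Adj e s) (hn : ¬ G.Adj e s) :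
    ∃ z z', z ≠ z' ∧ z ∈ clq (star G) e s ∧ z' ∈ clq (star G) e s ∧ G.Adj e z ∧ G.Adj e z' := by
  have hH : IsClosedGraph (star G) := IsClosedGraph.star
  obtain ⟨z, hz, hez⟩ := exists_adj_of_adj_star h
  by_contra! hcon
  let S := clq (star G) e s
  let F : SimpleGraph V :=
    { Adj := fun x y => (star G).Adj x y ∧ (x = e → y ∈ S → y = z) ∧ (y = e → x ∈ S → x = z)
      symm := ⟨fun x y hxy => ⟨hxy.1.symm, hxy.2.2, hxy.2.1⟩⟩
      loopless := ⟨fun x hx => (star G).loopless.irrefl x hx.1⟩ }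
  have hFH : F ≤ star G := fun _ _ h => h.1
  have huniq : ∀ y ∈ S, G.Adj e y → y = z := by
    intro y hy hey
    by_contra hyz
    exact hcon y z hyz hy hz hey hez
  have hGF : G ≤ F := by
    intro x y hxy
    refine ⟨le_star hxy, ?_, ?_⟩
    · rintro rfl hy
      exact huniq y hy hxy
    · rintro rfl hx
      exact huniq x hx hxy.symm
  have key : ∀ x w y t, (star G).Adj y t → x ≠ w → F.Adj x y → F.Adj x t → F.Adj w y → F.Adj w t →
      F.Adj y t := by
    have aux : ∀ x w t, (star G).Adj e t → x ≠ w → F.Adj x e → F.Adj x t → F.Adj w e → F.Adj w t →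
      t ∈ S → t = z := by
      intro x w t het hxw hxe hxt hwe hwt ht
      have hx : x ∈ S := hH.mem_clq h left_mem_clq ht het.ne hxe.1.symm hxt.1.symm
      have hw : w ∈ S := hH.mem_clq h left_mem_clq ht het.ne hwe.1.symm hwt.1.symm
      exact absurd ((hxe.2.2 rfl hx).trans (hwe.2.2 rfl hw).symm) hxw
    intro x w y t hyt hxw hxy hxt hwy hwt
    refine ⟨hyt, ?_, ?_⟩
    · rintro rfl
      exact aux x w t hyt hxw hxy hxt hwy hwt
    · rintro rfl
      exact aux x w y hyt.symm hxw hxt hxy hwt hwy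
  have hF : IsClosedGraph F := by
    constructor
    · intro x w y t hxw hxy hxt hwy hwt hyt
      exact key x w y t (hH.diamond (hFH hxw) (hFH hxy) (hFH hxt) (hFH hwy) (hFH hwt) hyt)
        hxw.ne hxy hxt hwy hwt
    · intro x y hx hy hxy
      by_contra hn
      obtain ⟨w, w', hne, ⟨h1, h2⟩, h3, h4⟩ := exists_common_of_heavy hx hy hxy hn
      exact hn (key w w' x y (hH.heavy (hx.mono hFH) (hy.mono hFH) hxy) hne h1.symm h2.symm
        h3.symm h4.symm)
  have h1 : F.Adj e s := star_le hGF hF h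
  have := h1.2.1 rfl right_mem_clq
  exact hn (this ▸ hez)

/-- Two nonadjacent heavy vertices of `G` have a common neighbour that is simplicial in `star G`. -/
theorem exists_simp_common (hp : Heavy G p) (hq : Heavy G q) (hpq : p ≠ q) (hn : ¬ G.Adj p q) :
    ∃ z, Simp (star G) z ∧ G.Adj p z ∧ G.Adj q z := by
  classical
  have hH : IsClosedGraph (star G) := IsClosedGraph.star
  have hadj : (star G).Adj p q := hH.heavy (hp.mono le_star) (hq.mono le_star) hpq
  by_contra! hcon
  -- If no common neighbour is simplicial, each one has a neighbour in `star G` outside the clique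
  -- of `pq`. These exits are distinct and avoid the closed neighbourhoods of `p` and `q` in `G`, so
  -- `W` is no larger than `N`; this bounds the degree sum by the order minus two.
  let W := G.neighborSet p ∩ G.neighborSet q
  let N := ({p, q} ∪ (G.neighborSet p ∪ G.neighborSet q))ᶜ
  have hW : ∀ w, w ∈ W → w ∈ clq (star G) p q := fun w hw =>
    mem_clq_of_adj (le_star hw.1) (le_star hw.2)
  have hex : ∀ w, ∃ r, w ∈ W → (star G).Adj w r ∧ r ∉ clq (star G) p q := by
    intro w
    by_cases hw : w ∈ W
    · obtain ⟨r, hr⟩ := hH.exists_exit hadj (fun hs => hcon w hs hw.1 hw.2)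
      exact ⟨r, fun _ => hr⟩
    · exact ⟨p, fun h => absurd h hw⟩
  choose f hf using hex
  have hfN : ∀ w ∈ W, f w ∈ N := by
    intro w hw
    obtain ⟨h1, h2⟩ := hf w hw
    simp only [N, Set.mem_compl_iff, Set.mem_union, Set.mem_insert_iff, Set.mem_singleton_iff,
      SimpleGraph.mem_neighborSet]
    rintro ((h3 | h3) | (h3 | h3))
    · exact h2 (Or.inl h3)
    · exact h2 (Or.inr (Or.inl h3))
    · exact h2 (hH.mem_clq hadj (hW w hw) left_mem_clq hw.1.ne.symm h1 (le_star h3))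
    · exact h2 (hH.mem_clq hadj (hW w hw) right_mem_clq hw.2.ne.symm h1 (le_star h3))
  have hinj : Set.InjOn f W := by
    intro w hw w' hw' he
    by_contra hne
    have h3 := (hf w' hw').1
    rw [← he] at h3
    exact (hf w hw).2 (hH.mem_clq hadj (hW w hw) (hW w' hw') hne (hf w hw).1 h3)
  have h1 := Set.ncard_le_ncard_of_injOn f hfN hinj (Set.toFinite _)
  have h2 : N.ncard + ({p, q} ∪ (G.neighborSet p ∪ G.neighborSet q)).ncard = Fintype.card V := by
    rw [add_comm, Set.ncard_add_ncard_compl, Nat.card_eq_fintype_card]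
  have hdis : Disjoint {p, q} (G.neighborSet p ∪ G.neighborSet q) := by
    rw [Set.disjoint_left]
    rintro w (rfl | rfl) (h | h)
    · exact G.loopless.irrefl _ h
    · exact hn (SimpleGraph.Adj.symm h)
    · exact hn h
    · exact G.loopless.irrefl _ h
  rw [Set.ncard_union_eq hdis (Set.toFinite _) (Set.toFinite _), Set.ncard_pair hpq] at h2
  have h3 := Set.ncard_union_add_ncard_inter (G.neighborSet p) (G.neighborSet q)
    (Set.toFinite _) (Set.toFinite _)
  have h4 : W.ncard = (G.neighborSet p ∩ G.neighborSet q).ncard := rfl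
  unfold Heavy at hp hq
  omega

end Leastness

/-! ### Heavy pairs supplied by the induced subgraph conditions -/

section HeavyPairs

variable {V W : Type*} [Fintype V] {G : SimpleGraph V} [DecidableRel G.Adj]

theorem heavy_iff (v : V) : (Fintype.card V : ℝ) / 2 ≤ (G.degree v : ℝ) ↔ Heavy G v := by
  have h : (G.neighborSet v).ncard = G.degree v := by
    rw [Set.ncard_eq_toFinset_card', ← SimpleGraph.card_neighborFinset_eq_degree]; rfl
  unfold Heavy
  rw [h, div_le_iff₀ (by norm_num), mul_comm]
  exact_mod_cast Iff.rfl

theorem IsFHeavyFor.heavy_or {R : SimpleGraph W} (h : IsFHeavyFor R G) (f : R ↪g G) {i j k : W}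
    (hij : i ≠ j) (hn : ¬ R.Adj i j) (hik : R.Adj i k) (hkj : R.Adj k j) :
    Heavy G (f i) ∨ Heavy G (f j) := by
  have h1 := h (Set.range f) ⟨f.isoInduceRange⟩ ⟨f i, i, rfl⟩ ⟨f j, j, rfl⟩ ?_
  · rcases le_max_iff.1 h1 with h2 | h2
    · exact Or.inl ((heavy_iff _).1 h2)
    · exact Or.inr ((heavy_iff _).1 h2)
  have ha : (G.induce (Set.range f)).Adj ⟨f i, i, rfl⟩ ⟨f k, k, rfl⟩ := f.map_adj_iff.2 hik
  have hb : (G.induce (Set.range f)).Adj ⟨f k, k, rfl⟩ ⟨f j, j, rfl⟩ := f.map_adj_iff.2 hkj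
  have hle := SimpleGraph.dist_le (SimpleGraph.Walk.cons ha (SimpleGraph.Walk.cons hb .nil))
  have hreach : (G.induce (Set.range f)).Reachable ⟨f i, i, rfl⟩ ⟨f j, j, rfl⟩ :=
    (SimpleGraph.Walk.cons ha (SimpleGraph.Walk.cons hb .nil)).reachable
  have hne : (⟨f i, i, rfl⟩ : Set.range f) ≠ ⟨f j, j, rfl⟩ := fun he =>
    hij (f.injective (congrArg Subtype.val he))
  have h0 := hreach.pos_dist_of_ne hne
  have h1 : (G.induce (Set.range f)).dist ⟨f i, i, rfl⟩ ⟨f j, j, rfl⟩ ≠ 1 := by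
    rw [Ne, SimpleGraph.dist_eq_one_iff_adj]
    exact fun hh => hn (f.map_adj_iff.1 hh)
  simp only [SimpleGraph.Walk.length_cons, SimpleGraph.Walk.length_nil] at hle
  omega

omit [Fintype V] [DecidableRel G.Adj] in
/-- A map on `Fin n` that is compatible with adjacency on increasing pairs is an embedding. -/
theorem exists_embedding {n : ℕ} {R : SimpleGraph (Fin n)} (g : Fin n → V)
    (h : ∀ i j, i < j → (G.Adj (g i) (g j) ↔ R.Adj i j) ∧ g i ≠ g j) :
    ∃ f : R ↪g G, ∀ i, f i = g i := by
  have hinj : Function.Injective g := by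
    intro i j hij
    by_contra hne
    rcases lt_or_gt_of_ne hne with h1 | h1
    · exact (h i j h1).2 hij
    · exact (h j i h1).2 hij.symm
  refine ⟨⟨⟨g, hinj⟩, ?_⟩, fun i => rfl⟩
  intro i j
  change G.Adj (g i) (g j) ↔ R.Adj i j
  rcases lt_trichotomy i j with h1 | rfl | h1
  · exact (h i j h1).1
  · simp
  · rw [G.adj_comm, R.adj_comm]; exact (h j i h1).1

theorem claw_heavy (h : IsFHeavyFor claw G) {x a b c : V} (ha : G.Adj x a) (hb : G.Adj x b)
    (hc : G.Adj x c) (hab : a ≠ b) (hac : a ≠ c) (hbc : b ≠ c) (nab : ¬ G.Adj a b)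
    (nac : ¬ G.Adj a c) (nbc : ¬ G.Adj b c) : Heavy G a ∨ Heavy G b := by
  let g : Fin 1 ⊕ Fin 3 → V := Sum.elim (fun _ => x) ![a, b, c]
  have hinj : Function.Injective g := by
    rintro (i | i) (j | j) hij <;> fin_cases i <;> fin_cases j <;>
      simp [g, ha.ne, hb.ne, hc.ne, hab, hac, hbc, ha.ne.symm, hb.ne.symm, hc.ne.symm, hab.symm,
        hac.symm, hbc.symm] at hij ⊢
  have nba : ¬ G.Adj b a := fun h => nab h.symm
  have nca : ¬ G.Adj c a := fun h => nac h.symm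
  have ncb : ¬ G.Adj c b := fun h => nbc h.symm
  let f : claw ↪g G := ⟨⟨g, hinj⟩, by
    rintro (i | i) (j | j) <;> fin_cases i <;> fin_cases j <;>
      simp [g, claw, ha, hb, hc, ha.symm, hb.symm, hc.symm, nab, nac, nbc, nba, nca, ncb]⟩
  exact h.heavy_or f (i := Sum.inr 0) (j := Sum.inr 1) (k := Sum.inl 0) (by simp)
    (by simp [claw]) (by simp [claw]) (by simp [claw])

/-- Any three consecutive vertices of an induced path with at least seven vertices lie in a window
of exactly seven. -/
theorem path_heavy (h : IsFHeavyFor path7 G) {l : List V} (hl : IndPath G l) (h7 : 7 ≤ l.length)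
    {l₁ l₂ : List V} {x m z : V} (he : l = l₁ ++ x :: m :: z :: l₂) : Heavy G x ∨ Heavy G z := by
  -- The window starts at `x` itself unless that would overrun the list, in which case it is the
  -- last seven vertices.
  obtain ⟨s, i, hs, hi⟩ : ∃ s i : ℕ, s + 7 ≤ l.length ∧ i ≤ 4 ∧ s + i = l₁.length := by
    have : l.length = l₁.length + (l₂.length + 3) := by simp [he]
    refine ⟨min l₁.length (l.length - 7), l₁.length - min l₁.length (l.length - 7), ?_, ?_, ?_⟩ <;>
      omega
  obtain ⟨f, hf⟩ := exists_embedding (R := path7) (G := G) (fun k => l[s + k.1]'(by omega)) (by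
    intro j k hjk
    constructor
    · rw [hl.adj_getElem_iff (by omega) (by omega) (by simpa using hjk), path7,
        SimpleGraph.pathGraph_adj]
      have : j.1 < k.1 := hjk
      omega
    · intro hh
      have := (List.Nodup.getElem_inj_iff hl.nodup).1 hh
      have : j.1 < k.1 := hjk
      omega)
  have h1 := h.heavy_or f (i := ⟨i, by omega⟩) (j := ⟨i + 2, by omega⟩) (k := ⟨i + 1, by omega⟩)
    (by simp) (by simp [path7, SimpleGraph.pathGraph_adj]; omega)
    (by simp [path7, SimpleGraph.pathGraph_adj]) (by simp [path7, SimpleGraph.pathGraph_adj])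
  rw [hf, hf] at h1
  have e1 : l[s + i]'(by omega) = x := by simp [he, hi.2]
  have e2 : l[s + (i + 2)]'(by omega) = z := by
    have : s + (i + 2) = l₁.length + 2 := by omega
    simp [he, this]
  rw [← e1, ← e2]; exact h1

/-- The two pairs are at distance two in the deer, through `g₁` and through `e'` respectively. -/
theorem deer_heavy (h : IsFHeavyFor deer G) {c e e' g₁ g₂ h₁ h₂ : V}
    (hp : IndPath G [g₂, g₁, e, e', h₁, h₂]) (hce : G.Adj c e) (hce' : G.Adj c e')
    (n1 : ¬ G.Adj c g₁) (n2 : ¬ G.Adj c g₂) (n3 : ¬ G.Adj c h₁) (n4 : ¬ G.Adj c h₂) :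
    (Heavy G e ∨ Heavy G g₂) ∧ (Heavy G e ∨ Heavy G h₁) := by
  simp only [IndPath, List.mem_cons, List.not_mem_nil, or_false, forall_eq_or_imp, forall_eq,
    and_true, IsEmpty.forall_iff, implies_true] at hp
  have k1 : c ≠ g₁ := by rintro rfl; exact n2 hp.1.symm
  have k2 : c ≠ g₂ := by rintro rfl; exact n1 hp.1
  obtain ⟨p1, ⟨⟨p2, p2'⟩, ⟨p3, p3'⟩, ⟨p4, p4'⟩, p5, p5'⟩, q1, ⟨⟨q2, q2'⟩, ⟨q3, q3'⟩, q4, q4'⟩, r1,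
    ⟨⟨r2, r2'⟩, r3, r3'⟩, s1, ⟨s2, s2'⟩, t1⟩ := hp
  have k3 : c ≠ h₁ := by rintro rfl; exact n4 t1
  have k4 : c ≠ h₂ := by rintro rfl; exact n3 t1.symm
  have m1 := r1.ne; have m2 := q1.ne.symm; have m3 := p1.ne.symm; have m4 := s1.ne
  have m5 := t1.ne; have m6 := hce.ne; have m7 := hce'.ne
  obtain ⟨f, hf⟩ := exists_embedding (R := deer) (G := G) ![c, e, e', g₁, g₂, h₁, h₂] (by
    intro i j hij
    fin_cases i <;> fin_cases j <;> first
      | exact absurd hij (by decide)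
      | (simp [deer, G.adj_comm] at *; tauto))
  have h1 := h.heavy_or f (i := 1) (j := 4) (k := 3) (by decide) (by simp [deer])
    (by simp [deer]) (by simp [deer])
  have h2 := h.heavy_or f (i := 1) (j := 5) (k := 2) (by decide) (by simp [deer])
    (by simp [deer]) (by simp [deer])
  rw [hf, hf] at h1 h2
  exact ⟨h1, h2⟩

theorem hourglass_heavy (h : IsFHeavyFor hourglass G) {e x₁ x₂ y₁ y₂ : V} (h1 : G.Adj e x₁)
    (h2 : G.Adj e x₂) (h3 : G.Adj e y₁) (h4 : G.Adj e y₂) (hx : G.Adj x₁ x₂) (hy : G.Adj y₁ y₂)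
    (n11 : ¬ G.Adj x₁ y₁ ∧ x₁ ≠ y₁) (n12 : ¬ G.Adj x₁ y₂ ∧ x₁ ≠ y₂) (n21 : ¬ G.Adj x₂ y₁ ∧ x₂ ≠ y₁)
    (n22 : ¬ G.Adj x₂ y₂ ∧ x₂ ≠ y₂) : Heavy G x₁ ∨ Heavy G y₁ := by
  have m1 := h1.ne; have m2 := h2.ne; have m3 := h3.ne; have m4 := h4.ne
  have m5 := hx.ne; have m6 := hy.ne
  obtain ⟨f, hf⟩ := exists_embedding (R := hourglass) (G := G) ![e, x₁, x₂, y₁, y₂] (by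
    intro i j hij
    fin_cases i <;> fin_cases j <;> first
      | exact absurd hij (by decide)
      | (simp [hourglass]; tauto))
  have h1 := h.heavy_or f (i := 1) (j := 3) (k := 0) (by decide) (by simp [hourglass])
    (by simp [hourglass]) (by simp [hourglass])
  rw [hf, hf] at h1
  exact h1

/-- A claw-`f`-heavy graph satisfies the weak form of claw-freeness. -/
theorem IsFHeavyFor.weakClawFree (h : IsFHeavyFor claw G) : WeakClawFree G := by
  intro x a b c ha hb hc hab hac hbc
  by_contra! hcon
  obtain ⟨n1, n2, n3⟩ := hcon
  have g1 := fun h => n1 (le_hv h)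
  have g2 := fun h => n2 (le_hv h)
  have g3 := fun h => n3 (le_hv h)
  have k1 := claw_heavy h ha hb hc hab hac hbc g1 g2 g3
  have k2 := claw_heavy h ha hc hb hac hab hbc.symm g2 g1 (fun h => g3 h.symm)
  have k3 := claw_heavy h hb hc ha hbc hab.symm hac.symm g3 (fun h => g1 h.symm) (fun h => g2 h.symm)
  -- Every pair of leaves contains a heavy vertex, so two of the three leaves are heavy.
  by_cases ha' : Heavy G a
  · rcases k3 with h1 | h1
    · exact n1 (Or.inr ⟨hab, ha', h1⟩)
    · exact n2 (Or.inr ⟨hac, ha', h1⟩)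
  · exact n3 (Or.inr ⟨hbc, k1.resolve_left ha', k2.resolve_left ha'⟩)

end HeavyPairs

/-! ### Following induced paths of the closure inside the original graph -/

section Transfer

variable {V : Type*} [Fintype V] {G : SimpleGraph V} {p q s t a b v w x y z e : V}
  {P Q P₁ P₂ Q₁ Q₂ : List V}

theorem star_adj_of_heavy (hp : Heavy G p) (hq : Heavy G q) (hpq : p ≠ q) : (star G).Adj p q :=
  IsClosedGraph.star.heavy (hp.mono le_star) (hq.mono le_star) hpq

/-- `v` lies on `P`, or it is simplicial and adjacent to two consecutive vertices of `P`. -/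
def Zone (H : SimpleGraph V) (P : List V) (v : V) : Prop :=
  v ∈ P ∨ (Simp H v ∧ ∃ l₁ a b l₂, P = l₁ ++ a :: b :: l₂ ∧ H.Adj v a ∧ H.Adj v b)

/-- `v` lies on `P`, or it is simplicial and adjacent to a vertex of `P`. -/
def Near (H : SimpleGraph V) (P : List V) (v : V) : Prop :=
  v ∈ P ∨ (Simp H v ∧ ∃ a ∈ P, H.Adj v a)

section

variable {H : SimpleGraph V}

omit [Fintype V]

theorem Zone.append_left (h : Zone H Q v) : Zone H (P ++ Q) v := by
  rcases h with h | ⟨h, l₁, a, b, l₂, rfl, h1⟩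
  · exact Or.inl (List.mem_append_right _ h)
  · exact Or.inr ⟨h, P ++ l₁, a, b, l₂, by simp, h1⟩

theorem Zone.append_right (h : Zone H P v) : Zone H (P ++ Q) v := by
  rcases h with h | ⟨h, l₁, a, b, l₂, rfl, h1⟩
  · exact Or.inl (List.mem_append_left _ h)
  · exact Or.inr ⟨h, l₁, a, b, l₂ ++ Q, by simp, h1⟩

theorem Zone.near (h : Zone H P v) : Near H P v := by
  rcases h with h | ⟨h, l₁, a, b, l₂, rfl, h1, -⟩
  · exact Or.inl h
  · exact Or.inr ⟨h, a, by simp, h1⟩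

theorem Zone.near_of_append (h : Zone H (P ++ [w]) v) (hv : v ≠ w) : Near H P v := by
  rcases h with h | ⟨h, l₁, a, b, l₂, he, h1, -⟩
  · simp only [List.mem_append, List.mem_singleton] at h
    exact Or.inl (h.resolve_right hv)
  · refine Or.inr ⟨h, a, ?_, h1⟩
    rcases List.eq_nil_or_concat (b :: l₂) with h2 | ⟨l₃, c, h2⟩
    · simp at h2
    · rw [h2, List.concat_eq_append, ← List.cons_append, ← List.append_assoc] at he
      rw [(List.append_inj' he rfl).1]
      simp

theorem Zone.near_of_cons (h : Zone H (w :: P) v) (hv : v ≠ w) : Near H P v := by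
  rcases h with h | ⟨h, l₁, a, b, l₂, he, -, h1⟩
  · exact Or.inl ((List.mem_cons.1 h).resolve_left hv)
  · refine Or.inr ⟨h, b, ?_, h1⟩
    cases l₁ with
    | nil => simp at he; simp [he.2]
    | cons c l₁ => simp at he; simp [he.2]

theorem Near.mono (h : Near H P v) (hPQ : P ⊆ Q) : Near H Q v :=
  h.imp (@hPQ _) fun h => ⟨h.1, h.2.imp fun _ h2 => ⟨hPQ h2.1, h2.2⟩⟩

/-- Nonadjacency of two vertex lists extends to their surroundings. -/
theorem Near.far (h : ∀ a ∈ P, ∀ b ∈ Q, ¬ H.Adj a b ∧ a ≠ b) (hx : Near H P x) (hy : Near H Q y) :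
    ¬ H.Adj x y ∧ x ≠ y := by
  have key : ∀ a ∈ P, ¬ H.Adj a y ∧ a ≠ y := by
    intro a ha
    rcases hy with hy | ⟨hs, b, hb, hyb⟩
    · exact h a ha y hy
    · refine ⟨fun hay => ?_, ?_⟩
      · exact (h a ha b hb).1 (hs a b hay.symm hyb (h a ha b hb).2)
      · rintro rfl
        exact (h a ha b hb).1 hyb
  rcases hx with hx | ⟨hs, a, ha, hxa⟩
  · exact key x hx
  · refine ⟨fun hxy => ?_, ?_⟩
    · exact (key a ha).1 (hs a y hxa hxy (key a ha).2)
    · rintro rfl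
      exact (key a ha).1 hxa.symm

end

/-- `Q` is an induced path of `G` that follows the induced path `P` of `star G`. -/
structure Follows (G : SimpleGraph V) (P Q : List V) : Prop where
  pth : ∀ x y, Pth (star G) P x y → Pth G Q x y
  ind : IndPath G Q
  len : P.length ≤ Q.length
  zone : ∀ v ∈ Q, Zone (star G) P v

/-- No chord can arise between the two halves: apart from `w`, their vertices are near `P₁` and near
`P₂`, and nonadjacency in `star G` extends to these surroundings by `Near.far`. -/
theorem Follows.append_aux {P₁ P₂ Q₁ Q₂ : List V} (hP : IndPath (star G) (P₁ ++ w :: P₂))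
    (h₁ : Follows G (P₁ ++ [w]) (Q₁ ++ [w])) (h₂ : Follows G (w :: P₂) (w :: Q₂)) :
    Follows G (P₁ ++ w :: P₂) (Q₁ ++ w :: Q₂) := by
  refine ⟨?_, ?_, ?_, ?_⟩
  · intro x y hxy
    obtain ⟨h3, h4⟩ := hxy.split
    have h5 := h₁.pth _ _ h3
    have h6 := h₂.pth _ _ h4
    rcases eq_or_ne Q₂ [] with rfl | hQ
    · have := (show Pth G ([] ++ [w]) w y from h6).last_eq
      subst this; exact h5
    · obtain ⟨-, c, hc, h7⟩ := h6.tail_of_cons hQ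
      have := h5.append hc h7
      simpa using this
  · rw [indPath_append] at hP ⊢
    refine ⟨h₁.ind, h₂.ind, ?_⟩
    intro a ha b hb
    have haw : a ≠ w := by
      rintro rfl
      have := h₁.ind.nodup
      rw [List.nodup_append] at this
      exact this.2.2 _ ha _ (List.mem_singleton_self _) rfl
    have hbw : b ≠ w := by
      rintro rfl
      exact (List.nodup_cons.1 h₂.ind.nodup).1 hb
    have := Near.far hP.2.2 ((h₁.zone a (by simp [ha])).near_of_append haw)
      ((h₂.zone b (by simp [hb])).near_of_cons hbw)
    exact ⟨fun h => this.1 (le_star h), this.2⟩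
  · have h3 := h₁.len
    have h4 := h₂.len
    simp at h3 h4 ⊢
    omega
  · intro v hv
    rw [List.mem_append] at hv
    rcases hv with hv | hv
    · have := (h₁.zone v (by simp [hv])).append_right (Q := P₂)
      simpa using this
    · exact (h₂.zone v hv).append_left

theorem Follows.exists_last (h : Follows G (P ++ [w]) Q) (hP : IndPath (star G) (P ++ [w])) :
    ∃ Q', Q = Q' ++ [w] := by
  obtain ⟨x, y, hxy⟩ := Pth.exists hP.isChain (by simp)
  have := hxy.last_eq; subst this
  have h1 := h.pth _ _ hxy
  rcases List.eq_nil_or_concat Q with rfl | ⟨Q', c, rfl⟩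
  · exact absurd rfl h1.ne_nil
  · rw [List.concat_eq_append] at h1 ⊢
    exact ⟨Q', by rw [h1.last_eq]⟩

theorem Follows.exists_head (h : Follows G (w :: P) Q) (hP : IndPath (star G) (w :: P)) :
    ∃ Q', Q = w :: Q' := by
  obtain ⟨x, y, hxy⟩ := Pth.exists hP.isChain (by simp)
  have := hxy.head_eq; subst this
  have h1 := h.pth _ _ hxy
  cases Q with
  | nil => exact absurd rfl h1.ne_nil
  | cons c Q' => exact ⟨Q', by rw [h1.head_eq]⟩

theorem Follows.singleton (w : V) : Follows G [w] [w] := by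
  refine ⟨?_, trivial, le_rfl, fun v hv => Or.inl hv⟩
  intro x y h
  have h1 := h.head_eq
  have h2 := (show Pth (star G) ([] ++ [w]) x y from h).last_eq
  subst h1 h2
  exact Pth.singleton G _

theorem Follows.edge (h : G.Adj p q) : Follows G [p, q] [p, q] := by
  refine ⟨?_, ⟨h, by simp, trivial⟩, le_rfl, fun v hv => Or.inl hv⟩
  intro x y hxy
  have h1 := hxy.head_eq
  have h2 := (show Pth (star G) ([p] ++ [q]) x y from hxy).last_eq
  subst h1 h2
  exact Pth.cons h (Pth.singleton G _)

variable [DecidableRel G.Adj]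

/-- Adjacent vertices of `star G` are joined in `G` by an induced path whose inner vertices are
simplicial in `star G` and adjacent to both ends. -/
theorem exists_segment (hc : IsFHeavyFor claw G) (hpq : (star G).Adj p q) :
    ∃ l, Pth G l p q ∧ IndPath G l ∧ (∀ v ∈ l, v ∈ clq (star G) p q) ∧
      ∀ v ∈ l, v = p ∨ v = q ∨ Simp (star G) v := by
  classical
  have hH : IsClosedGraph (star G) := IsClosedGraph.star
  have hne : {l | Pth G l p q ∧ ∀ v ∈ l, v ∈ clq (star G) p q}.Nonempty := by
    by_contra hno
    let A : Set V := {x | ∃ l, Pth G l p x ∧ ∀ v ∈ l, v ∈ clq (star G) p q}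
    obtain ⟨c, d, hc, ⟨l, hl, hl2⟩, hd, hdA, hcd⟩ := exists_adj_of_cut hpq A
      (a := p) (b := q) left_mem_clq ⟨[p], Pth.singleton G p, by simp [left_mem_clq]⟩ right_mem_clq
      (fun ⟨l, hl⟩ => hno ⟨l, hl⟩)
    refine hdA ⟨l ++ [d], hl.concat hcd, ?_⟩
    intro v hv
    rw [List.mem_append, List.mem_singleton] at hv
    rcases hv with hv | rfl
    · exact hl2 v hv
    · exact hd
  -- Minimising length makes the walk induced; the second summand also penalises nonsimplicial
  -- vertices, so that exchanging one for a simplicial vertex at equal length is an improvement.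
  let f : List V → ℕ := fun l => l.length + l.countP (fun v => ¬ Simp (star G) v)
  obtain ⟨l, ⟨hl, hlc⟩, hmin⟩ := WellFounded.has_min (measure f).wf _ hne
  have hi : IndPath G l := by
    obtain ⟨l', hs, hp, hi⟩ := hl.exists_indPath
    by_cases he : l' = l
    · exact he ▸ hi
    · refine absurd ?_ (hmin l' ⟨hp, fun v hv => hlc v (hs.subset hv)⟩)
      have h1 : l'.length < l.length :=
        lt_of_le_of_ne hs.length_le fun h => he (hs.eq_of_length h)
      have h2 := hs.countP_le (p := fun v => ¬ Simp (star G) v)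
      change l'.length + _ < l.length + _
      omega
  refine ⟨l, hl, hi, hlc, ?_⟩
  intro v hv
  by_contra! hcon
  obtain ⟨hvp, hvq, hvs⟩ := hcon
  obtain ⟨A, B, rfl⟩ := List.append_of_mem hv
  have hA : A ≠ [] := by rintro rfl; exact hvp hl.head_eq
  have hB : B ≠ [] := by rintro rfl; exact hvq hl.last_eq
  obtain ⟨s, v', hAs, hsv, hl2⟩ := hl.of_append hA (by simp)
  obtain ⟨hv', t, hvt, hBt⟩ := hl2.tail_of_cons hB
  subst hv'
  have hst := (indPath_append.1 hi).2.2 s hAs.last_mem t hBt.head_mem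
  have hsc := hlc s (by simp [hAs.last_mem])
  have htc := hlc t (by simp [hBt.head_mem])
  have hvc := hlc v (by simp)
  -- A nonsimplicial inner vertex `v` has a neighbour `d` in `G` outside the clique, giving a claw
  -- with leaves `s, t, d`. A heavy `d` would be adjacent in `star G` to a heavy `s` or `t`, so `s`
  -- and `t` are the heavy leaves, and their simplicial common neighbour can replace `v`.
  obtain ⟨r, hvr, hr⟩ := hH.exists_exit hpq hvs
  obtain ⟨d, hd, hvd⟩ := exists_adj_of_adj_star hvr
  have hdc : d ∉ clq (star G) p q := by
    intro hdc
    have h1 : d ≠ r := fun h => hr (h ▸ hdc)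
    exact hr (hH.mem_clq hpq hvc hdc hvd.ne hvr (hH.adj_clq hvr hd right_mem_clq h1))
  have far : ∀ u ∈ clq (star G) p q, G.Adj u v → ¬ (star G).Adj u d ∧ u ≠ d := by
    intro u hu huv
    refine ⟨fun hud => hdc (hH.mem_clq hpq hu hvc huv.ne hud (le_star hvd)), ?_⟩
    rintro rfl; exact hdc hu
  obtain ⟨f1, f2⟩ := far s hsc hsv
  obtain ⟨f3, f4⟩ := far t htc hvt.symm
  have k1 := claw_heavy hc hsv.symm hvt hvd hst.2 f2 f4 hst.1 (fun h => f1 (le_star h))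
    (fun h => f3 (le_star h))
  have k2 := claw_heavy hc hsv.symm hvd hvt f2 hst.2 f4.symm (fun h => f1 (le_star h)) hst.1
    (fun h => f3 (le_star h.symm))
  have k3 := claw_heavy hc hvt hvd hsv.symm f4 hst.2.symm f2.symm (fun h => f3 (le_star h))
    (fun h => hst.1 h.symm) (fun h => f1 (le_star h.symm))
  have hdh : ¬ Heavy G d := by
    intro hd
    rcases k1 with h | h
    · exact f1 (star_adj_of_heavy h hd f2)
    · exact f3 (star_adj_of_heavy h hd f4)
  obtain ⟨z, hz, hsz, htz⟩ := exists_simp_common (k2.resolve_right hdh) (k3.resolve_right hdh)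
    hst.2 hst.1
  refine hmin (A ++ z :: B) ⟨hAs.append hsz (Pth.cons htz.symm hBt), ?_⟩ ?_
  · intro u hu
    rw [List.mem_append, List.mem_cons] at hu
    rcases hu with hu | rfl | hu
    · exact hlc u (by simp [hu])
    · exact hH.mem_clq hpq hsc htc hst.2 (le_star hsz) (le_star htz)
    · exact hlc u (by simp [hu])
  · change (A ++ z :: B).length + _ < (A ++ v :: B).length + _
    simp [List.countP_append, hz, hvs]

theorem exists_follows_edge (hc : IsFHeavyFor claw G) (hpq : (star G).Adj p q) :
    ∃ Q, Follows G [p, q] Q := by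
  obtain ⟨l, h1, h2, h3, h4⟩ := exists_segment hc hpq
  refine ⟨l, ?_, h2, ?_, ?_⟩
  · intro x y hxy
    have e1 := hxy.head_eq
    have e2 := (show Pth (star G) ([p] ++ [q]) x y from hxy).last_eq
    subst e1 e2
    exact h1
  · cases l with
    | nil => exact absurd rfl h1.ne_nil
    | cons c l =>
      cases l with
      | nil =>
        have e1 := h1.head_eq
        have e2 := (show Pth G ([] ++ [c]) p q from h1).last_eq
        exact absurd (e1.symm.trans e2) hpq.ne
      | cons d l => simp
  · intro v hv
    rcases h4 v hv with rfl | rfl | h5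
    · exact Or.inl (by simp)
    · exact Or.inl (by simp)
    · rcases h3 v hv with rfl | rfl | ⟨h6, h7⟩
      · exact Or.inl (by simp)
      · exact Or.inl (by simp)
      · exact Or.inr ⟨h5, [], p, q, [], rfl, h6.symm, h7.symm⟩

theorem exists_follows (hc : IsFHeavyFor claw G) : ∀ {P : List V}, P ≠ [] → IndPath (star G) P →
    ∃ Q, Follows G P Q
  | [], h, _ => absurd rfl h
  | [w], _, _ => ⟨[w], Follows.singleton w⟩
  | p :: q :: P, _, h => by
    obtain ⟨Q₁, hQ₁⟩ := exists_follows_edge hc h.1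
    obtain ⟨Q₂, hQ₂⟩ := exists_follows hc (List.cons_ne_nil q P) h.2.2
    obtain ⟨Q₁, rfl⟩ := hQ₁.exists_last (P := [p]) ⟨h.1, by simp, trivial⟩
    obtain ⟨Q₂, rfl⟩ := hQ₂.exists_head h.2.2
    exact ⟨_, Follows.append_aux (P₁ := [p]) h hQ₁ hQ₂⟩

/-- `star G` has no induced path on seven vertices. -/
theorem star_indPath_length (hc : IsFHeavyFor claw G) (h7 : IsFHeavyFor path7 G)
    (hP : IndPath (star G) P) : P.length < 7 := by
  by_contra! hlen
  obtain ⟨p0, p1, p2, p3, p4, p5, p6, P', rfl⟩ :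
      ∃ p0 p1 p2 p3 p4 p5 p6 P', P = p0 :: p1 :: p2 :: p3 :: p4 :: p5 :: p6 :: P' := by
    match P, hlen with
    | p0 :: p1 :: p2 :: p3 :: p4 :: p5 :: p6 :: P', _ => exact ⟨_, _, _, _, _, _, _, _, rfl⟩
  have hP' : IndPath (star G) [p0, p1, p2, p3, p4, p5, p6] :=
    IndPath.left (l₂ := P') hP
  have i1 : IndPath (star G) ([p0, p1] ++ [p2]) := IndPath.left (l₂ := [p3, p4, p5, p6]) hP'
  have i2 : IndPath (star G) (p2 :: ([p3] ++ [p4])) :=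
    IndPath.left (l₂ := [p5, p6]) (IndPath.right (l₁ := [p0, p1]) hP')
  have i3 : IndPath (star G) [p4, p5, p6] := IndPath.right (l₁ := [p0, p1, p2, p3]) hP'
  obtain ⟨A, hA⟩ := exists_follows hc (by simp) i1
  obtain ⟨B, hB⟩ := exists_follows hc (by simp) i2
  obtain ⟨C, hC⟩ := exists_follows hc (by simp) i3
  obtain ⟨A, rfl⟩ := hA.exists_last i1
  obtain ⟨C, rfl⟩ := hC.exists_head i3
  obtain ⟨B, rfl⟩ := hB.exists_head i2
  obtain ⟨B', hB'⟩ := Follows.exists_last (P := [p2, p3]) hB i2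
  have hBC := Follows.append_aux (P₁ := [p2, p3]) (Q₁ := B') (w := p4) (P₂ := [p5, p6]) (Q₂ := C)
    (IndPath.right (l₁ := [p0, p1]) hP') (by rw [← hB']; exact hB) hC
  obtain ⟨D, hD⟩ := hBC.exists_head (P := [p3, p4, p5, p6]) (IndPath.right (l₁ := [p0, p1]) hP')
  have hABC := Follows.append_aux (P₁ := [p0, p1]) (Q₁ := A) (w := p2) (P₂ := [p3, p4, p5, p6])
    (Q₂ := D) hP' hA (by rw [← hD]; exact hBC)
  have lA := hA.len
  have lC := hC.len
  have lT := hABC.len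
  -- The part following `p0, p1, p2` has at least three vertices, so two of them at distance two
  -- yield a heavy one. The part following `p4, p5, p6` does the same, and no edge of `star G` joins
  -- the two surroundings.
  obtain ⟨k, hk, hkh⟩ : ∃ k ∈ A ++ [p2], Heavy G k := by
    match hA' : A ++ [p2], lA with
    | x :: m :: z :: A'', _ =>
      have := path_heavy h7 hABC.ind lT (l₁ := []) (x := x) (m := m) (z := z) (l₂ := A'' ++ D) (by
        rw [show A ++ p2 :: D = (A ++ [p2]) ++ D by simp, hA']; simp)
      rcases this with h | h
      · exact ⟨x, by simp, h⟩
      · exact ⟨z, by simp, h⟩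
  obtain ⟨k', hk', hkh'⟩ : ∃ k' ∈ p4 :: C, Heavy G k' := by
    match C, lC, hD with
    | m :: z :: C', _, hD =>
      have := path_heavy h7 hABC.ind lT (l₁ := A ++ B') (x := p4) (m := m) (z := z) (l₂ := C') (by
        rw [← hD]; simp)
      rcases this with h | h
      · exact ⟨p4, by simp, h⟩
      · exact ⟨z, by simp, h⟩
  have hfar : ∀ a ∈ [p0, p1] ++ [p2], ∀ b ∈ [p4, p5, p6], ¬ (star G).Adj a b ∧ a ≠ b := by
    intro a ha
    exact (indPath_append (l₁ := [p0, p1, p2]) (l₂ := [p4, p5, p6]) (x := p3)).1 hP' |>.2.2 a ha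
  obtain ⟨h1, h2⟩ := Near.far hfar (hA.zone k hk).near (hC.zone k' hk').near
  exact h1 (star_adj_of_heavy hkh hkh' h2)

end Transfer

/-! ### Deer and hourglasses in the closure -/

section DeerHourglass

variable {V : Type*} [Fintype V] {G : SimpleGraph V} [DecidableRel G.Adj]
  {p q s t a b v w x y z e e' d₀ e₁ e₂ f₁ f₂ : V} {P Q P₁ P₂ Q₁ Q₂ : List V}

/-- Without the edge `ee'` the path of `G` following the spine has a seventh vertex. If `e` were
light, the vertices two steps from `e` on both sides would be heavy, yet they are nonadjacent in
`star G`. -/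
theorem star_deer_heavy_of_not_adj (hc : IsFHeavyFor claw G) (h7 : IsFHeavyFor path7 G)
    (hP : IndPath (star G) [e₂, e₁, e, e', f₁, f₂]) (hn : ¬ G.Adj e e') : Heavy G e := by
  by_contra he
  have i1 : IndPath (star G) ([e₂, e₁] ++ [e]) := IndPath.left (l₂ := [e', f₁, f₂]) hP
  have i2 : IndPath (star G) (e :: ([] ++ [e'])) :=
    IndPath.left (l₂ := [f₁, f₂]) (IndPath.right (l₁ := [e₂, e₁]) hP)
  have i3 : IndPath (star G) (e' :: [f₁, f₂]) := IndPath.right (l₁ := [e₂, e₁, e]) hP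
  have i23 : IndPath (star G) (e :: [e', f₁, f₂]) := IndPath.right (l₁ := [e₂, e₁]) hP
  obtain ⟨A, hA⟩ := exists_follows hc (by simp) i1
  obtain ⟨B, hB⟩ := exists_follows hc (by simp) i2
  obtain ⟨C, hC⟩ := exists_follows hc (by simp) i3
  obtain ⟨A, rfl⟩ := hA.exists_last i1
  obtain ⟨C, rfl⟩ := hC.exists_head i3
  obtain ⟨B, rfl⟩ := hB.exists_head i2
  have lB : 3 ≤ (e :: B).length := by
    have hp := hB.pth e e' (Pth.cons i2.1 (Pth.singleton _ _))
    match B, hp with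
    | [], hp =>
      have := (show Pth G ([] ++ [e]) e e' from hp).last_eq
      exact absurd this i2.1.ne
    | [c], hp =>
      have h1 := (show Pth G ([e] ++ [c]) e e' from hp).last_eq
      subst h1
      have := List.isChain_cons_cons.1 hp.1
      exact absurd this.1 hn
    | c :: d :: B, _ => simp
  obtain ⟨B', hB'⟩ := Follows.exists_last (P := [e]) hB i2
  have hBC := Follows.append_aux (P₁ := [e]) (Q₁ := B') (w := e') (P₂ := [f₁, f₂]) (Q₂ := C)
    i23 (by rw [← hB']; exact hB) hC
  obtain ⟨D, hD⟩ := hBC.exists_head (P := [e', f₁, f₂]) i23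
  have hABC := Follows.append_aux (P₁ := [e₂, e₁]) (Q₁ := A) (w := e) (P₂ := [e', f₁, f₂])
    (Q₂ := D) hP hA (by rw [← hD]; exact hBC)
  have lA := hA.len
  have lC := hC.len
  have lT : 7 ≤ (A ++ e :: D).length := by
    rw [hB'] at lB
    have := congrArg List.length hD
    simp at lA lB lC this ⊢
    omega
  obtain ⟨k, hk, hke, hkh⟩ : ∃ k ∈ A ++ [e], k ≠ e ∧ Heavy G k := by
    have lA' : 2 ≤ A.length := by simpa using lA
    obtain ⟨A', x, m, rfl⟩ : ∃ A' x m, A = A' ++ [x, m] := by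
      rcases List.eq_nil_or_concat A with rfl | ⟨A₁, m, rfl⟩
      · simp at lA'
      rcases List.eq_nil_or_concat A₁ with rfl | ⟨A₂, x, rfl⟩
      · simp at lA'
      · exact ⟨A₂, x, m, by simp⟩
    have h1 := path_heavy h7 hABC.ind lT (l₁ := A') (x := x) (m := m) (z := e) (l₂ := D) (by simp)
    refine ⟨x, by simp, ?_, h1.resolve_right he⟩
    rintro rfl
    have := hA.ind.nodup
    simp [List.nodup_append] at this
  obtain ⟨k', hk', hke', hkh'⟩ : ∃ k' ∈ B' ++ e' :: C, k' ≠ e ∧ Heavy G k' := by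
    have hl := hBC.len
    rw [hD] at hl ⊢
    match D, hl with
    | m :: z :: D, _ =>
      have h1 := path_heavy h7 hABC.ind lT (l₁ := A) (x := e) (m := m) (z := z) (l₂ := D) rfl
      refine ⟨z, by simp, ?_, h1.resolve_left he⟩
      rintro rfl
      have := hABC.ind.nodup
      simp [List.nodup_append] at this
  obtain ⟨h1, h2⟩ := Near.far (indPath_append (l₁ := [e₂, e₁]) (x := e) (l₂ := [e', f₁, f₂]) |>.1
    hP).2.2 ((hA.zone k hk).near_of_append hke) ((hBC.zone k' hk').near_of_cons hke')
  exact h1 (star_adj_of_heavy hkh hkh' h2)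

/-- The middle vertices `e`, `e'` of a deer of `star G` that are adjacent in `G`: either `e` is heavy
or `e` and `e'` have a common neighbour not adjacent to the ends of the legs. -/
theorem exists_deer_top (hc : IsFHeavyFor claw G)
    (hP : IndPath (star G) [e₂, e₁, e, e', f₁, f₂]) (hd : (star G).Adj e d₀)
    (hd' : (star G).Adj e' d₀) (n1 : ¬ (star G).Adj d₀ e₂) (n2 : ¬ (star G).Adj d₀ f₂)
    (hee' : G.Adj e e') (he : ¬ Heavy G e) :
    ∃ c, G.Adj c e ∧ G.Adj c e' ∧ ¬ (star G).Adj c e₂ ∧ ¬ (star G).Adj c f₂ := by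
  have hH : IsClosedGraph (star G) := IsClosedGraph.star
  by_contra! hno
  simp only [IndPath, List.mem_cons, List.not_mem_nil, or_false, forall_eq_or_imp, forall_eq,
    and_true, IsEmpty.forall_iff, implies_true] at hP
  obtain ⟨p1, ⟨⟨p2, p2'⟩, ⟨p3, p3'⟩, ⟨p4, p4'⟩, p5, p5'⟩, q1, ⟨⟨q2, q2'⟩, ⟨q3, q3'⟩, q4, q4'⟩, r1,
    ⟨⟨r2, r2'⟩, r3, r3'⟩, s1, ⟨s2, s2'⟩, t1⟩ := hP
  have he₁T : e₁ ∉ clq (star G) e e' := by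
    rintro (h | h | h)
    · exact q1.ne h
    · exact q2' h
    · exact q2 h.2.symm
  have hf₁T : f₁ ∉ clq (star G) e e' := by
    rintro (h | h | h)
    · exact r2' h.symm
    · exact s1.ne h.symm
    · exact r2 h.1
  have he₂T : e₂ ∉ clq (star G) e e' := by
    rintro (h | h | h)
    · exact p2' h
    · exact p3' h
    · exact p2 h.1.symm
  have hf₂T : f₂ ∉ clq (star G) e e' := by
    rintro (h | h | h)
    · exact r3' h.symm
    · exact s2' h.symm
    · exact r3 h.1
  -- A simplicial neighbour of `e` sees neither `e₂` nor `f₂`, as `e` is adjacent to neither in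
  -- `star G`; so it would be the desired vertex.
  have hsimp : ∀ z, Simp (star G) z → G.Adj z e → G.Adj z e' → False := by
    intro z hz hze hze'
    have h1 : ¬ (star G).Adj z e₂ := fun h => p2 (hz _ _ h (le_star hze) p2')
    exact (hno z hze hze' h1) |> fun h => r3 (hz _ _ (le_star hze) h r3')
  obtain ⟨s', hs', hes'⟩ := exists_adj_of_adj_star s1
  obtain ⟨s, hs, hes⟩ := exists_adj_of_adj_star q1.symm
  have hs'T : s' ∉ clq (star G) e e' := by
    intro h
    exact hf₁T (hH.mem_clq r1 h right_mem_clq hes'.ne.symm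
      (hH.adj_clq s1 hs' right_mem_clq (by rintro rfl; exact hf₁T h)) s1)
  have hsT : s ∉ clq (star G) e e' := by
    intro h
    exact he₁T (hH.mem_clq r1 h left_mem_clq hes.ne.symm
      (hH.adj_clq q1.symm hs right_mem_clq (by rintro rfl; exact he₁T h)) q1.symm)
  have farT : ∀ u r c, u ∈ clq (star G) e e' → c ∈ clq (star G) e e' → u ≠ c → G.Adj u r →
      r ∉ clq (star G) e e' → ¬ (star G).Adj c r ∧ c ≠ r := by
    intro u r c hu hc huc hur hr
    refine ⟨fun h => hr (hH.mem_clq r1 hu hc huc (le_star hur) h), ?_⟩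
    rintro rfl; exact hr hc
  have memT : ∀ c, G.Adj c e → G.Adj c e' → c ∈ clq (star G) e e' := fun c h1 h2 =>
    mem_clq_of_adj (le_star h1.symm) (le_star h2.symm)
  -- If `c` and `d` were nonadjacent, the claw at `u` with leaves `r, c, d` and `c` light would make
  -- `r` and `d` heavy, hence adjacent in `star G`; but `r` has only `u` as a neighbour in the
  -- clique.
  have clawT : ∀ u r c d, u ∈ clq (star G) e e' → c ∈ clq (star G) e e' → d ∈ clq (star G) e e' →
      r ∉ clq (star G) e e' → G.Adj u r → G.Adj u c → G.Adj u d → c ≠ d → ¬ Heavy G c →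
      G.Adj c d := by
    intro u r c d hu hcT hdT hr hur huc hud hcd hch
    by_contra hn
    obtain ⟨g1, g2⟩ := farT u r c hu hcT huc.ne hur hr
    obtain ⟨g3, g4⟩ := farT u r d hu hdT hud.ne hur hr
    have k1 := claw_heavy hc hur huc hud g2.symm g4.symm hcd (fun h => g1 (le_star h.symm))
      (fun h => g3 (le_star h.symm)) hn
    have k2 := claw_heavy hc huc hud hur hcd g2 g4 hn (fun h => g1 (le_star h))
      (fun h => g3 (le_star h))
    exact g3 (star_adj_of_heavy (k2.resolve_left hch) (k1.resolve_right hch) g4)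
  have hX' : ∀ c, c ∈ clq (star G) e e' → c ≠ e → G.Adj c e' → G.Adj c e := by
    intro c hcT hce hce'
    exact (clawT e' s' e c right_mem_clq left_mem_clq hcT hs'T hes' hee'.symm hce'.symm hce.symm
      he).symm
  have hX : ∀ c, c ∈ clq (star G) e e' → c ≠ e' → G.Adj c e → G.Adj c e' := by
    intro c hcT hce' hce
    by_contra hn
    have hch : Heavy G c := by
      by_contra hch
      exact hn (clawT e s c e' left_mem_clq hcT right_mem_clq hsT hes hce.symm hee' hce' hch)
    have heh' : Heavy G e' := by
      by_contra heh'
      exact hn (clawT e s e' c left_mem_clq right_mem_clq hcT hsT hes hee' hce.symm hce'.symm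
        heh').symm
    obtain ⟨z, hz, hcz, hz'⟩ := exists_simp_common hch heh' hce' hn
    have hzT : z ∈ clq (star G) e e' := hH.mem_clq r1 hcT right_mem_clq hce' (le_star hcz)
      (le_star hz')
    have hze : z ≠ e := by
      rintro rfl
      exact q2 (hz _ _ q1.symm r1 q2')
    exact hsimp z hz (hX' z hzT hze hz'.symm) hz'.symm
  -- The set cut off consists of `e`, `e'` and their common neighbours in `G`, and it misses `d₀`.
  -- An edge `γd` leaving it must start at such a common neighbour, which by `hno` has an exit from
  -- the clique; a claw at `γ` then forces the edge `de`.
  obtain ⟨γ, d, hγT, hγ, hdT, hd2, hγd⟩ := exists_adj_of_cut r1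
    (a := e) (b := d₀) {c | c = e ∨ c = e' ∨ (G.Adj c e ∧ G.Adj c e')} left_mem_clq (Or.inl rfl)
    (mem_clq_of_adj hd hd') (by
      rintro (h | h | h)
      · exact hd.ne h.symm
      · exact hd'.ne h.symm
      · exact n2 (hno d₀ h.1 h.2 n1))
  have hde : d ≠ e := fun h => hd2 (Or.inl h)
  have hde' : d ≠ e' := fun h => hd2 (Or.inr (Or.inl h))
  have hnd : ¬ G.Adj d e := fun h => hd2 (Or.inr (Or.inr ⟨h, hX d hdT hde' h⟩))
  rcases hγ with rfl | rfl | ⟨h1, h2⟩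
  · exact hnd hγd.symm
  · exact hnd (hX' d hdT hde hγd.symm)
  · obtain ⟨t, hγt, htT⟩ : ∃ t, (star G).Adj γ t ∧ t ∉ clq (star G) e e' := by
      by_cases h3 : (star G).Adj γ e₂
      · exact ⟨e₂, h3, he₂T⟩
      · exact ⟨f₂, hno γ h1 h2 h3, hf₂T⟩
    obtain ⟨r, hr, hγr⟩ := exists_adj_of_adj_star hγt
    have hrT : r ∉ clq (star G) e e' := by
      intro h
      exact htT (hH.mem_clq r1 h hγT hγr.ne.symm
        (hH.adj_clq hγt hr right_mem_clq (by rintro rfl; exact htT h)) hγt)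
    exact hnd (clawT γ r e d hγT left_mem_clq hdT hrT hγr h1 hγd hde.symm he).symm

/-- With the edge `ee'` present, a suitable top vertex and the paths following the legs form a deer
of `G`. A light `e` would make `g₂` and `h₁` heavy, although they lie near nonadjacent parts of the
spine. -/
theorem star_deer_heavy (hc : IsFHeavyFor claw G) (h7 : IsFHeavyFor path7 G)
    (hD : IsFHeavyFor deer G) (hP : IndPath (star G) [e₂, e₁, e, e', f₁, f₂])
    (hd : (star G).Adj e d₀) (hd' : (star G).Adj e' d₀) (n1 : ¬ (star G).Adj d₀ e₂)
    (n2 : ¬ (star G).Adj d₀ f₂) : Heavy G e := by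
  have hH : IsClosedGraph (star G) := IsClosedGraph.star
  by_cases hee' : G.Adj e e'
  swap
  · exact star_deer_heavy_of_not_adj hc h7 hP hee'
  by_contra he
  obtain ⟨c, hce, hce', m1, m2⟩ := exists_deer_top hc hP hd hd' n1 n2 hee' he
  have i1 : IndPath (star G) ([e₂, e₁] ++ [e]) := IndPath.left (l₂ := [e', f₁, f₂]) hP
  have i3 : IndPath (star G) (e' :: [f₁, f₂]) := IndPath.right (l₁ := [e₂, e₁, e]) hP
  have i23 : IndPath (star G) (e :: [e', f₁, f₂]) := IndPath.right (l₁ := [e₂, e₁]) hP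
  obtain ⟨A, hA⟩ := exists_follows hc (by simp) i1
  obtain ⟨C, hC⟩ := exists_follows hc (by simp) i3
  obtain ⟨A, rfl⟩ := hA.exists_last i1
  obtain ⟨C, rfl⟩ := hC.exists_head i3
  have hBC := Follows.append_aux (P₁ := [e]) (Q₁ := [e]) (w := e') (P₂ := [f₁, f₂]) (Q₂ := C)
    i23 (Follows.edge hee') hC
  have hABC := Follows.append_aux (P₁ := [e₂, e₁]) (Q₁ := A) (w := e) (P₂ := [e', f₁, f₂])
    (Q₂ := e' :: C) hP hA hBC
  have hall := (indPath_append (l₁ := [e₂, e₁]) (x := e) (l₂ := [e', f₁, f₂]) |>.1 hP).2.2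
  obtain ⟨A', g₂, g₁, rfl⟩ : ∃ A' x m, A = A' ++ [x, m] := by
    have lA' : 2 ≤ A.length := by simpa using hA.len
    rcases List.eq_nil_or_concat A with rfl | ⟨A₁, m, rfl⟩
    · simp at lA'
    rcases List.eq_nil_or_concat A₁ with rfl | ⟨A₂, x, rfl⟩
    · simp at lA'
    · exact ⟨A₂, x, m, by simp⟩
  have hnA := hA.ind.nodup
  simp [List.nodup_append] at hnA
  match C, hC.len with
  | h₁ :: h₂ :: C, _ =>
    have hnC := hC.ind.nodup
    simp at hnC
    have hg₁ : Near (star G) [e₂, e₁] g₁ :=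
      (hA.zone g₁ (by simp)).near_of_append (by rintro rfl; simp at hnA)
    have hg₂ : Near (star G) [e₂, e₁] g₂ :=
      (hA.zone g₂ (by simp)).near_of_append (by rintro rfl; simp at hnA)
    have hh₁ : Near (star G) [f₁, f₂] h₁ :=
      (hC.zone h₁ (by simp)).near_of_cons (by rintro rfl; simp at hnC)
    have hh₂ : Near (star G) [f₁, f₂] h₂ :=
      (hC.zone h₂ (by simp)).near_of_cons (by rintro rfl; simp at hnC)
    have hcT : c ∈ clq (star G) e e' := mem_clq_of_adj (le_star hce.symm) (le_star hce'.symm)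
    have hc0 : Near (star G) [c] c := Or.inl (by simp)
    have hce₁ : ¬ (star G).Adj c e₁ := by
      intro h
      rcases hH.mem_clq i23.1 hcT left_mem_clq hce.ne h hP.2.2.1.symm with h2 | h2 | h2
      · exact hP.2.2.1.ne h2
      · exact (hP.2.2.2.1 e' (by simp)).2 h2
      · exact (hP.2.2.2.1 e' (by simp)).1 h2.2.symm
    have hcf₁ : ¬ (star G).Adj c f₁ := by
      intro h
      rcases hH.mem_clq i23.1 hcT right_mem_clq hce'.ne h i3.1 with h2 | h2 | h2
      · exact (i23.2.1 f₁ (by simp)).2 h2.symm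
      · exact i3.1.ne h2.symm
      · exact (i23.2.1 f₁ (by simp)).1 h2.1
    have hcE : ∀ x ∈ [c], ∀ y ∈ [e₂, e₁], ¬ (star G).Adj x y ∧ x ≠ y := by
      simp only [List.mem_cons, List.not_mem_nil, or_false, forall_eq_or_imp, forall_eq]
      refine ⟨⟨m1, ?_⟩, hce₁, ?_⟩
      · rintro rfl
        exact (hP.2.1 e (by simp)).1 (le_star hce)
      · rintro rfl
        exact (hP.2.2.2.1 e' (by simp)).1 (le_star hce')
    have hcF : ∀ x ∈ [c], ∀ y ∈ [f₁, f₂], ¬ (star G).Adj x y ∧ x ≠ y := by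
      simp only [List.mem_cons, List.not_mem_nil, or_false, forall_eq_or_imp, forall_eq]
      refine ⟨⟨hcf₁, ?_⟩, m2, ?_⟩
      · rintro rfl
        exact (i23.2.1 c (by simp)).1 (le_star hce.symm)
      · rintro rfl
        exact (i23.2.1 c (by simp)).1 (le_star hce.symm)
    have hi : IndPath G [g₂, g₁, e, e', h₁, h₂] := by
      have h := hABC.ind
      rw [show (A' ++ [g₂, g₁]) ++ e :: e' :: h₁ :: h₂ :: C =
        A' ++ ([g₂, g₁, e, e', h₁, h₂] ++ C) by simp] at h
      exact h.right.left
    obtain ⟨k1, k2⟩ := deer_heavy hD hi hce hce'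
      (fun h => (Near.far hcE hc0 hg₁).1 (le_star h)) (fun h => (Near.far hcE hc0 hg₂).1 (le_star h))
      (fun h => (Near.far hcF hc0 hh₁).1 (le_star h)) (fun h => (Near.far hcF hc0 hh₂).1 (le_star h))
    obtain ⟨h1, h2⟩ := Near.far hall hg₂ (hh₁.mono (List.subset_cons_self _ _))
    exact h1 (star_adj_of_heavy (k1.resolve_left he) (k2.resolve_left he) h2)

/-- The clique of the edge `pq` contains two heavy vertices. -/
def TwoHeavy (G : SimpleGraph V) (p q : V) : Prop :=
  ∃ k k', k ≠ k' ∧ k ∈ clq (star G) p q ∧ k' ∈ clq (star G) p q ∧ Heavy G k ∧ Heavy G k'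

omit [DecidableRel G.Adj] in
-- Any further heavy vertex is adjacent in `star G` to both heavy vertices of the clique and is
-- therefore absorbed by it.
theorem TwoHeavy.heavy_mem (h : TwoHeavy G p q) (hpq : (star G).Adj p q) (hx : Heavy G x) :
    x ∈ clq (star G) p q := by
  obtain ⟨k, k', hne, h1, h2, h3, h4⟩ := h
  by_cases hk : k = x
  · exact hk ▸ h1
  by_cases hk' : k' = x
  · exact hk' ▸ h2
  exact IsClosedGraph.star.mem_clq hpq h1 h2 hne (star_adj_of_heavy h3 hx hk)
    (star_adj_of_heavy h4 hx hk')

omit [DecidableRel G.Adj] in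
/-- The clique with two heavy vertices is unique. -/
theorem TwoHeavy.clq_eq (h : TwoHeavy G p q) (hpq : (star G).Adj p q) (h' : TwoHeavy G s t)
    (hst : (star G).Adj s t) : clq (star G) p q = clq (star G) s t := by
  obtain ⟨k, k', hne, h1, h2, h3, h4⟩ := h
  rw [← IsClosedGraph.star.clq_eq hpq h1 h2 hne]
  exact IsClosedGraph.star.clq_eq hst (h'.heavy_mem hst h3) (h'.heavy_mem hst h4) hne

omit [DecidableRel G.Adj] in
theorem exists_two_adj (hes : (star G).Adj e s) (hex : (star G).Adj e x) (hsx : (star G).Adj s x) :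
    ∃ z z', z ≠ z' ∧ z ∈ clq (star G) e s ∧ z' ∈ clq (star G) e s ∧ G.Adj e z ∧ G.Adj e z' := by
  by_cases h1 : G.Adj e s
  · by_cases h2 : G.Adj e x
    · exact ⟨s, x, hsx.ne, right_mem_clq, mem_clq_of_adj hex hsx, h1, h2⟩
    · obtain ⟨z, z', h3, h4, h5, h6⟩ := exists_two_adj_of_adj_star hex h2
      rw [IsClosedGraph.star.clq_eq hes left_mem_clq (mem_clq_of_adj hex hsx) hex.ne] at h4 h5
      exact ⟨z, z', h3, h4, h5, h6⟩
  · exact exists_two_adj_of_adj_star hes h1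

/-- Of two triangles of `star G` sharing exactly one vertex, one lies in a clique with two heavy
vertices. -/
theorem star_hourglass_heavy (hc : IsFHeavyFor claw G) (hG : IsFHeavyFor hourglass G)
    (hes : (star G).Adj e s) (hex : (star G).Adj e x) (hsx : (star G).Adj s x)
    (het : (star G).Adj e t) (hey : (star G).Adj e y) (hty : (star G).Adj t y)
    (hst : ¬ (star G).Adj s t) (hne : s ≠ t) : TwoHeavy G e s ∨ TwoHeavy G e t := by
  have hH : IsClosedGraph (star G) := IsClosedGraph.star
  obtain ⟨x₁, x₂, hx, hx₁, hx₂, gx₁, gx₂⟩ := exists_two_adj hes hex hsx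
  obtain ⟨y₁, y₂, hy, hy₁, hy₂, gy₁, gy₂⟩ := exists_two_adj het hey hty
  have htS : t ∉ clq (star G) e s := by
    rintro (h | h | h)
    · exact het.ne h.symm
    · exact hne h.symm
    · exact hst h.2
  have far : ∀ u ∈ clq (star G) e s, ∀ v ∈ clq (star G) e t, G.Adj e u → G.Adj e v →
      ¬ (star G).Adj u v ∧ u ≠ v := by
    intro u hu v hv heu hev
    have hvS : v ∉ clq (star G) e s := by
      intro h
      have h2 := hH.clq_eq hes left_mem_clq h hev.ne
      rw [hH.clq_eq het left_mem_clq hv hev.ne] at h2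
      exact htS (h2 ▸ right_mem_clq)
    refine ⟨fun huv => hvS (hH.mem_clq hes left_mem_clq hu heu.ne (le_star hev) huv), ?_⟩
    rintro rfl; exact hvS hu
  have f11 := far _ hx₁ _ hy₁ gx₁ gy₁
  have f12 := far _ hx₁ _ hy₂ gx₁ gy₂
  have f21 := far _ hx₂ _ hy₁ gx₂ gy₁
  have f22 := far _ hx₂ _ hy₂ gx₂ gy₂
  have g11 : ¬ G.Adj x₁ y₁ ∧ x₁ ≠ y₁ := ⟨fun h => f11.1 (le_star h), f11.2⟩
  have g12 : ¬ G.Adj x₁ y₂ ∧ x₁ ≠ y₂ := ⟨fun h => f12.1 (le_star h), f12.2⟩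
  have g21 : ¬ G.Adj x₂ y₁ ∧ x₂ ≠ y₁ := ⟨fun h => f21.1 (le_star h), f21.2⟩
  have g22 : ¬ G.Adj x₂ y₂ ∧ x₂ ≠ y₂ := ⟨fun h => f22.1 (le_star h), f22.2⟩
  -- If `x₁` and `x₂` are nonadjacent in `G`, they form a claw at `e` with `y₁`. A heavy `y₁` would
  -- be adjacent in `star G` to a heavy `x₁` or `x₂`, so both of these are the heavy leaves.
  by_cases h1 : G.Adj x₁ x₂
  swap
  · left
    refine ⟨x₁, x₂, hx, hx₁, hx₂, ?_⟩
    have k1 := claw_heavy hc gx₁ gx₂ gy₁ hx g11.2 g21.2 h1 g11.1 g21.1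
    have k2 := claw_heavy hc gx₁ gy₁ gx₂ g11.2 hx g21.2.symm g11.1 h1 (fun h => g21.1 h.symm)
    have k3 := claw_heavy hc gx₂ gy₁ gx₁ g21.2 hx.symm g11.2.symm g21.1 (fun h => h1 h.symm)
      (fun h => g11.1 h.symm)
    have hk : ¬ Heavy G y₁ := by
      intro hk
      rcases k1 with h | h
      · exact f11.1 (star_adj_of_heavy h hk f11.2)
      · exact f21.1 (star_adj_of_heavy h hk f21.2)
    exact ⟨k2.resolve_right hk, k3.resolve_right hk⟩
  by_cases h2 : G.Adj y₁ y₂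
  swap
  · right
    refine ⟨y₁, y₂, hy, hy₁, hy₂, ?_⟩
    have k1 := claw_heavy hc gy₁ gy₂ gx₁ hy g11.2.symm g12.2.symm h2 (fun h => g11.1 h.symm)
      (fun h => g12.1 h.symm)
    have k2 := claw_heavy hc gy₁ gx₁ gy₂ g11.2.symm hy g12.2 (fun h => g11.1 h.symm) h2 g12.1
    have k3 := claw_heavy hc gy₂ gx₁ gy₁ g12.2.symm hy.symm g11.2 (fun h => g12.1 h.symm)
      (fun h => h2 h.symm) g11.1
    have hk : ¬ Heavy G x₁ := by
      intro hk
      rcases k1 with h | h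
      · exact f11.1 (star_adj_of_heavy hk h f11.2)
      · exact f12.1 (star_adj_of_heavy hk h f12.2)
    exact ⟨k2.resolve_right hk, k3.resolve_right hk⟩
  have k11 := hourglass_heavy hG gx₁ gx₂ gy₁ gy₂ h1 h2 g11 g12 g21 g22
  have k12 := hourglass_heavy hG gx₁ gx₂ gy₂ gy₁ h1 h2.symm g12 g11 g22 g21
  have k21 := hourglass_heavy hG gx₂ gx₁ gy₁ gy₂ h1.symm h2 g21 g22 g11 g12
  have k22 := hourglass_heavy hG gx₂ gx₁ gy₂ gy₁ h1.symm h2.symm g22 g21 g12 g11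
  -- Each of the four pairs `xᵢ, yⱼ` contains a heavy vertex, so both `xᵢ` or both `yⱼ` are heavy.
  by_cases hk1 : Heavy G x₁
  · by_cases hk2 : Heavy G x₂
    · exact Or.inl ⟨x₁, x₂, hx, hx₁, hx₂, hk1, hk2⟩
    · exact Or.inr ⟨y₁, y₂, hy, hy₁, hy₂, k21.resolve_left hk2, k22.resolve_left hk2⟩
  · exact Or.inr ⟨y₁, y₂, hy, hy₁, hy₂, k11.resolve_left hk1, k12.resolve_left hk1⟩

end DeerHourglass

/-! ### Walks recorded by their inner vertices -/

section Links

variable {V : Type*} {H : SimpleGraph V} {u v w x y m a f p : V} {A B Q Z F : List V}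

/-- `u :: Q ++ [v]` is a walk of `H`. -/
def Link (H : SimpleGraph V) : V → List V → V → Prop
  | u, [], v => H.Adj u v
  | u, a :: Q, v => H.Adj u a ∧ Link H a Q v

theorem link_append : ∀ {A : List V} {u : V},
    Link H u (A ++ m :: B) v ↔ Link H u A m ∧ Link H m B v
  | [], u => Iff.rfl
  | a :: A, u => by
    have ih := @link_append A a
    simp only [List.cons_append, Link, ih]
    tauto

theorem link_concat : Link H u (A ++ [m]) v ↔ Link H u A m ∧ H.Adj m v := link_append

theorem Link.reverse : ∀ {Q : List V} {u : V}, Link H u Q v → Link H v Q.reverse u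
  | [], _, h => SimpleGraph.Adj.symm h
  | a :: Q, u, h => by
    rw [List.reverse_cons]
    exact link_concat.2 ⟨Link.reverse h.2, h.1.symm⟩

theorem Link.pth : ∀ {Q : List V} {u : V}, Link H u Q v → Pth H (u :: (Q ++ [v])) u v
  | [], _, h => Pth.cons h (Pth.singleton H v)
  | _ :: _, _, h => Pth.cons h.1 (Link.pth h.2)

theorem Pth.link : ∀ {Q : List V} {u : V}, Pth H (u :: (Q ++ [v])) u v → Link H u Q v
  | [], _, h => (List.isChain_cons_cons.1 h.1).1
  | a :: Q, u, h => by
    obtain ⟨-, b, hb, h2⟩ := h.tail_of_cons (by simp)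
    obtain rfl : a = b := h2.head_eq
    exact ⟨hb, Pth.link h2⟩

theorem Link.cyc (h : Link H u Q u) : Cyc H (u :: Q) := by
  rcases List.eq_nil_or_concat Q with rfl | ⟨Z, z, rfl⟩
  · exact absurd h (H.loopless.irrefl u)
  · rw [List.concat_eq_append] at h ⊢
    obtain ⟨h1, h2⟩ := link_concat.1 h
    exact ⟨u, z, h1.pth, h2⟩

theorem Cyc.link (h : Cyc H (u :: Q)) (hQ : Q ≠ []) : Link H u Q u := by
  obtain ⟨x, y, h1, h2⟩ := h
  obtain rfl := h1.head_eq
  rcases List.eq_nil_or_concat Q with rfl | ⟨Z, z, rfl⟩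
  · exact absurd rfl hQ
  · rw [List.concat_eq_append] at h1 ⊢
    obtain rfl := (show Pth H ((u :: Z) ++ [z]) u y from h1).last_eq
    exact link_concat.2 ⟨h1.link, h2⟩

theorem Link.change_end (h : Link H f F u) (hF : f :: F = Z ++ [a]) (ha : H.Adj a w) :
    Link H f F w := by
  cases Z with
  | nil => simp at hF; obtain ⟨rfl, rfl⟩ := hF; exact ha
  | cons z Z =>
    simp at hF; obtain ⟨rfl, rfl⟩ := hF
    exact link_concat.2 ⟨(link_concat.1 h).1, ha⟩

theorem Link.reverse_between (h : Link H f F u) (hF : f :: F = Z ++ [a]) (ha : H.Adj x a)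
    (hf : H.Adj f y) : Link H x (f :: F).reverse y := by
  rw [List.reverse_cons, link_concat]
  refine ⟨?_, hf⟩
  exact (h.change_end hF ha.symm).reverse

end Links

/-! ### A longest cycle with an outside path -/

section Configurations

variable {V : Type*} {H : SimpleGraph V} {u v a b a' b' c p q f r s t x y z β γ : V}
  {A B Q Q₁ Q₂ P P₁ P₂ F F₁ F₂ Z : List V}

/-- A longest cycle `u Q₁ v Q₂` together with a path `P` outside it joining `u` and `v`. -/
structure Conf (H : SimpleGraph V) (u v : V) (Q₁ Q₂ P : List V) : Prop where
  nodup : (u :: (Q₁ ++ v :: (Q₂ ++ P))).Nodup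
  link₁ : Link H u Q₁ v
  link₂ : Link H v Q₂ u
  linkP : Link H u P v
  ne : P ≠ []
  longest : ∀ x l, (x :: l).Nodup → Link H x l x → l.length ≤ Q₁.length + Q₂.length + 1

variable [DecidableEq V]

theorem Conf.swap (h : Conf H u v Q₁ Q₂ P) : Conf H v u Q₁.reverse Q₂.reverse P.reverse where
  nodup := nodup_of_count h.nodup (by intro a; simp [List.count_append, List.count_cons]; omega)
  link₁ := h.link₁.reverse
  link₂ := h.link₂.reverse
  linkP := h.linkP.reverse
  ne := by simpa using h.ne
  longest := by simpa using h.longest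

theorem Conf.flip (h : Conf H u v Q₁ Q₂ P) : Conf H u v Q₂.reverse Q₁.reverse P where
  nodup := nodup_of_count h.nodup (by intro a; simp [List.count_append, List.count_cons]; omega)
  link₁ := h.link₂.reverse
  link₂ := h.link₁.reverse
  linkP := h.linkP
  ne := h.ne
  longest := by
    intro x l h1 h2
    have := h.longest x l h1 h2
    simp
    omega

theorem Conf.length_le (h : Conf H u v Q₁ Q₂ P) (hl : Link H x Q x)
    (hc : ∀ a, (x :: Q).count a ≤ (u :: (Q₁ ++ v :: (Q₂ ++ P))).count a) :
    Q.length ≤ Q₁.length + Q₂.length + 1 :=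
  h.longest x Q (nodup_of_count h.nodup hc) hl

omit [DecidableEq V] in
theorem Conf.length_pos (h : Conf H u v Q₁ Q₂ P) : 0 < P.length := List.length_pos_of_ne_nil h.ne

/-- Replacing an empty arc by `P` would lengthen the cycle. -/
theorem Conf.not_adj (h : Conf H u v [] Q₂ P) : False := by
  have := h.length_le (x := u) (Q := P ++ v :: Q₂) (link_append.2 ⟨h.linkP, h.link₂⟩)
    (by intro a; simp [List.count_append, List.count_cons]; omega)
  have h0 := h.length_pos
  simp only [List.length_append, List.length_cons, List.length_nil] at this
  omega

theorem Conf.not_adj_head₁ (h : Conf H u v (a :: A) Q₂ P) (hp : p ∈ P) : ¬ H.Adj p a := by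
  intro hpa
  obtain ⟨P₁, P₂, rfl⟩ := List.append_of_mem hp
  have := h.length_le (x := u) (Q := P₁ ++ p :: (a :: (A ++ v :: Q₂)))
    (link_append.2 ⟨(link_append.1 h.linkP).1, hpa, link_append.2 ⟨h.link₁.2, h.link₂⟩⟩)
    (by intro a; simp [List.count_append, List.count_cons]; omega)
  simp at this
  omega

theorem Conf.not_adj_last₂ (h : Conf H u v Q₁ (A ++ [a']) P) (hp : p ∈ P) : ¬ H.Adj p a' := by
  have h1 := h.flip
  rw [List.reverse_append] at h1
  exact h1.not_adj_head₁ (A := A.reverse) hp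

/-- Claw-freeness. -/
def ClawFree (H : SimpleGraph V) : Prop :=
  ∀ x a b c, H.Adj x a → H.Adj x b → H.Adj x c → a ≠ b → a ≠ c → b ≠ c →
    H.Adj a b ∨ H.Adj a c ∨ H.Adj b c

/-- Claw-freeness at `u`, applied to its two cycle neighbours and the first vertex of `P`, leaves no
other edge. -/
theorem Conf.adj_ends (hC : ClawFree H) (h : Conf H u v (a :: A) (B ++ [a']) P) : H.Adj a a' := by
  obtain ⟨r, P, rfl⟩ := List.exists_cons_of_ne_nil h.ne
  have hn := h.nodup
  have h1 := h.not_adj_head₁ (p := r) (by simp)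
  have h2 := h.not_adj_last₂ (p := r) (by simp)
  have := hC u a a' r h.link₁.1 (link_concat.1 h.link₂).2.symm h.linkP.1
    (by rintro rfl; simp [List.nodup_append] at hn)
    (by rintro rfl; simp [List.nodup_append] at hn)
    (by rintro rfl; simp [List.nodup_append] at hn)
  rcases this with h3 | h3 | h3
  · exact h3
  · exact absurd h3.symm h1
  · exact absurd h3.symm h2

theorem Conf.adj_ends' (hC : ClawFree H) (h : Conf H u v (A ++ [b]) (b' :: B) P) : H.Adj b b' := by
  have h1 := h.swap
  rw [List.reverse_append, List.reverse_cons (a := b')] at h1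
  exact Conf.adj_ends hC (A := A.reverse) h1

omit [DecidableEq V] in
theorem concat_decomp (a : V) (A : List V) : ∃ Z b, a :: A = Z ++ [b] := by
  rcases List.eq_nil_or_concat (a :: A) with h | ⟨Z, b, h⟩
  · simp at h
  · exact ⟨Z, b, by simpa using h⟩

/-- The vertex `v` of the cycle can be moved along its neighbours on `Q₂`. -/
theorem Conf.link_run (hC : ClawFree H) (h : Conf H u v (a :: A) (F₁ ++ F₂) P)
    (hF : ∀ x ∈ F₁, H.Adj x v) : Link H a (A ++ F₁) v := by
  cases F₁ with
  | nil => simpa using h.link₁.2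
  | cons b' F =>
    obtain ⟨Z, b, hZ⟩ := concat_decomp a A
    rw [hZ] at h
    have hbb' := h.adj_ends' hC (B := F ++ F₂)
    rw [link_append]
    refine ⟨?_, ?_⟩
    · rw [← hZ] at h
      exact h.link₁.2.change_end hZ hbb'
    · have h2 : Link H b' (F ++ F₂) u := h.link₂.2
      rcases List.eq_nil_or_concat F with rfl | ⟨F', c, rfl⟩
      · exact hF _ (by simp)
      · rw [List.concat_eq_append, List.append_assoc, List.singleton_append, link_append] at h2
        rw [List.concat_eq_append, link_concat]
        exact ⟨h2.1, hF _ (by simp)⟩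

/-- Moving `v` behind the run `F₁` makes it possible to go from `v` back along `P` to `p` and on to
`f`, a longer cycle. -/
theorem Conf.not_adj_run_P (hC : ClawFree H) (h : Conf H u v (a :: A) (F₁ ++ f :: F₂) P)
    (hF : ∀ x ∈ F₁, H.Adj x v) (hp : p ∈ P) : ¬ H.Adj p f := by
  intro hpf
  have hr := h.link_run hC hF
  obtain ⟨P₁, P₂, rfl⟩ := List.append_of_mem hp
  have := h.length_le (x := u) (Q := a :: ((A ++ F₁) ++ v :: (P₂.reverse ++ p :: f :: F₂)))
    ⟨h.link₁.1, link_append.2 ⟨hr, link_append.2 ⟨(link_append.1 h.linkP).2.reverse, hpf,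
      (link_append.1 h.link₂).2⟩⟩⟩
    (by intro a; simp [List.count_append, List.count_cons]; omega)
  simp at this
  omega

/-- After moving `v` behind the run, the cycle can traverse `P`, return from `v` to `a`, jump to
`a'` and come back along `Q₂` to `f` and `u`. -/
theorem Conf.not_adj_run_u (hC : ClawFree H) (h : Conf H u v (a :: A) (F₁ ++ f :: F₂) P)
    (hF : ∀ x ∈ F₁, H.Adj x v) : ¬ H.Adj f u := by
  intro hfu
  have hr := h.link_run hC hF
  obtain ⟨Z, a', hZ⟩ := concat_decomp f F₂
  have haa' : H.Adj a a' := by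
    rw [hZ, ← List.append_assoc] at h
    exact h.adj_ends hC
  have := h.length_le (x := u) (Q := P ++ v :: ((A ++ F₁).reverse ++ a :: (f :: F₂).reverse))
    (link_append.2 ⟨h.linkP, link_append.2 ⟨hr.reverse,
      (link_append.1 h.link₂).2.reverse_between hZ haa' hfu⟩⟩)
    (by intro a; simp [List.count_append, List.count_cons]; omega)
  have h0 := h.length_pos
  simp only [List.length_append, List.length_cons, List.length_reverse] at this
  omega

theorem Conf.not_adj_run_head (hC : ClawFree H) (h : Conf H u v (a :: A) (F₁ ++ f :: F₂) P)
    (hF : ∀ x ∈ F₁, H.Adj x v) : ¬ H.Adj a f := by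
  intro haf
  have hr := h.link_run hC hF
  have := h.length_le (x := u) (Q := P ++ v :: ((A ++ F₁).reverse ++ a :: f :: F₂))
    (link_append.2 ⟨h.linkP, link_append.2 ⟨hr.reverse, haf, (link_append.1 h.link₂).2⟩⟩)
    (by intro a; simp [List.count_append, List.count_cons]; omega)
  have h0 := h.length_pos
  simp only [List.length_append, List.length_cons, List.length_reverse] at this
  omega

theorem Conf.not_adj_run_second (hC : ClawFree H) (h : Conf H u v (a :: c :: A) (F₁ ++ f :: F₂) P)
    (hF : ∀ x ∈ F₁, H.Adj x v) : ¬ H.Adj c f := by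
  intro hcf
  have hr := h.link_run hC hF
  obtain ⟨Z, a', hZ⟩ := concat_decomp f F₂
  have haa' : H.Adj a a' := by
    rw [hZ, ← List.append_assoc] at h
    exact h.adj_ends hC
  have := h.length_le (x := a) (Q := u :: (P ++ v :: ((A ++ F₁).reverse ++ c :: f :: F₂)))
    ⟨h.link₁.1.symm, link_append.2 ⟨h.linkP, link_append.2 ⟨Link.reverse hr.2, hcf,
      (link_append.1 h.link₂).2.change_end hZ haa'.symm⟩⟩⟩
    (by intro a; simp [List.count_append, List.count_cons]; omega)
  have h0 := h.length_pos
  simp only [List.length_append, List.length_cons, List.length_reverse] at this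
  omega

theorem Conf.not_adj_v_head (hC : ClawFree H) (h : Conf H u v (a :: A) Q₂ P) : ¬ H.Adj v a := by
  have h1 := h.swap.flip
  rw [List.reverse_reverse, List.reverse_reverse] at h1
  obtain ⟨b', B, rfl⟩ : ∃ b' B, Q₂ = b' :: B := by
    cases Q₂ with
    | nil => exact h.flip.not_adj.elim
    | cons b' B => exact ⟨b', B, rfl⟩
  exact fun hh => h1.not_adj_run_u hC (F₁ := []) (by simp) hh.symm

theorem Conf.not_adj_u_last (hC : ClawFree H) (h : Conf H u v (A ++ [b]) Q₂ P) :
    ¬ H.Adj u b := by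
  have h1 := h.swap
  rw [List.reverse_append] at h1
  exact h1.not_adj_v_head hC (A := A.reverse)

theorem Conf.not_adj_v_last₂ (hC : ClawFree H) (h : Conf H u v Q₁ (A ++ [a']) P) :
    ¬ H.Adj v a' := by
  have h1 := h.flip
  rw [List.reverse_append] at h1
  exact h1.not_adj_v_head hC (A := A.reverse)

/-- A configuration with `Q₁` as short as possible. -/
def MinConf (H : SimpleGraph V) (u v : V) (Q₁ Q₂ P : List V) : Prop :=
  Conf H u v Q₁ Q₂ P ∧ ∀ u' v' Q₁' Q₂' P', Conf H u' v' Q₁' Q₂' P' → Q₁.length ≤ Q₁'.length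

theorem MinConf.swap (h : MinConf H u v Q₁ Q₂ P) :
    MinConf H v u Q₁.reverse Q₂.reverse P.reverse :=
  ⟨h.1.swap, by simpa using h.2⟩

/-- A neighbour `q` of `P` on `Q₁` could replace `v` as attachment vertex and would shorten the arc.
-/
theorem MinConf.not_adj_P (h : MinConf H u v Q₁ Q₂ P) (hq : q ∈ Q₁) (hp : p ∈ P) :
    ¬ H.Adj p q := by
  intro hpq
  obtain ⟨A, B, rfl⟩ := List.append_of_mem hq
  obtain ⟨P₁, P₂, rfl⟩ := List.append_of_mem hp
  have h1 := link_append.1 h.1.link₁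
  have hc : Conf H u q A (B ++ v :: Q₂) (P₁ ++ [p]) :=
    { nodup := nodup_of_count h.1.nodup
        (by intro a; simp [List.count_append, List.count_cons])
      link₁ := h1.1
      link₂ := link_append.2 ⟨h1.2, h.1.link₂⟩
      linkP := link_concat.2 ⟨(link_append.1 h.1.linkP).1, hpq⟩
      ne := by simp
      longest := by
        intro x l hl hl2
        have := h.1.longest x l hl hl2
        simp at this ⊢
        omega }
  have := h.2 _ _ _ _ _ hc
  simp at this

theorem MinConf.eq_head_of_adj (hC : ClawFree H) (h : MinConf H u v (a :: A) Q₂ P)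
    (hq : q ∈ a :: A) (hqu : H.Adj q u) : q = a := by
  by_contra hqa
  obtain ⟨A, B, hAB⟩ := List.append_of_mem hq
  obtain ⟨A, rfl⟩ : ∃ t, A = a :: t := by
    cases A with
    | nil => simp at hAB; exact absurd hAB.1.symm hqa
    | cons c t => simp at hAB; exact ⟨t, by rw [hAB.1]⟩
  rw [hAB] at h
  have h' : MinConf H u v (a :: (A ++ q :: B)) Q₂ P := h
  obtain ⟨Z, a', rfl⟩ : ∃ Z a', Q₂ = Z ++ [a'] := by
    rcases List.eq_nil_or_concat Q₂ with rfl | ⟨Z, a', rfl⟩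
    · exact h.1.flip.not_adj.elim
    · exact ⟨Z, a', by simp⟩
  have hn := h.1.nodup
  have haa' := h'.1.adj_ends hC
  obtain ⟨r, P', hP⟩ := List.exists_cons_of_ne_nil h.1.ne
  -- The claw at `u` with leaves `q`, `a'` and a vertex of `P` forces this edge.
  have hqa' : H.Adj q a' := by
    have hr : r ∈ P := by simp [hP]
    have h1 : H.Adj u r := by
      have := h.1.linkP
      rw [hP] at this
      exact this.1
    have := hC u q a' r hqu.symm (link_concat.1 h.1.link₂).2.symm h1
      (by rintro rfl; simp [List.nodup_append] at hn)
      (by rintro rfl; simp [List.nodup_append, hP] at hn)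
      (by rintro rfl; simp [List.nodup_append, hP] at hn)
    rcases this with h3 | h3 | h3
    · exact h3
    · exact absurd h3.symm (h.not_adj_P (by simp) hr)
    · exact absurd h3.symm (h.1.not_adj_last₂ hr)
  obtain ⟨l1, l2⟩ := link_append.1 h.1.link₁
  obtain ⟨Y, qm, hY⟩ := concat_decomp a A
  obtain ⟨qp, X, hX⟩ : ∃ qp X, B ++ [v] = qp :: X := by
    cases B with
    | nil => exact ⟨v, [], rfl⟩
    | cons c B => exact ⟨c, B ++ [v], rfl⟩
  have hqm : H.Adj qm q := by
    rw [hY] at l1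
    exact (link_concat.1 l1).2
  have hqp : H.Adj q qp ∧ ∀ w, H.Adj w qp → Link H w B v := by
    cases B with
    | nil => simp at hX; obtain ⟨rfl, rfl⟩ := hX; exact ⟨l2, fun w hw => hw⟩
    | cons c B => simp at hX; obtain ⟨rfl, rfl⟩ := hX; exact ⟨l2.1, fun w hw => ⟨hw, l2.2⟩⟩
  have hqm_mem : qm ∈ a :: A := by rw [hY]; simp
  have hqp_mem : qp ∈ B ++ [v] := by rw [hX]; simp
  have hlong : ∀ {m : ℕ}, m = (a :: A ++ q :: B).length + (Z ++ [a']).length + 1 →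
      ∀ x l, (x :: l).Nodup → Link H x l x → l.length ≤ m := by
    rintro m rfl
    exact h.1.longest
  have hdisj : (a :: A).Disjoint (B ++ [v]) ∧ u ∉ a :: A ∧ u ∉ B ++ [v] := by
    simp only [List.nodup_append, List.nodup_cons, List.cons_append, List.mem_append,
      List.mem_cons] at hn
    refine ⟨fun x hx hx' => ?_, ?_, ?_⟩
    · simp only [List.mem_append, List.mem_cons, List.not_mem_nil, or_false] at hx hx'
      grind
    · simp only [List.mem_cons]; grind
    · simp only [List.mem_append, List.mem_cons, List.not_mem_nil, or_false]; grind
  have hcl := hC q qm qp u hqm.symm hqp.1 hqu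
    (by rintro rfl; exact hdisj.1 hqm_mem hqp_mem)
    (by rintro rfl; exact hdisj.2.1 hqm_mem)
    (by rintro rfl; exact hdisj.2.2 hqp_mem)
  -- Each outcome of the claw at `q` rearranges the same longest cycle with a shorter first arc: `q`
  -- moves between `a'` and `u`, or the piece before `q` moves to the second arc, or that piece
  -- moves together with `q`.
  rcases hcl with h1 | h1 | h1
  · have hc : Conf H u v (a :: A ++ B) ((Z ++ [a']) ++ [q]) P :=
      { nodup := nodup_of_count h.1.nodup
          (by intro a; simp [List.count_append, List.count_cons]; omega)
        link₁ := by
          rw [hY, List.append_assoc, List.singleton_append, link_append]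
          rw [hY] at l1
          exact ⟨(link_concat.1 l1).1, hqp.2 _ h1⟩
        link₂ := link_concat.2
          ⟨link_concat.2 ⟨(link_concat.1 h.1.link₂).1, hqa'.symm⟩, hqu⟩
        linkP := h.1.linkP
        ne := h.1.ne
        longest := hlong (by simp; omega) }
    have := h.2 _ _ _ _ _ hc
    simp at this
  · have hc : Conf H u v (q :: B) ((Z ++ [a']) ++ (a :: A)) P :=
      { nodup := nodup_of_count h.1.nodup
          (by intro a; simp [List.count_append, List.count_cons]; omega)
        link₁ := ⟨hqu.symm, l2⟩
        link₂ := link_append.2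
          ⟨link_concat.2 ⟨(link_concat.1 h.1.link₂).1, haa'.symm⟩, l1.2.change_end hY h1⟩
        linkP := h.1.linkP
        ne := h.1.ne
        longest := hlong (by simp; omega) }
    have := h.2 _ _ _ _ _ hc
    simp at this
    omega
  · have hc : Conf H u v B ((Z ++ [a']) ++ a :: (A ++ [q])) P :=
      { nodup := nodup_of_count h.1.nodup
          (by intro a; simp [List.count_append, List.count_cons]; omega)
        link₁ := hqp.2 _ h1.symm
        link₂ := link_append.2
          ⟨link_concat.2 ⟨(link_concat.1 h.1.link₂).1, haa'.symm⟩, link_concat.2 ⟨l1.2, hqu⟩⟩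
        linkP := h.1.linkP
        ne := h.1.ne
        longest := hlong (by simp; omega) }
    have := h.2 _ _ _ _ _ hc
    simp at this
    omega

theorem MinConf.eq_last_of_adj (hC : ClawFree H) (h : MinConf H u v (A ++ [b]) Q₂ P)
    (hq : q ∈ A ++ [b]) (hqv : H.Adj q v) : q = b := by
  have h1 := h.swap
  rw [List.reverse_append] at h1
  exact h1.eq_head_of_adj hC (A := A.reverse) (by simpa [or_comm] using hq) hqv

end Configurations

/-! ### Existence of a configuration -/

section Existence

variable {V : Type*} {H : SimpleGraph V}

theorem Pth.trans {l₁ l₂ : List V} {x y z : V} (h₁ : Pth H l₁ x y) (h₂ : Pth H l₂ y z) :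
    ∃ l, Pth H l x z ∧ ∀ w ∈ l, w ∈ l₁ ∨ w ∈ l₂ := by
  cases l₂ with
  | nil => exact absurd rfl h₂.ne_nil
  | cons c t =>
    rcases eq_or_ne t [] with rfl | ht
    · have e1 := h₂.head_eq
      have e2 := (show Pth H ([] ++ [c]) y z from h₂).last_eq
      subst e1 e2
      exact ⟨l₁, h₁, fun w hw => Or.inl hw⟩
    · obtain ⟨e, d, hd, h3⟩ := h₂.tail_of_cons ht
      subst e
      refine ⟨l₁ ++ t, h₁.append hd h3, fun w hw => ?_⟩
      rw [List.mem_append] at hw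
      exact hw.imp_right fun h => List.mem_cons_of_mem _ h

/-- Across any cut there is an edge. -/
def CutConnected (H : SimpleGraph V) : Prop :=
  ∀ A : Set V, (∃ x, x ∈ A) → (∃ y, y ∉ A) → ∃ x y, x ∈ A ∧ y ∉ A ∧ H.Adj x y

/-- Across any cut there is an edge avoiding a given vertex. -/
def CutTwoConnected (H : SimpleGraph V) : Prop :=
  ∀ (u : V) (A : Set V), u ∉ A → (∃ x, x ∈ A) → (∃ y, y ∉ A ∧ y ≠ u) →
    ∃ x y, x ∈ A ∧ y ∉ A ∧ y ≠ u ∧ H.Adj x y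

/-- A component `D` of the complement of a longest cycle attaches to the cycle at some `u`, and at a
second vertex because edges leave `D` even when `u` is avoided. -/
theorem exists_conf [Fintype V] [DecidableEq V] (h1 : CutConnected H) (h2 : CutTwoConnected H)
    (h3 : 2 ≤ Fintype.card V) (hno : ¬ HamL H) : ∃ u v Q₁ Q₂ P, Conf H u v Q₁ Q₂ P := by
  obtain ⟨x₀, y₀, hxy₀⟩ := Fintype.one_lt_card_iff.1 h3
  obtain ⟨p, q, -, -, hpq⟩ := h1 {x₀} ⟨x₀, rfl⟩ ⟨y₀, fun h => hxy₀ h.symm⟩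
  obtain ⟨L, ⟨hLn, hLc⟩, hmax⟩ := WellFounded.has_min
    (measure (fun l : List V => Fintype.card V - l.length)).wf
    -- A single edge counts as a closed list with two vertices, so the family is nonempty without
    -- first finding a genuine cycle.
    {l | l.Nodup ∧ Cyc H l} ⟨[p, q], by simp [hpq.ne], p, q, Pth.cons hpq (Pth.singleton _ _),
      hpq.symm⟩
  have hlong : ∀ l : List V, l.Nodup → Cyc H l → l.length ≤ L.length := by
    intro l hl hc
    by_contra! hlt
    refine hmax l ⟨hl, hc⟩ ?_
    have := hl.length_le_card
    change Fintype.card V - l.length < Fintype.card V - L.length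
    omega
  obtain ⟨s, hs⟩ : ∃ s, s ∉ L := by
    by_contra! hall
    exact hno ⟨L, hLn, hall, hLc⟩
  obtain ⟨e, e', hLp, hee'⟩ := hLc
  let D : Set V := {x | ∃ l, Pth H l s x ∧ ∀ w ∈ l, w ∉ L}
  have hsD : s ∈ D := ⟨[s], Pth.singleton _ _, by simpa using hs⟩
  have hDL : ∀ x ∈ D, x ∉ L := fun x ⟨l, hl, hl2⟩ => hl2 x hl.last_mem
  have hext : ∀ x y, x ∈ D → y ∉ D → H.Adj x y → y ∈ L := by
    rintro x y ⟨l, hl, hl2⟩ hy hxy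
    by_contra hyL
    refine hy ⟨l ++ [y], hl.concat hxy, ?_⟩
    intro w hw
    rw [List.mem_append, List.mem_singleton] at hw
    rcases hw with hw | rfl
    · exact hl2 w hw
    · exact hyL
  obtain ⟨d, u, hd, hu, hdu⟩ := h1 D ⟨s, hsD⟩ ⟨e, fun h => hDL e h hLp.head_mem⟩
  have huL := hext d u hd hu hdu
  obtain ⟨d', v, hd', hv, hvu, hdv⟩ := h2 u D hu ⟨s, hsD⟩ (by
    by_cases h : e = u
    · exact ⟨e', fun h => hDL _ h hLp.last_mem, fun h' => hee'.ne (h'.trans h.symm)⟩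
    · exact ⟨e, fun h => hDL _ h hLp.head_mem, h⟩)
  have hvL := hext d' v hd' hv hdv
  obtain ⟨l, hl, hl2⟩ := hd
  obtain ⟨l', hl', hl2'⟩ := hd'
  obtain ⟨l₀, hl₀, hl₀2⟩ := hl.reverse.trans hl'
  obtain ⟨P, hPs, hP, hPi⟩ := hl₀.exists_indPath
  have hPL : ∀ w ∈ P, w ∉ L := by
    intro w hw
    rcases hl₀2 w (hPs.subset hw) with h | h
    · exact hl2 w (by simpa using h)
    · exact hl2' w h
  obtain ⟨A, B, rfl⟩ := List.append_of_mem huL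
  have hcyc : Cyc H (u :: (B ++ A)) := Cyc.rotate ⟨e, e', hLp, hee'⟩
  have hvBA : v ∈ B ++ A := by
    have : v ∈ A ∨ v = u ∨ v ∈ B := by simpa using hvL
    rw [List.mem_append]
    tauto
  have hlk := hcyc.link (List.ne_nil_of_mem hvBA)
  have hn : (u :: (B ++ A)).Nodup := (List.nodup_append_comm (l₁ := A)).1 hLn
  have hP' : ∀ w ∈ P, w ∉ u :: (B ++ A) := by
    intro w hw h
    exact hPL w hw (by simp at h ⊢; tauto)
  have hlen : (A ++ u :: B).length = (B ++ A).length + 1 := by simp; omega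
  rw [hlen] at hlong
  obtain ⟨Q₁, Q₂, hQ⟩ := List.append_of_mem hvBA
  rw [hQ] at hlk hn hP' hlong
  obtain ⟨k1, k2⟩ := link_append.1 hlk
  refine ⟨u, v, Q₁, Q₂, P, ?_, k1, k2, ((hP.concat hdv).cons hdu.symm).link, hP.ne_nil, ?_⟩
  · rw [show u :: (Q₁ ++ v :: (Q₂ ++ P)) = (u :: (Q₁ ++ v :: Q₂)) ++ P by simp, List.nodup_append]
    refine ⟨hn, hPi.nodup, ?_⟩
    rintro x hx w hw rfl
    exact hP' x hw hx
  · intro x l hxl hlk'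
    have := hlong (x :: l) hxl hlk'.cyc
    simp at this
    omega

theorem exists_minConf [DecidableEq V] {u v : V} {Q₁ Q₂ P : List V} (h : Conf H u v Q₁ Q₂ P) :
    ∃ u v Q₁ Q₂ P, MinConf H u v Q₁ Q₂ P := by
  obtain ⟨⟨u, v, Q₁, Q₂, P⟩, hc, hmin⟩ := WellFounded.has_min
    (measure (fun t : V × V × List V × List V × List V => t.2.2.1.length)).wf
    {t | Conf H t.1 t.2.1 t.2.2.1 t.2.2.2.1 t.2.2.2.2} ⟨(u, v, Q₁, Q₂, P), h⟩
  exact ⟨u, v, Q₁, Q₂, P, hc, fun u' v' Q₁' Q₂' P' hc' =>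
    not_lt.1 (hmin (u', v', Q₁', Q₂', P') hc')⟩

end Existence

/-! ### The forced local structure around the longest cycle -/

section Endgame

variable {V : Type*} {H : SimpleGraph V}

/-- Common neighbours of adjacent vertices are adjacent. -/
def DiamondFree (H : SimpleGraph V) : Prop :=
  ∀ ⦃x w y z⦄, H.Adj x w → H.Adj x y → H.Adj x z → H.Adj w y → H.Adj w z → y ≠ z → H.Adj y z

/-- The local structure around a longest cycle of a nonhamiltonian graph without long induced
paths. -/
structure EndConf (H : SimpleGraph V) (u v a b a' b' c r β y : V) : Prop where
  ind₁ : IndPath H [c, a, u, v, β, y]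
  ind₂ : IndPath H [y, β, b, a, u, r]
  ur : H.Adj u r
  vr : H.Adj v r
  rc : ¬ H.Adj r c
  ry : ¬ H.Adj r y
  bc : H.Adj b c
  ac : H.Adj a c
  cy : ¬ H.Adj c y
  aa' : H.Adj a a'
  ua' : H.Adj u a'
  vb : H.Adj v b
  vb' : H.Adj v b'
  bb' : H.Adj b b'

/-- If `a` and `b` were nonadjacent, an induced path through the arc, extended by `r, u` before `a`
and by `β, y` after `b`, would be too long, unless chords to `β` or `y` intervene; rerouting at the
first chord still yields seven vertices or contradicts the diamond rule. -/
theorem no_indPath_through_cycle (hD : DiamondFree H) (hC : ClawFree H)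
    (hT : ∀ P, IndPath H P → P.length < 7) {u v a b β y r : V} {Q : List V}
    (hW : Pth H Q a b) (hQu : ∀ q ∈ Q, H.Adj u q → q = a) (hQv : ∀ q ∈ Q, H.Adj v q → q = b)
    (hQr : ∀ q ∈ Q, ¬ H.Adj r q ∧ r ≠ q) (huQ : u ∉ Q) (hvQ : v ∉ Q) (hβQ : β ∉ Q) (hyQ : y ∉ Q)
    (hua : H.Adj u a) (hru : H.Adj r u) (hvβ : H.Adj v β)
    (hvy : ¬ H.Adj v y) (hvy' : v ≠ y)
    (hβy : H.Adj β y) (hbβ : H.Adj b β) (hby : ¬ H.Adj b y) (hrβ : ¬ H.Adj r β ∧ r ≠ β)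
    (hry : ¬ H.Adj r y ∧ r ≠ y) (huβ : ¬ H.Adj u β ∧ u ≠ β) (huy : ¬ H.Adj u y ∧ u ≠ y)
    (haβ : ¬ H.Adj a β) (hay : ¬ H.Adj a y) (hab : ¬ H.Adj a b) (hab' : a ≠ b) : False := by
  obtain ⟨W, hWs, hWp, hWi⟩ := hW.exists_indPath
  have hWQ : ∀ q ∈ W, q ∈ Q := fun q hq => hWs.subset hq
  obtain ⟨W₀, rfl⟩ : ∃ W₀, W = W₀ ++ [b] := by
    rcases List.eq_nil_or_concat W with rfl | ⟨W₀, c, rfl⟩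
    · exact absurd rfl hWp.ne_nil
    · rw [List.concat_eq_append] at hWp ⊢
      exact ⟨W₀, by rw [hWp.last_eq]⟩
  obtain ⟨W₁, rfl⟩ : ∃ W₁, W₀ = a :: W₁ := by
    cases W₀ with
    | nil => exact absurd hWp.head_eq.symm hab'
    | cons c t => exact ⟨t, by rw [(show Pth H (c :: (t ++ [b])) a b from hWp).head_eq]⟩
  have hW₁ : W₁ ≠ [] := by
    rintro rfl
    exact hab (List.isChain_cons_cons.1 hWp.1).1
  have hWn := hWi.nodup
  have hur : ∀ q ∈ W₁ ++ [b], ¬ H.Adj u q ∧ u ≠ q := by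
    intro q hq
    have hqQ := hWQ q (List.mem_cons_of_mem _ hq)
    refine ⟨fun h => ?_, fun h => huQ (h ▸ hqQ)⟩
    obtain rfl := hQu q hqQ h
    exact (List.nodup_cons.1 hWn).1 hq
  have hne : ∀ q ∈ (a :: W₁) ++ [b], q ≠ β ∧ q ≠ y ∧ q ≠ v := by
    intro q hq
    have hqQ := hWQ q hq
    exact ⟨fun h => hβQ (h ▸ hqQ), fun h => hyQ (h ▸ hqQ), fun h => hvQ (h ▸ hqQ)⟩
  have hbQ := hWQ b (by simp)
  have hyb : y ≠ b := ((hne b (by simp)).2.1).symm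
  have hbW : b ∉ a :: W₁ := by
    intro h
    rw [List.nodup_append] at hWn
    exact hWn.2.2 b h b (by simp) rfl
  have start : ∀ T : List V, IndPath H (a :: T) → (∀ q ∈ T, ¬ H.Adj u q ∧ u ≠ q) →
      (∀ q ∈ a :: T, ¬ H.Adj r q ∧ r ≠ q) → T.length < 4 := by
    intro T h1 h2 h3
    have := hT (r :: u :: a :: T) ⟨hru, h3, hua, h2, h1⟩
    simp at this
    omega
  by_cases hex : ∃ q ∈ a :: W₁, H.Adj q β ∨ H.Adj q y
  swap
  · push Not at hex
    have hi : IndPath H ((a :: W₁) ++ b :: [β, y]) := by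
      refine indPath_append.2 ⟨hWi, ⟨hbβ, by simp [hby, hyb.symm], hβy, by simp, trivial⟩, ?_⟩
      intro q hq z hz
      have h1 := hne q (List.mem_append_left _ hq)
      have h2 := hex q hq
      simp at hz
      rcases hz with rfl | rfl
      · exact ⟨h2.1, h1.1⟩
      · exact ⟨h2.2, h1.2.1⟩
    have h0 := start (W₁ ++ b :: [β, y]) hi (by
      intro q hq
      rw [show W₁ ++ b :: [β, y] = (W₁ ++ [b]) ++ [β, y] by simp, List.mem_append] at hq
      rcases hq with hq | hq
      · exact hur q hq
      · simp at hq; rcases hq with rfl | rfl <;> assumption) (by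
      intro q hq
      rw [show a :: (W₁ ++ b :: [β, y]) = ((a :: W₁) ++ [b]) ++ [β, y] by simp,
        List.mem_append] at hq
      rcases hq with hq | hq
      · exact hQr q (hWQ q hq)
      · simp at hq; rcases hq with rfl | rfl <;> assumption)
    have := List.length_pos_of_ne_nil hW₁
    simp at h0
    omega
  obtain ⟨X, q, Y, hXY, hq, hX⟩ := exists_split_first _ _ hex
  push Not at hX
  obtain ⟨X, rfl⟩ : ∃ X', X = a :: X' := by
    cases X with
    | nil =>
      simp at hXY
      obtain ⟨rfl, -⟩ := hXY
      exact (hq.elim haβ hay).elim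
    | cons c t => simp at hXY; exact ⟨t, by rw [hXY.1]⟩
  obtain rfl : W₁ = X ++ q :: Y := by simpa using hXY
  -- Claw at `β` with leaves `v, p, y`: the only neighbour of `v` on the arc is `b`, so a vertex
  -- before it that sees `β` also sees `y`.
  have hβy_of : ∀ p ∈ a :: (X ++ q :: Y), H.Adj p β → H.Adj p y := by
    intro p hp hpβ
    have hpm : p ∈ (a :: (X ++ q :: Y)) ++ [b] := List.mem_append_left _ hp
    have hpv : ¬ H.Adj v p := by
      intro h
      have := hQv p (hWQ p hpm) h
      exact hbW (this ▸ hp)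
    rcases hC β v p y hvβ.symm hpβ.symm hβy (hne p hpm).2.2.symm hvy' (hne p hpm).2.1
      with h | h | h
    · exact absurd h hpv
    · exact absurd h hvy
    · exact h
  have hqy : H.Adj q y := hq.elim (hβy_of q (by simp)) id
  have hqne := hne q (by simp)
  rw [show (a :: (X ++ q :: Y)) ++ [b] = (a :: X) ++ q :: (Y ++ [b]) by simp] at hWi hWp
  obtain ⟨j1, j2, j3⟩ := indPath_append.1 hWi
  obtain ⟨x, q', hx1, hxq, hx2⟩ := hWp.of_append (by simp) (by simp)
  obtain rfl := hx2.head_eq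
  have hxX := hx1.last_mem
  have hY : Y ≠ [] := by
    rintro rfl
    have hqb : H.Adj q b := j2.1
    have h1 := j3 x hxX b (by simp)
    have h2 := hne x (List.mem_append_left [b]
      (show x ∈ (a :: X) ++ [q] from List.mem_append_left _ hxX))
    rcases hC q x b y hxq.symm hqb hqy h1.2 h2.2.1 hyb.symm with h | h | h
    · exact h1.1 h
    · exact (hX x hxX).2 h
    · exact hby h
  obtain ⟨w, Y, rfl⟩ := List.exists_cons_of_ne_nil hY
  have hqb : ¬ H.Adj q b ∧ q ≠ b := j2.2.1 b (by simp)
  have hXf : ∀ x ∈ a :: X, (¬ H.Adj x β ∧ x ≠ β) ∧ (¬ H.Adj x y ∧ x ≠ y) ∧ ¬ H.Adj x b ∧ x ≠ b := by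
    intro x hx
    have h2 := hne x (List.mem_append_left [b]
      (show x ∈ (a :: X) ++ q :: (w :: Y) from List.mem_append_left _ hx))
    exact ⟨⟨(hX x hx).1, h2.1⟩, ⟨(hX x hx).2, h2.2.1⟩, j3 x hx b (by simp)⟩
  have hub := hur b (by simp)
  have hrb := hQr b hbQ
  have hXu : ∀ x ∈ X ++ [q], ¬ H.Adj u x ∧ u ≠ x := by
    intro x hx
    refine hur x ?_
    rw [show (X ++ q :: w :: Y) ++ [b] = (X ++ [q]) ++ (w :: Y ++ [b]) by simp]
    exact List.mem_append_left _ hx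
  have hXr : ∀ x ∈ (a :: X) ++ [q], ¬ H.Adj r x ∧ r ≠ x := by
    intro x hx
    refine hQr x (hWQ x ?_)
    rw [show (a :: (X ++ q :: w :: Y)) ++ [b] = ((a :: X) ++ [q]) ++ (w :: Y ++ [b]) by simp]
    exact List.mem_append_left _ hx
  by_cases hqβ : H.Adj q β
  swap
  · have hi : IndPath H ((a :: X) ++ q :: [y, β, b]) := by
      refine indPath_append.2 ⟨j1, ⟨hqy, ?_, hβy.symm, ?_, hbβ.symm, by simp, trivial⟩, ?_⟩
      · simp only [List.mem_cons, List.not_mem_nil, or_false, forall_eq_or_imp, forall_eq]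
        exact ⟨⟨hqβ, hqne.1⟩, hqb⟩
      · simp only [List.mem_singleton, forall_eq]
        exact ⟨fun h => hby h.symm, hyb⟩
      · intro x hx z hz
        obtain ⟨g1, g2, g3⟩ := hXf x hx
        simp only [List.mem_cons, List.not_mem_nil, or_false] at hz
        rcases hz with rfl | rfl | rfl
        exacts [g2, g1, g3]
    have h0 := start (X ++ q :: [y, β, b]) hi (by
      intro z hz
      rw [show X ++ q :: [y, β, b] = (X ++ [q]) ++ [y, β, b] by simp, List.mem_append] at hz
      rcases hz with hz | hz
      · exact hXu z hz
      · simp at hz; rcases hz with rfl | rfl | rfl <;> assumption) (by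
      intro z hz
      rw [show a :: (X ++ q :: [y, β, b]) = ((a :: X) ++ [q]) ++ [y, β, b] by simp,
        List.mem_append] at hz
      rcases hz with hz | hz
      · exact hXr z hz
      · simp at hz; rcases hz with rfl | rfl | rfl <;> assumption)
    simp at h0
  have hi : IndPath H ((a :: X) ++ q :: [β, b]) := by
    refine indPath_append.2 ⟨j1, ⟨hqβ, by simp [hqb], hbβ.symm, by simp, trivial⟩, ?_⟩
    intro x hx z hz
    obtain ⟨g1, g2, g3⟩ := hXf x hx
    simp only [List.mem_cons, List.not_mem_nil, or_false] at hz
    rcases hz with rfl | rfl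
    exacts [g1, g3]
  have h0 := start (X ++ q :: [β, b]) hi (by
    intro z hz
    rw [show X ++ q :: [β, b] = (X ++ [q]) ++ [β, b] by simp, List.mem_append] at hz
    rcases hz with hz | hz
    · exact hXu z hz
    · simp at hz; rcases hz with rfl | rfl <;> assumption) (by
    intro z hz
    rw [show a :: (X ++ q :: [β, b]) = ((a :: X) ++ [q]) ++ [β, b] by simp,
      List.mem_append] at hz
    rcases hz with hz | hz
    · exact hXr z hz
    · simp at hz; rcases hz with rfl | rfl <;> assumption)
  -- The induced path `r, u, a, X, q, β, b` has room for no vertex in `X`.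
  obtain rfl : X = [] := by
    cases X with
    | nil => rfl
    | cons _ _ => simp at h0; omega
  have hqw : H.Adj q w := j2.1
  have hwne := hne w (by simp)
  have haw := j3 a (by simp) w (by simp)
  have haq : H.Adj a q := j1.1
  have hwy : H.Adj w y := by
    rcases hC q a w y haq.symm hqw hqy haw.2 ((hXf a (by simp)).2.1.2) hwne.2.1 with h | h | h
    · exact absurd h haw.1
    · exact absurd h hay
    · exact h
  have hwβ : H.Adj w β := hD hqy hqw hqβ hwy.symm hβy.symm hwne.1
  rcases List.eq_nil_or_concat Y with rfl | ⟨Y', z, rfl⟩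
  · have hwb : H.Adj w b := j2.2.2.1
    exact hby (hD hwβ hwb hwy hbβ.symm hβy hyb.symm)
  · have j4 : IndPath H ((q :: w :: Y') ++ z :: [b]) := by simpa using j2
    obtain ⟨-, ⟨hzb, -, -⟩, j5⟩ := indPath_append.1 j4
    have hqz : ¬ H.Adj q z ∧ q ≠ z := j2.2.1 z (by simp)
    have haz := j3 a (by simp) z (by simp)
    have hzne := hne z (by simp)
    have hzβ : ¬ H.Adj z β := by
      intro h
      have hzy := hβy_of z (by simp) h
      exact hby (hD h hzb hzy hbβ.symm hβy hyb.symm)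
    have hab2 := (hXf a (by simp))
    -- With `z` the vertex before `b` on the induced arc, `r, u, a, q, β, b, z` is an induced path
    -- on seven vertices.
    have h0 := start [q, β, b, z] (by
      simp only [IndPath, List.mem_cons, List.not_mem_nil, or_false, forall_eq_or_imp, forall_eq,
        and_true, IsEmpty.forall_iff, implies_true]
      exact ⟨haq, ⟨hab2.1, hab2.2.2, haz⟩, hqβ, ⟨hqb, hqz⟩, hbβ.symm,
        ⟨fun h => hzβ h.symm, hzne.1.symm⟩, hzb.symm⟩) (by
      simp only [List.mem_cons, List.not_mem_nil, or_false, forall_eq_or_imp, forall_eq]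
      exact ⟨hur q (by simp), huβ, hub, hur z (by simp)⟩) (by
      simp only [List.mem_cons, List.not_mem_nil, or_false, forall_eq_or_imp, forall_eq]
      exact ⟨hXr a (by simp), hXr q (by simp), hrβ, hrb, hQr z (hWQ z (by simp))⟩)
    simp at h0

variable [DecidableEq V]

theorem MinConf.endConf (hD : DiamondFree H) (hC : ClawFree H)
    (hT : ∀ P, IndPath H P → P.length < 7) {u v : V} {Q₁ Q₂ P : List V}
    (h : MinConf H u v Q₁ Q₂ P) : ∃ a b a' b' c r β y, EndConf H u v a b a' b' c r β y := by
  have hc := h.1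
  obtain ⟨a, A, rfl⟩ : ∃ a A, Q₁ = a :: A := by
    cases Q₁ with
    | nil => exact hc.not_adj.elim
    | cons a A => exact ⟨a, A, rfl⟩
  obtain ⟨b', B, rfl⟩ : ∃ b' B, Q₂ = b' :: B := by
    cases Q₂ with
    | nil => exact hc.flip.not_adj.elim
    | cons b' B => exact ⟨b', B, rfl⟩
  obtain ⟨Z₁, b, hZ₁⟩ := concat_decomp a A
  obtain ⟨Z₂, a', hZ₂⟩ := concat_decomp b' B
  have hcb : Conf H u v (Z₁ ++ [b]) (b' :: B) P := hZ₁ ▸ hc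
  have hca : Conf H u v (a :: A) (Z₂ ++ [a']) P := hZ₂ ▸ hc
  have hua : H.Adj u a := hc.link₁.1
  have hbv : H.Adj b v := (link_concat.1 hcb.link₁).2
  have hvb' : H.Adj v b' := hc.link₂.1
  have ha'u : H.Adj a' u := (link_concat.1 hca.link₂).2
  have haa' : H.Adj a a' := hca.adj_ends hC
  have hbb' : H.Adj b b' := hcb.adj_ends' hC
  have hva : ¬ H.Adj v a := hc.not_adj_v_head hC
  have hub : ¬ H.Adj u b := hcb.not_adj_u_last hC
  have hva' : ¬ H.Adj v a' := hca.not_adj_v_last₂ hC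
  obtain ⟨c, A, rfl⟩ : ∃ c A', A = c :: A' := by
    cases A with
    | nil => exact absurd hc.link₁.2.symm hva
    | cons c A => exact ⟨c, A, rfl⟩
  have hac : H.Adj a c := hc.link₁.2.1
  have hcb_ne : c ≠ b := by
    rintro rfl
    exact hc.not_adj_run_second hC (F₁ := []) (by simp) hbb'
  -- Here `y` is the first vertex of `Q₂` not adjacent to `v`; it exists because `a'` qualifies. Its
  -- predecessor `β` ends the run along which `v` can be moved.
  obtain ⟨F, y, F', hFy, hyv, hF⟩ := exists_split_first (fun x => ¬ H.Adj x v) (b' :: B)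
    ⟨a', by rw [hZ₂]; simp, fun h => hva' h.symm⟩
  push Not at hF
  obtain ⟨F, β, rfl⟩ : ∃ F₀ β, F = F₀ ++ [β] := by
    rcases List.eq_nil_or_concat F with rfl | ⟨F₀, β, rfl⟩
    · simp at hFy
      obtain ⟨rfl, -⟩ := hFy
      exact absurd hvb'.symm hyv
    · exact ⟨F₀, β, by simp⟩
  have hcy : Conf H u v (a :: c :: A) ((F ++ [β]) ++ y :: F') P := hFy ▸ hc
  have hcβ : Conf H u v (a :: c :: A) (F ++ β :: y :: F') P := by simpa using hcy
  have hF0 : ∀ x ∈ F, H.Adj x v := fun x hx => hF x (by simp [hx])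
  have hβv : H.Adj β v := hF β (by simp)
  have hβy : H.Adj β y := (link_append.1 hcβ.link₂).2.1
  have hPβ : ∀ p ∈ P, ¬ H.Adj p β := fun p hp => hcβ.not_adj_run_P hC hF0 hp
  have hPy : ∀ p ∈ P, ¬ H.Adj p y := fun p hp => hcy.not_adj_run_P hC hF hp
  have hβu : ¬ H.Adj β u := hcβ.not_adj_run_u hC hF0
  have hyu : ¬ H.Adj y u := hcy.not_adj_run_u hC hF
  have haβ : ¬ H.Adj a β := hcβ.not_adj_run_head hC hF0
  have hay : ¬ H.Adj a y := hcy.not_adj_run_head hC hF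
  have hcβ' : ¬ H.Adj c β := hcβ.not_adj_run_second hC hF0
  have hcy' : ¬ H.Adj c y := hcy.not_adj_run_second hC hF
  have hPQ : ∀ q ∈ a :: c :: A, ∀ p ∈ P, ¬ H.Adj p q := fun q hq p hp => h.not_adj_P hq hp
  have hQu : ∀ q ∈ a :: c :: A, H.Adj u q → q = a := fun q hq hqu =>
    h.eq_head_of_adj hC hq hqu.symm
  have hQv : ∀ q ∈ a :: c :: A, H.Adj v q → q = b := by
    intro q hq hqv
    have h' := h
    rw [hZ₁] at h' hq
    exact h'.eq_last_of_adj hC hq hqv.symm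
  have hbm : b ∈ a :: c :: A := by rw [hZ₁]; simp
  have hn := hcβ.nodup
  rw [List.nodup_cons] at hn
  obtain ⟨hnu, hn⟩ := hn
  rw [List.nodup_append] at hn
  obtain ⟨hnQ, hn2, hnQ2⟩ := hn
  rw [List.nodup_cons, List.nodup_append] at hn2
  obtain ⟨hnv, hn2⟩ := hn2
  obtain ⟨hnF, hnP, hnFP⟩ := hn2
  have hβm : β ∈ F ++ β :: y :: F' := by simp
  have hym : y ∈ F ++ β :: y :: F' := by simp
  have huQ : u ∉ a :: c :: A := fun h => hnu (List.mem_append_left _ h)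
  have huv : u ≠ v := by rintro rfl; exact hnu (by simp)
  have huβ : u ≠ β := by rintro rfl; exact hnu (by simp)
  have huy : u ≠ y := by rintro rfl; exact hnu (by simp)
  have huP : u ∉ P := fun h => hnu (by simp [h])
  have hvQ : v ∉ a :: c :: A := fun h => hnQ2 v h v (by simp) rfl
  have hvβ : v ≠ β := hβv.ne.symm
  have hvy : v ≠ y := by rintro rfl; exact hnv (by simp)
  have hvP : v ∉ P := fun h => hnv (by simp [h])
  have hβQ : β ∉ a :: c :: A := fun h => hnQ2 β h β (by simp) rfl
  have hyQ : y ∉ a :: c :: A := fun h => hnQ2 y h y (by simp) rfl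
  have hPQne : ∀ p ∈ P, ∀ q ∈ a :: c :: A, p ≠ q := by
    rintro p hp q hq rfl
    exact hnQ2 p hq p (by simp [hp]) rfl
  have hPβne : ∀ p ∈ P, p ≠ β := by rintro p hp rfl; exact hnFP p hβm p hp rfl
  have hPyne : ∀ p ∈ P, p ≠ y := by rintro p hp rfl; exact hnFP p hym p hp rfl
  have hca_ne : c ≠ a := hac.ne.symm
  have hau : a ≠ u := hua.ne.symm
  have hcm : c ∈ a :: c :: A := by simp
  have ham : a ∈ a :: c :: A := by simp
  have hcu : ¬ H.Adj c u := fun hh => hca_ne (hQu c hcm hh.symm)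
  have hcv : ¬ H.Adj c v := fun hh => hcb_ne (hQv c hcm hh.symm)
  have hne : ∀ q ∈ a :: c :: A, q ≠ u ∧ q ≠ v ∧ q ≠ β ∧ q ≠ y := by
    intro q hq
    refine ⟨?_, ?_, ?_, ?_⟩ <;> rintro rfl <;> contradiction
  have hab : a ≠ b := by rintro rfl; exact hva hbv.symm
  have hbβ : H.Adj b β := by
    obtain ⟨P', r', hP'⟩ : ∃ P' r', P = P' ++ [r'] := by
      rcases List.eq_nil_or_concat P with rfl | ⟨P', r', rfl⟩
      · exact absurd rfl hc.ne
      · exact ⟨P', r', by simp⟩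
    have hr' : r' ∈ P := by simp [hP']
    have hr'v : H.Adj r' v := by
      have := hc.linkP
      rw [hP'] at this
      exact (link_concat.1 this).2
    rcases hC v r' b β hr'v.symm hbv.symm hβv.symm (hPQne r' hr' b hbm) (hPβne r' hr')
      (hne b hbm).2.2.1 with h1 | h1 | h1
    · exact absurd h1 (hPQ b hbm r' hr')
    · exact absurd h1 (hPβ r' hr')
    · exact h1
  have hby : ¬ H.Adj b y := by
    intro hby
    exact hyv (hD hbβ hby hbv hβy hβv hvy.symm)
  -- If `u` and `v` were nonadjacent, an induced path between them through `P` would have an inner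
  -- vertex, and with `c, a` in front and `β, y` behind it would have at least seven vertices.
  by_cases huv' : H.Adj u v
  swap
  · exfalso
    obtain ⟨L, hLs, hLp, hLi⟩ := hc.linkP.pth.exists_indPath
    obtain ⟨L, rfl⟩ : ∃ L', L = L' ++ [v] := by
      rcases List.eq_nil_or_concat L with rfl | ⟨L', z, rfl⟩
      · exact absurd rfl hLp.ne_nil
      · rw [List.concat_eq_append] at hLp ⊢
        exact ⟨L', by rw [hLp.last_eq]⟩
    obtain ⟨L, rfl⟩ : ∃ L', L = u :: L' := by
      cases L with
      | nil => exact absurd hLp.head_eq.symm huv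
      | cons z t => exact ⟨t, by rw [(show Pth H (z :: (t ++ [v])) u v from hLp).head_eq]⟩
    have hLP : ∀ x ∈ L, x ∈ P := by
      intro x hx
      have hn := hLi.nodup
      have h1 : x ∈ u :: (P ++ [v]) := hLs.subset (by simp [hx])
      simp only [List.mem_cons, List.mem_append, List.not_mem_nil, or_false] at h1
      rcases h1 with rfl | h1 | rfl
      · simp [hx] at hn
      · exact h1
      · simp only [List.nodup_append] at hn
        exact absurd rfl (hn.2.2 x (List.mem_cons_of_mem _ hx) x (List.mem_singleton_self x))
    have hL : L ≠ [] := by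
      rintro rfl
      exact huv' (List.isChain_cons_cons.1 hLp.1).1
    have hi : IndPath H ((u :: L) ++ v :: [β, y]) := by
      refine indPath_append.2 ⟨hLi, ⟨hβv.symm, ?_, hβy, by simp, trivial⟩, ?_⟩
      · simp only [List.mem_singleton, forall_eq]
        exact ⟨fun h => hyv h.symm, hvy⟩
      · simp only [List.mem_cons, List.not_mem_nil, or_false, forall_eq_or_imp, forall_eq]
        refine ⟨⟨⟨fun h => hβu h.symm, huβ⟩, fun h => hyu h.symm, huy⟩, fun x hx => ?_⟩
        have hxP := hLP x hx
        exact ⟨⟨hPβ x hxP, hPβne x hxP⟩, hPy x hxP, hPyne x hxP⟩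
    have hfar : ∀ q ∈ a :: c :: A, ∀ x ∈ L, ¬ H.Adj q x ∧ q ≠ x := fun q hq x hx =>
      ⟨fun h => hPQ q hq x (hLP x hx) h.symm, (hPQne x (hLP x hx) q hq).symm⟩
    have hi2 : IndPath H (c :: a :: ((u :: L) ++ v :: [β, y])) := by
      refine ⟨hac.symm, ?_, hua.symm, ?_, hi⟩
      · intro x hx
        simp only [List.mem_append, List.mem_cons, List.not_mem_nil, or_false] at hx
        have := hne c hcm
        rcases hx with (rfl | hx) | rfl | rfl | rfl
        · exact ⟨hcu, this.1⟩
        · exact hfar c hcm x hx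
        · exact ⟨hcv, this.2.1⟩
        · exact ⟨hcβ', this.2.2.1⟩
        · exact ⟨hcy', this.2.2.2⟩
      · intro x (hx : x ∈ L ++ v :: [β, y])
        simp only [List.mem_append, List.mem_cons, List.not_mem_nil, or_false] at hx
        have := hne a ham
        rcases hx with hx | rfl | rfl | rfl
        · exact hfar a ham x hx
        · exact ⟨fun h => hva h.symm, this.2.1⟩
        · exact ⟨haβ, this.2.2.1⟩
        · exact ⟨hay, this.2.2.2⟩
    have h7 := hT _ hi2
    have := List.length_pos_of_ne_nil hL
    simp at h7
    omega
  obtain ⟨r, P', hP'⟩ := List.exists_cons_of_ne_nil hc.ne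
  have hrP : r ∈ P := by simp [hP']
  have hur : H.Adj u r := by
    have := hc.linkP
    rw [hP'] at this
    exact this.1
  have hrv : r ≠ v := by rintro rfl; exact hvP hrP
  have hvr : H.Adj v r := by
    rcases hC u r v a hur huv' hua hrv (hPQne r hrP a ham) (hne a ham).2.1.symm with h1 | h1 | h1
    · exact h1.symm
    · exact absurd h1 (hPQ a ham r hrP)
    · exact absurd h1 hva
  by_cases hab' : H.Adj a b
  swap
  · have hW : Pth H (a :: c :: A) a b := by
      refine ⟨?_, rfl, by rw [hZ₁]; simp⟩
      have := hc.link₁.pth.1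
      exact (List.isChain_append.1 (List.isChain_cons.1 this).2).1
    exact (no_indPath_through_cycle hD hC hT hW hQu hQv
      (fun q hq => ⟨hPQ q hq r hrP, hPQne r hrP q hq⟩) huQ hvQ hβQ hyQ hua hur.symm hβv.symm
      (fun h => hyv h.symm) hvy hβy hbβ hby ⟨hPβ r hrP, hPβne r hrP⟩ ⟨hPy r hrP, hPyne r hrP⟩
      ⟨fun h => hβu h.symm, huβ⟩ ⟨fun h => hyu h.symm, huy⟩ haβ hay hab' hab).elim
  have hbc : H.Adj b c := by
    rcases hC a u b c hua.symm hab' hac (hne b hbm).1.symm (hne c hcm).1.symm hcb_ne.symm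
      with h1 | h1 | h1
    · exact absurd h1 hub
    · exact absurd h1.symm hcu
    · exact h1
  have hnc := hne c hcm
  have hna := hne a ham
  have hnb := hne b hbm
  refine ⟨a, b, a', b', c, r, β, y, ?_, ?_, hur, hvr, hPQ c hcm r hrP, hPy r hrP, hbc, hac, hcy',
    haa', ha'u.symm, hbv.symm, hvb', hbb'⟩
  · simp only [IndPath, List.mem_cons, List.not_mem_nil, or_false, forall_eq_or_imp, forall_eq,
      and_true, IsEmpty.forall_iff, implies_true]
    exact ⟨hac.symm, ⟨⟨hcu, hnc.1⟩, ⟨hcv, hnc.2.1⟩, ⟨hcβ', hnc.2.2.1⟩, hcy', hnc.2.2.2⟩, hua.symm,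
      ⟨⟨fun h => hva h.symm, hna.2.1⟩, ⟨haβ, hna.2.2.1⟩, hay, hna.2.2.2⟩, huv',
      ⟨⟨fun h => hβu h.symm, huβ⟩, fun h => hyu h.symm, huy⟩, hβv.symm,
      ⟨fun h => hyv h.symm, hvy⟩, hβy⟩
  · simp only [IndPath, List.mem_cons, List.not_mem_nil, or_false, forall_eq_or_imp, forall_eq,
      and_true, IsEmpty.forall_iff, implies_true]
    exact ⟨hβy.symm, ⟨⟨fun h => hby h.symm, hnb.2.2.2.symm⟩, ⟨fun h => hay h.symm, hna.2.2.2.symm⟩,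
      ⟨hyu, huy.symm⟩, fun h => hPy r hrP h.symm, (hPyne r hrP).symm⟩, hbβ.symm,
      ⟨⟨fun h => haβ h.symm, hna.2.2.1.symm⟩, ⟨hβu, huβ.symm⟩, fun h => hPβ r hrP h.symm,
        (hPβne r hrP).symm⟩, hab'.symm,
      ⟨⟨fun h => hub h.symm, hnb.1⟩, fun h => hPQ b hbm r hrP h.symm,
        (hPQne r hrP b hbm).symm⟩, hua.symm,
      ⟨fun h => hPQ a ham r hrP h.symm, (hPQne r hrP a ham).symm⟩, hur⟩

end Endgame

/-! ### Connectivity and the final contradictions -/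

section Main

variable {V : Type*}

theorem CutConnected.mono {G H : SimpleGraph V} (h : CutConnected G) (hle : G ≤ H) :
    CutConnected H := fun A hx hy => by
  obtain ⟨x, y, h1, h2, h3⟩ := h A hx hy
  exact ⟨x, y, h1, h2, hle h3⟩

theorem CutTwoConnected.mono {G H : SimpleGraph V} (h : CutTwoConnected G) (hle : G ≤ H) :
    CutTwoConnected H := fun u A hu hx hy => by
  obtain ⟨x, y, h1, h2, h3, h4⟩ := h u A hu hx hy
  exact ⟨x, y, h1, h2, h3, hle h4⟩

theorem cutConnected_of_connected {G : SimpleGraph V} (h : G.Connected) : CutConnected G := by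
  rintro A ⟨x, hx⟩ ⟨y, hy⟩
  obtain ⟨w⟩ := h.preconnected x y
  obtain ⟨d, -, h1, h2⟩ := w.exists_boundary_dart A hx hy
  exact ⟨d.fst, d.snd, h1, h2, d.adj⟩

theorem TwoConnected.cutTwoConnected [Fintype V] {G : SimpleGraph V} (h : TwoConnected G) :
    CutTwoConnected G := by
  rintro u A hu ⟨x, hx⟩ ⟨y, hy, hyu⟩
  have hxu : x ≠ u := by rintro rfl; exact hu hx
  obtain ⟨x', y', h1, h2, h3⟩ := cutConnected_of_connected (h.2.2 u) {w | w.1 ∈ A}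
    ⟨⟨x, hxu⟩, hx⟩ ⟨⟨y, hyu⟩, hy⟩
  exact ⟨x'.1, y'.1, h1, h2, y'.2, h3⟩

variable [Fintype V] {G : SimpleGraph V} [DecidableRel G.Adj]
  {u v a b a' b' c r β y : V}

/-- The two induced paths are spines of deer with tops `r` and `c`; they make `u` and `b` heavy,
although these are nonadjacent in `star G`. -/
theorem EndConf.false_of_deer (h : EndConf (star G) u v a b a' b' c r β y)
    (hc : IsFHeavyFor claw G) (h7 : IsFHeavyFor path7 G) (hD : IsFHeavyFor deer G) : False := by
  have h1 : Heavy G u := star_deer_heavy hc h7 hD h.ind₁ h.ur h.vr h.rc h.ry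
  have h2 : Heavy G b := star_deer_heavy hc h7 hD h.ind₂ h.bc h.ac h.cy fun hh => h.rc hh.symm
  have h3 := h.ind₂.2.2.2.2.2.1 u (by simp)
  exact h3.1 (star_adj_of_heavy h2 h1 h3.2)

/-- The hourglass at `a` puts the unique clique with two heavy vertices on `au` or on `ab`. In the
first case the hourglass at `b` shows that it contains `b`, in the second the one at `u` shows that
it contains `u`; either way `u` and `b` would be adjacent. -/
theorem EndConf.false_of_hourglass (h : EndConf (star G) u v a b a' b' c r β y)
    (hc : IsFHeavyFor claw G) (hG : IsFHeavyFor hourglass G) : False := by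
  have hbu := h.ind₂.2.2.2.2.2.1 u (by simp)
  have hav := h.ind₁.2.2.2.1 v (by simp)
  have hau : (star G).Adj a u := h.ind₁.2.2.1
  have huv : (star G).Adj u v := h.ind₁.2.2.2.2.1
  have hba : (star G).Adj b a := h.ind₂.2.2.2.2.1
  have hbu' : ∀ p q, (star G).Adj p q → b ∈ clq (star G) p q → u ∈ clq (star G) p q → False :=
    fun p q hpq hb hu => hbu.1 (IsClosedGraph.star.adj_clq hpq hb hu hbu.2)
  have ka := star_hourglass_heavy hc hG hau h.aa' h.ua' hba.symm h.ac h.bc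
    (fun hh => hbu.1 hh.symm) hbu.2.symm
  have ku := star_hourglass_heavy hc hG huv h.ur h.vr hau.symm h.ua' h.aa'
    (fun hh => hav.1 hh.symm) hav.2.symm
  have kb := star_hourglass_heavy hc hG h.vb.symm h.bb' h.vb' hba h.bc h.ac
    (fun hh => hav.1 hh.symm) hav.2.symm
  rcases ka with ka | ka
  · rcases kb with kb | kb
    · exact hbu' a u hau ((ka.clq_eq hau kb h.vb.symm) ▸ left_mem_clq) right_mem_clq
    · exact hbu' a u hau ((ka.clq_eq hau kb hba) ▸ left_mem_clq) right_mem_clq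
  · rcases ku with ku | ku
    · exact hbu' a b hba.symm right_mem_clq ((ka.clq_eq hba.symm ku huv) ▸ left_mem_clq)
    · exact hbu' a b hba.symm right_mem_clq ((ka.clq_eq hba.symm ku hau.symm) ▸ left_mem_clq)

end Main

end FanHeavy

theorem theorem5 {V : Type*} [Fintype V] [DecidableEq V] (G : SimpleGraph V)
    [DecidableRel G.Adj] (h2 : FanHeavy.TwoConnected G)
    (hG : (FanHeavy.IsFHeavyFor FanHeavy.claw G ∧ FanHeavy.IsFHeavyFor FanHeavy.path7 G ∧
            FanHeavy.IsFHeavyFor FanHeavy.deer G) ∨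
          (FanHeavy.IsFHeavyFor FanHeavy.claw G ∧ FanHeavy.IsFHeavyFor FanHeavy.path7 G ∧
            FanHeavy.IsFHeavyFor FanHeavy.hourglass G)) :
    G.IsHamiltonian := by
  open FanHeavy in
  have hc : IsFHeavyFor claw G := hG.elim (fun h => h.1) fun h => h.1
  have h7 : IsFHeavyFor path7 G := hG.elim (fun h => h.2.1) fun h => h.2.1
  have hW : WeakClawFree G := hc.weakClawFree
  refine ((star_spec h2.1 hW).1 ?_).isHamiltonian h2.1
  by_contra hno
  obtain ⟨u, v, Q₁, Q₂, P, h⟩ := exists_conf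
    ((cutConnected_of_connected h2.2.1).mono le_star) (h2.cutTwoConnected.mono le_star)
    (le_trans (by norm_num) h2.1) hno
  obtain ⟨u, v, Q₁, Q₂, P, h⟩ := exists_minConf h
  obtain ⟨a, b, a', b', c, r, β, y, he⟩ := h.endConf IsClosedGraph.star.diamond
    (fun x a b c ha hb hc hab hac hbc => star_claw h2.1 hW ha hb hc hab hac hbc)
    (fun P hP => star_indPath_length hc h7 hP)
  rcases hG with hG | hG
  · exact he.false_of_deer hc h7 hG.2.2
  · exact he.false_of_hourglass hc hG.2.2
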